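/- \textbf{Setting.} Consider the linear system $x_{t+1}=Ax_t+Ba_t+w_{t+1}$ with states $x_t\in\mathbb R^n$, actions $a_t\in\mathbb R^d$, i.i.d. noise $w_t\sim\mathcal N(0,W)$ ($W\succeq 0$), and cost $c(x,a)=x^\top Mx+a^\top Na$ with $M,N\succ0$. Let $x\mapsto -Kx$ be a linear policy that is stable, i.e. the spectral radius of $A-BK$ is less than $1$. Let $\Sigma_\pi$ be the unique solution of $\Sigma=(A-BK)\Sigma(A-BK)^\top+W$ (the stationary state covariance), let $G$ be the unique solution of $$G=\begin{pmatrix}A^\top\\B^\top\end{pmatrix}\begin{pmatrix}I&-K^\top\end{pmatrix}G\begin{pmatrix}I\\-K\end{pmatrix}\begin{pmatrix}A&B\end{pmatrix}+\begin{pmatrix}M&0\\0&N\end{pmatrix}$$ (the matrix of the state-action value function of the policy), and let $H=\begin{pmatrix}I&-K^\top\end{pmatrix}G\begin{pmatrix}I\\-K\end{pmatrix}$ be its value matrix. Let $\Sigma_a$ be the exploration covariance and $\Sigma_{G,\pi}=A\Sigma_\pi A^\top+B\Sigma_aB^\top$. \textbf{Data and estimate.} Exploratory data are collected along one trajectory: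 repeatedly, the policy is executed for $s-1$ rounds, then in the state $x$ so reached a random action $a\sim\mathcal N(0,\Sigma_a)$ is taken, the next state $x_+$ is observed, and $(x,a,x_+)$ is recorded; this gives tuples $(x_k,a_k,x_{+,k})$, $k=1,\dots,\tau$. The collection starts in a state $x_{\rm init}\sim\mathcal N(m_0,\Sigma_0)$ (possibly deterministic). Let $\widehat H$ be a random symmetric matrix (an estimate of $H$). The pair $(x_{\rm init},\widehat H)$, the noise sequence during the collection, and the i.i.d. sequence of exploratory actions are independent; $x_{\rm init}$ and $\widehat H$ may depend on each other. Let $\mathrm{vec}$ be the vectorization of symmetric matrices with $\mathrm{vec}(X)^\top\mathrm{vec}(Y)=\mathrm{tr}(XY)$ (one coordinate per unordered pair of indices), let $\Psi$ be the matrix with rows $\mathrm{vec}(z_kz_k^\top)$, $z_k^\top=(x_k^\top,a_k^\top)$, let $\Phi_+$ have rows $\mathrm{vec}(x_{+,k}x_{+,k}^\top)$, let $\mathbf W$ have all rows equal to $\mathrm{vec}(W)$, and let $\mathbf c=(c(x_k,a_k))_k$. The least-squares estimate is the symmetric matrix $\widehat G$ given by $$\mathrm{vec}(\widehat G)=(\Psi^\top\Psi)^{-1}\Psi^\top\big(\mathbf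 c+(\Phi_+-\mathbf W)\,\mathrm{vec}(\widehat H)\big).$$ Below, $\|\cdot\|$ is the spectral norm and $\|\cdot\|_F$ the Frobenius norm. \textbf{Lemma.} There is an absolute exponent $q\in\mathbb N$, and for every $\kappa>0$ a constant $C$ depending only on $\kappa$, such that the following holds for all $n,d$ and all systems and policies as above with $\Sigma_\pi\succeq\kappa I$, $\Sigma_a\succeq\kappa I$, every nonzero eigenvalue of $W$ at least $\kappa$, and $\|\Sigma_{G,\pi}\|_F\ge\kappa$. For every $R$ there are $s_0$ and $\tau_0$, depending only on the system, the policy, $\Sigma_a$, $\kappa$ and $R$, such that if $\|m_0\|\le R$, $\mathrm{tr}(\Sigma_0)\le R$, $s\ge s_0$, $0<\delta_1<1$ and $\tau\ge\tau_0(1+\log(1/\delta_1))^q$, then with probability at least $1-\delta_1$ the matrix $\Psi^\top\Psi$ is invertible and $$\|G-\widehat G\|_F\le C\Big(\mathrm{tr}(\Sigma_{G,\pi})\,\|H-\widehat H\|+\tau^{-1/2}\,\|W\widehat H\|_F\,\big(\mathrm{tr}(\Sigma_\pi)+\mathrm{tr}(\Sigma_a)\big)\,\|\Sigma_{G,\pi}\|_F\,\big(1+\log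 n^2+\log\tfrac1{\delta_1}+\log\tau\big)^q\Big),$$ and on the same event the same bound holds with $\widehat G$ replaced by its Frobenius-orthogonal projection onto $\{Y:\ Y\succeq\begin{pmatrix}M&0\\0&N\end{pmatrix}\}$. -/

import Mathlib

open MeasureTheory ProbabilityTheory Matrix

universe u

noncomputable section

/-- The Frobenius norm of a real matrix. -/
def frobNorm {m k : Type*} [Fintype m] [Fintype k] (X : Matrix m k ℝ) : ℝ :=
  Real.sqrt (∑ i, ∑ j, X i j ^ 2)

/-- The spectral norm of a square real matrix: the operator norm for the Euclidean norm. -/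
def specNorm {m : Type*} [Fintype m] [DecidableEq m] (X : Matrix m m ℝ) : ℝ :=
  ‖Matrix.toEuclideanCLM (n := m) (𝕜 := ℝ) X‖

/-- Vectorization of a symmetric matrix, with one coordinate per unordered pair of indices and the
off-diagonal entries multiplied by `√2`, so that `svec X ⬝ᵥ svec Y = tr (X * Y)` for symmetric
`X`, `Y`. The entry is written symmetrically in `i`, `j`; it is `X i j` when `X` is symmetric. -/
def svec {ι : Type*} [DecidableEq ι] (X : Matrix ι ι ℝ) : Sym2 ι → ℝ :=
  Sym2.lift ⟨fun i j => (if i = j then 1 else Real.sqrt 2) * ((X i j + X j i) / 2), fun i j => by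
    simp only [eq_comm (a := i) (b := j), add_comm (X i j) (X j i)]⟩

/-- The symmetric matrix with a given vectorization (the inverse of `svec`). -/
def smat {ι : Type*} [DecidableEq ι] (v : Sym2 ι → ℝ) : Matrix ι ι ℝ :=
  Matrix.of fun i j => (if i = j then 1 else (Real.sqrt 2)⁻¹) * v s(i, j)

/-- A linear quadratic control problem `x₊ = A x + B a + w`, `w ∼ 𝒩(0, W)`, with
cost `xᵀ M x + aᵀ N a`, state space `ℝⁿ` and action space `ℝᵈ`. -/
structure LQProblem (n d : ℕ) where
  A : Matrix (Fin n) (Fin n) ℝ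
  B : Matrix (Fin n) (Fin d) ℝ
  M : Matrix (Fin n) (Fin n) ℝ
  N : Matrix (Fin d) (Fin d) ℝ
  W : Matrix (Fin n) (Fin n) ℝ
  posDef_M : M.PosDef
  posDef_N : N.PosDef
  posSemidef_W : W.PosSemidef

namespace LQProblem

variable {n d : ℕ} (S : LQProblem n d)

/-- The cost of taking action `u` in state `x`. -/
def cost (x : Fin n → ℝ) (u : Fin d → ℝ) : ℝ :=
  x ⬝ᵥ (S.M *ᵥ x) + u ⬝ᵥ (S.N *ᵥ u)

/-- The linear policy `x ↦ -K x` is stable: the spectral radius of `A - B K` is less than one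
(complex eigenvalues included). -/
def IsStable (K : Matrix (Fin d) (Fin n) ℝ) : Prop :=
  spectralRadius ℂ ((S.A - S.B * K).map (algebraMap ℝ ℂ)) < 1

/-- `Sig` solves the Lyapunov equation of the policy `x ↦ -K x`; for a stable policy the solution is
unique, and it is the covariance of the stationary state distribution. -/
def IsStationaryCov (K : Matrix (Fin d) (Fin n) ℝ) (Sig : Matrix (Fin n) (Fin n) ℝ) : Prop :=
  Sig = (S.A - S.B * K) * Sig * (S.A - S.B * K)ᵀ + S.W

/-- The block matrix `diag(M, N)`. -/
def costMatrix : Matrix (Fin n ⊕ Fin d) (Fin n ⊕ Fin d) ℝ :=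
  Matrix.fromBlocks S.M 0 0 S.N

/-- The matrix `(I  -Kᵀ) G (I ; -K)`: the matrix of `x ↦ Q(x, -K x)` when `Q` has matrix `G`. -/
def valueMatrix (K : Matrix (Fin d) (Fin n) ℝ)
    (G : Matrix (Fin n ⊕ Fin d) (Fin n ⊕ Fin d) ℝ) : Matrix (Fin n) (Fin n) ℝ :=
  Matrix.fromCols (1 : Matrix (Fin n) (Fin n) ℝ) (-Kᵀ) * G *
    Matrix.fromRows (1 : Matrix (Fin n) (Fin n) ℝ) (-K)

/-- `G` solves the evaluation equation of the policy `x ↦ -K x`; for a stable policy the solution is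
unique, and it is the matrix of the state-action value function of the policy. -/
def IsStateActionMatrix (K : Matrix (Fin d) (Fin n) ℝ)
    (G : Matrix (Fin n ⊕ Fin d) (Fin n ⊕ Fin d) ℝ) : Prop :=
  G = Matrix.fromRows S.Aᵀ S.Bᵀ * valueMatrix K G * Matrix.fromCols S.A S.B + S.costMatrix

/-- The matrix `Σ_G = A Σ Aᵀ + B Σₐ Bᵀ`. -/
def nextCov (Sig : Matrix (Fin n) (Fin n) ℝ) (SigA : Matrix (Fin d) (Fin d) ℝ) :
    Matrix (Fin n) (Fin n) ℝ :=
  S.A * Sig * S.Aᵀ + S.B * SigA * S.Bᵀ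

/-- The states visited while data are collected with exploration period `s`: in each block of `s`
rounds the policy `x ↦ -K x` is executed for `s - 1` rounds, and in the last round of block `k` the
exploratory action `a k` is taken. The noise in round `t` is `w t`. -/
def trajectory (K : Matrix (Fin d) (Fin n) ℝ) (s : ℕ) (x₀ : Fin n → ℝ) (w : ℕ → Fin n → ℝ)
    (a : ℕ → Fin d → ℝ) : ℕ → Fin n → ℝ
  | 0 => x₀
  | t + 1 =>
      S.A *ᵥ trajectory K s x₀ w a t
        + S.B *ᵥ (if (t + 1) % s = 0 then a (t / s) else -(K *ᵥ trajectory K s x₀ w a t))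
        + w t

/-- The state in which the exploratory action `a k` is taken. -/
def exploreState (K : Matrix (Fin d) (Fin n) ℝ) (s : ℕ) (x₀ : Fin n → ℝ) (w : ℕ → Fin n → ℝ)
    (a : ℕ → Fin d → ℝ) (k : ℕ) : Fin n → ℝ :=
  S.trajectory K s x₀ w a (k * s + (s - 1))

/-- The state observed right after the exploratory action `a k`. -/
def nextState (K : Matrix (Fin d) (Fin n) ℝ) (s : ℕ) (x₀ : Fin n → ℝ) (w : ℕ → Fin n → ℝ)
    (a : ℕ → Fin d → ℝ) (k : ℕ) : Fin n → ℝ :=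
  S.trajectory K s x₀ w a ((k + 1) * s)

/-- The design matrix `Ψ`, with rows `vec(z zᵀ)`, `z = (x, a)`, over the first `τ` exploratory
tuples. -/
def designMatrix (K : Matrix (Fin d) (Fin n) ℝ) (s : ℕ) (x₀ : Fin n → ℝ) (w : ℕ → Fin n → ℝ)
    (a : ℕ → Fin d → ℝ) (τ : ℕ) : Matrix (Fin τ) (Sym2 (Fin n ⊕ Fin d)) ℝ :=
  Matrix.of fun k =>
    svec (Matrix.vecMulVec (Sum.elim (S.exploreState K s x₀ w a k) (a k))
      (Sum.elim (S.exploreState K s x₀ w a k) (a k)))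

/-- The regression targets `c + (Φ₊ - 𝐖) vec(Ĥ)` over the first `τ` exploratory tuples. -/
def targetVec (K : Matrix (Fin d) (Fin n) ℝ) (s : ℕ) (x₀ : Fin n → ℝ) (w : ℕ → Fin n → ℝ)
    (a : ℕ → Fin d → ℝ) (Hhat : Matrix (Fin n) (Fin n) ℝ) (τ : ℕ) : Fin τ → ℝ :=
  fun k => S.cost (S.exploreState K s x₀ w a k) (a k) +
    (svec (Matrix.vecMulVec (S.nextState K s x₀ w a k) (S.nextState K s x₀ w a k)) - svec S.W)
      ⬝ᵥ svec Hhat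

/-- The least-squares estimate `Ĝ`, given by
`vec(Ĝ) = (Ψᵀ Ψ)⁻¹ Ψᵀ (c + (Φ₊ - 𝐖) vec(Ĥ))`. -/
def estimate (K : Matrix (Fin d) (Fin n) ℝ) (s : ℕ) (x₀ : Fin n → ℝ) (w : ℕ → Fin n → ℝ)
    (a : ℕ → Fin d → ℝ) (Hhat : Matrix (Fin n) (Fin n) ℝ) (τ : ℕ) :
    Matrix (Fin n ⊕ Fin d) (Fin n ⊕ Fin d) ℝ :=
  smat (((S.designMatrix K s x₀ w a τ)ᵀ * S.designMatrix K s x₀ w a τ)⁻¹ *ᵥ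
    ((S.designMatrix K s x₀ w a τ)ᵀ *ᵥ S.targetVec K s x₀ w a Hhat τ))

end LQProblem

/-- `P` is the orthogonal projection (for the Frobenius norm) of `X` onto the convex set of
matrices `Y` with `Y ⪰ D`. -/
def IsFrobProj {ι : Type*} [Fintype ι] (D X P : Matrix ι ι ℝ) : Prop :=
  (P - D).PosSemidef ∧ ∀ Y : Matrix ι ι ℝ, (Y - D).PosSemidef → frobNorm (P - X) ≤ frobNorm (Y - X)

/-- The randomness of one data collection on a probability space: the initial state `x₀` is
Gaussian `𝒩(m₀, Σ₀)` (deterministic if `Σ₀ = 0`), the noise vectors `w t` are i.i.d. `𝒩(0, W)`, the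
exploratory actions `a k` are i.i.d. `𝒩(0, Σₐ)`, and the pair `(x₀, Ĥ)`, the noise sequence and the
action sequence are independent. The initial state and the symmetric random matrix `Ĥ` may depend
on each other in any way. -/
structure IsDataCollection {n d : ℕ} {Ω : Type*} [MeasurableSpace Ω] (μ : Measure Ω)
    (W : Matrix (Fin n) (Fin n) ℝ) (SigA : Matrix (Fin d) (Fin d) ℝ)
    (m₀ : EuclideanSpace ℝ (Fin n)) (Sig₀ : Matrix (Fin n) (Fin n) ℝ)
    (x₀ : Ω → EuclideanSpace ℝ (Fin n)) (Hhat : Ω → Matrix (Fin n) (Fin n) ℝ)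
    (w : ℕ → Ω → EuclideanSpace ℝ (Fin n)) (a : ℕ → Ω → EuclideanSpace ℝ (Fin d)) : Prop where
  measurable_init : Measurable x₀
  measurable_est : ∀ i j, Measurable fun ω => Hhat ω i j
  measurable_noise : ∀ t, Measurable (w t)
  measurable_action : ∀ k, Measurable (a k)
  isSymm_est : ∀ ω, (Hhat ω).IsSymm
  law_init : HasLaw x₀ (multivariateGaussian m₀ Sig₀) μ
  law_noise : ∀ t, HasLaw (w t) (multivariateGaussian 0 W) μ
  law_action : ∀ k, HasLaw (a k) (multivariateGaussian 0 SigA) μ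
  indep_noise : iIndepFun w μ
  indep_action : iIndepFun a μ
  indep_noise_action : IndepFun (fun ω t => w t ω) (fun ω k => a k ω) μ
  indep_init : IndepFun (fun ω => (x₀ ω, fun i j => Hhat ω i j))
    (fun ω => ((fun t => w t ω), fun k => a k ω)) μ

/-- The error bound: `C` times the sum of `tr(Σ_G) ‖H - Ĥ‖` and
`τ^{-1/2} ‖W Ĥ‖_F (tr Σ + tr Σₐ) ‖Σ_G‖_F (1 + log n² + log (1/δ) + log τ)^q`. -/
def LQProblem.errorBound {n d : ℕ} (S : LQProblem n d) (C : ℝ) (q : ℕ)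
    (Sig : Matrix (Fin n) (Fin n) ℝ) (SigA : Matrix (Fin d) (Fin d) ℝ)
    (H Hhat : Matrix (Fin n) (Fin n) ℝ) (δ : ℝ) (τ : ℕ) : ℝ :=
  C * ((S.nextCov Sig SigA).trace * specNorm (H - Hhat) +
    (τ : ℝ) ^ (-(1 / 2) : ℝ) * frobNorm (S.W * Hhat) * (Sig.trace + SigA.trace) *
      frobNorm (S.nextCov Sig SigA) *
      (1 + Real.log ((n : ℝ) ^ 2) + Real.log (1 / δ) + Real.log τ) ^ q)

end

/-!
The state `P_k` at the beginning of the `k`-th block satisfies `P_{k+1} = (A  B) z_k + ω_k` with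
`z_k = (L^{s-1} P_k, 0) + ζ_k`, `L = A - B K`, where `ω_k` is the noise of the exploratory round and
`ζ_k` is a centred Gaussian vector generated inside the block (`LQProblem.regressor_eq`,
`LQProblem.state_next`). The evaluation equation turns the regression target into
`z_kᵀ (G + (A B)ᵀ (Ĥ - H) (A B)) z_k + ξ_k`, where `ξ_k = 2 y_kᵀ Ĥ ω_k + ω_kᵀ Ĥ ω_k - tr (W Ĥ)`,
`y_k = (A  B) z_k`, has mean zero given the past (`LQProblem.targetVec_eq`). Hence the error of the
estimate is at most `‖(A B)ᵀ (Ĥ - H) (A B)‖_F`, which gives the first term of the bound, plus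
`‖∑ ξ_k vec(z_k z_kᵀ)‖ / c` when `Ψᵀ Ψ ⪰ c I`
(`LQProblem.IsStateActionMatrix.frobNorm_sub_estimate_le`). The projection can only decrease the
error, because `G` itself lies in the convex set: its value matrix solves a Lyapunov equation with a
positive semidefinite right-hand side.

Both random quantities are handled by moments of order `2 p` with `p` of size `1 + log (1/δ)`, for
a frozen pair `(x, h)` in place of `(x₀, Ĥ)`, which is independent of the noise and of the actions.
The tool is a moment inequality for martingales in a Hilbert space that is free of the dimension
(`MomBd.martingale_indep`). When the period `s` is long enough for `L^{s-1}` to be small, the `L^{8p}`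
norms of the states `P_k` are of size `√p`, uniformly in `k`
(`LQProblem.IsNondegenerate.momBd_state`).

* `∑ ξ_k vec(z_k z_kᵀ)` is a martingale of size `√τ` (`momBd_noiseSum`). The size of `ξ_k` is that
  of `‖W Ĥ y_k‖` and `‖W Ĥ‖_F`: the linear part by the spectral gap of `W`, the quadratic part by
  the rotation invariance of Gaussian measures (`momBd_quadratic`). The moments of `W Ĥ y_k` bring
  in `‖Σ_G‖_F`.
* `∑ vec(z_k z_kᵀ) ⊗ vec(z_k z_kᵀ)` differs from the sum of its conditional means by a martingale of
  size `√τ` (`momBd_designSum`), and each conditional mean dominates a multiple of `κ²`, whatever the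
  state: for a symmetric `Y`, the quadratic form of `Y` at a Gaussian vector with covariance `Q`
  and any mean has second moment at least `2 tr (Q Y Q Y)` (`le_integral_quadratic_sq`). So
  `Ψᵀ Ψ` is at least a multiple of `κ² τ` once `√τ` exceeds a constant depending on the system times
  a power of `p`.
-/

noncomputable section

/-! ### Moment bounds, independence and martingales in a Hilbert space -/

section MomentBounds

open scoped ENNReal

variable {Ω : Type*} [MeasurableSpace Ω] {μ : Measure Ω}
variable {E : Type*} [NormedAddCommGroup E] {F : Type*} [NormedAddCommGroup F]

/-- `MomBd μ q X b`: the random variable `X` has `L^q` norm at most `b`. -/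
structure MomBd (μ : Measure Ω) (q : ℕ) (X : Ω → E) (b : ℝ) : Prop where
  aesm : AEStronglyMeasurable X μ
  nonneg : 0 ≤ b
  le : eLpNorm X q μ ≤ ENNReal.ofReal b

namespace MomBd

variable {q : ℕ} {X Y : Ω → E} {b c : ℝ}

lemma memLp (h : MomBd μ q X b) : MemLp X q μ :=
  ⟨h.aesm, h.le.trans_lt ENNReal.ofReal_lt_top⟩

lemma mono (h : MomBd μ q X b) (hbc : b ≤ c) : MomBd μ q X c :=
  ⟨h.aesm, h.nonneg.trans hbc, h.le.trans (ENNReal.ofReal_le_ofReal hbc)⟩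

lemma mono_exp [IsProbabilityMeasure μ] {q' : ℕ} (h : MomBd μ q' X b) (hq : q ≤ q') :
    MomBd μ q X b :=
  ⟨h.aesm, h.nonneg, (eLpNorm_le_eLpNorm_of_exponent_le (by exact_mod_cast hq) h.aesm).trans h.le⟩

lemma add (hq : 1 ≤ q) (hX : MomBd μ q X b) (hY : MomBd μ q Y c) :
    MomBd μ q (fun ω => X ω + Y ω) (b + c) := by
  refine ⟨hX.aesm.add hY.aesm, add_nonneg hX.nonneg hY.nonneg, ?_⟩
  rw [ENNReal.ofReal_add hX.nonneg hY.nonneg]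
  exact (eLpNorm_add_le hX.aesm hY.aesm (by exact_mod_cast hq)).trans (add_le_add hX.le hY.le)

lemma neg (hX : MomBd μ q X b) : MomBd μ q (fun ω => - X ω) b :=
  ⟨hX.aesm.neg, hX.nonneg, by
    have : eLpNorm (fun ω => - X ω) q μ = eLpNorm X q μ := eLpNorm_neg X q μ
    rw [this]; exact hX.le⟩

lemma sub (hq : 1 ≤ q) (hX : MomBd μ q X b) (hY : MomBd μ q Y c) :
    MomBd μ q (fun ω => X ω - Y ω) (b + c) := by
  simpa [sub_eq_add_neg] using hX.add hq hY.neg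

lemma of_norm_le {X : Ω → F} (hX : AEStronglyMeasurable X μ) {g : Ω → ℝ} (hg : MomBd μ q g b)
    (h : ∀ ω, ‖X ω‖ ≤ g ω) : MomBd μ q X b :=
  ⟨hX, hg.nonneg, (eLpNorm_mono_real h).trans hg.le⟩

lemma norm (hX : MomBd μ q X b) : MomBd μ q (fun ω => ‖X ω‖) b :=
  ⟨hX.aesm.norm, hX.nonneg, by rw [eLpNorm_norm]; exact hX.le⟩

lemma const_mul {X : Ω → ℝ} (hX : MomBd μ q X b) (a : ℝ) :
    MomBd μ q (fun ω => a * X ω) (|a| * b) := by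
  refine ⟨hX.aesm.const_mul a, mul_nonneg (abs_nonneg a) hX.nonneg, ?_⟩
  have : eLpNorm (fun ω => a * X ω) q μ = ‖a‖ₑ * eLpNorm X q μ := eLpNorm_const_smul a X q μ
  rw [this, ENNReal.ofReal_mul (abs_nonneg a), ← Real.enorm_eq_ofReal_abs]
  exact mul_le_mul_right hX.le _

lemma of_le_mul {X : Ω → F} (hX : AEStronglyMeasurable X μ) (hY : MomBd μ q Y b) {a : ℝ}
    (ha : 0 ≤ a) (h : ∀ ω, ‖X ω‖ ≤ a * ‖Y ω‖) : MomBd μ q X (a * b) := by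
  have := hY.norm.const_mul a
  rw [abs_of_nonneg ha] at this
  exact of_norm_le hX this h

lemma sum {ι : Type*} {s : Finset ι} {X : ι → Ω → E} {b : ι → ℝ} (hq : 1 ≤ q)
    (h : ∀ i ∈ s, MomBd μ q (X i) (b i)) :
    MomBd μ q (fun ω => ∑ i ∈ s, X i ω) (∑ i ∈ s, b i) := by
  refine ⟨Finset.aestronglyMeasurable_fun_sum s fun i hi => (h i hi).aesm,
    Finset.sum_nonneg fun i hi => (h i hi).nonneg, ?_⟩
  have h1 := eLpNorm_sum_le (fun i hi => (h i hi).aesm) (p := (q : ℝ≥0∞)) (by exact_mod_cast hq)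
  have h2 : (∑ i ∈ s, X i) = fun ω => ∑ i ∈ s, X i ω := by ext ω; simp
  rw [h2] at h1
  rw [ENNReal.ofReal_sum_of_nonneg fun i hi => (h i hi).nonneg]
  exact h1.trans (Finset.sum_le_sum fun i hi => (h i hi).le)

lemma const [IsProbabilityMeasure μ] (x : E) : MomBd μ q (fun _ => x) ‖x‖ := by
  refine ⟨aestronglyMeasurable_const, norm_nonneg _, ?_⟩
  rcases eq_or_ne q 0 with rfl | hq
  · simp
  · rw [eLpNorm_const x (by exact_mod_cast hq) (NeZero.ne μ)]
    simp

lemma smul [NormedSpace ℝ E] {X : Ω → ℝ} (hX : MomBd μ (2 * q) X b)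
    (hY : MomBd μ (2 * q) Y c) : MomBd μ q (fun ω => X ω • Y ω) (b * c) := by
  refine ⟨hX.aesm.smul hY.aesm, mul_nonneg hX.nonneg hY.nonneg, ?_⟩
  have : ENNReal.HolderTriple ((2 * q : ℕ) : ℝ≥0∞) ((2 * q : ℕ) : ℝ≥0∞) (q : ℝ≥0∞) := by
    constructor
    push_cast
    rw [ENNReal.mul_inv (by simp) (by simp), ← add_mul, ENNReal.inv_two_add_inv_two, one_mul]
  have h1 := eLpNorm_smul_le_mul_eLpNorm hY.aesm hX.aesm (p := ((2 * q : ℕ) : ℝ≥0∞))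
    (q := ((2 * q : ℕ) : ℝ≥0∞)) (r := (q : ℝ≥0∞))
  rw [ENNReal.ofReal_mul hX.nonneg]
  exact h1.trans (mul_le_mul' hX.le hY.le)

lemma mul {X Y : Ω → ℝ} (hX : MomBd μ (2 * q) X b)
    (hY : MomBd μ (2 * q) Y c) : MomBd μ q (fun ω => X ω * Y ω) (b * c) := hX.smul hY

lemma eLpNorm_natCast_pow (hq : q ≠ 0) (X : Ω → E) :
    eLpNorm X q μ ^ q = ∫⁻ ω, ‖X ω‖ₑ ^ q ∂μ := by
  have := eLpNorm_nnreal_pow_eq_lintegral (μ := μ) (f := X) (p := (q : NNReal))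
    (by exact_mod_cast hq)
  simpa [ENNReal.rpow_natCast] using this

lemma iff_lintegral (hq : q ≠ 0) :
    MomBd μ q X b ↔
      AEStronglyMeasurable X μ ∧ 0 ≤ b ∧ ∫⁻ ω, ‖X ω‖ₑ ^ q ∂μ ≤ ENNReal.ofReal b ^ q := by
  constructor
  · rintro ⟨h1, h2, h3⟩
    refine ⟨h1, h2, ?_⟩
    rw [← eLpNorm_natCast_pow hq]
    exact pow_le_pow_left₀ (bot_le) h3 q
  · rintro ⟨h1, h2, h3⟩
    refine ⟨h1, h2, ?_⟩
    rw [← eLpNorm_natCast_pow hq] at h3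
    exact (ENNReal.pow_le_pow_left_iff hq).1 h3

lemma integrable_pow (hq : q ≠ 0) (h : MomBd μ q X b) : Integrable (fun ω => ‖X ω‖ ^ q) μ := by
  have := h.memLp.integrable_norm_rpow (by exact_mod_cast hq) (by simp)
  simpa using this

lemma integral_pow_le (hq : q ≠ 0) (h : MomBd μ q X b) : ∫ ω, ‖X ω‖ ^ q ∂μ ≤ b ^ q := by
  have h1 := ((iff_lintegral hq).1 h).2.2
  rw [integral_eq_lintegral_of_nonneg_ae (Filter.Eventually.of_forall fun ω => by positivity)
    (h.integrable_pow hq).1]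
  refine ENNReal.toReal_le_of_le_ofReal (pow_nonneg h.nonneg q) ?_
  rw [ENNReal.ofReal_pow h.nonneg]
  refine le_trans (le_of_eq ?_) h1
  refine lintegral_congr fun ω => ?_
  rw [ENNReal.ofReal_pow (norm_nonneg _), ofReal_norm]

lemma of_integral_pow_le (hq : q ≠ 0) (hX : AEStronglyMeasurable X μ) (hb : 0 ≤ b)
    (hi : Integrable (fun ω => ‖X ω‖ ^ q) μ) (h : ∫ ω, ‖X ω‖ ^ q ∂μ ≤ b ^ q) :
    MomBd μ q X b := by
  refine (iff_lintegral hq).2 ⟨hX, hb, ?_⟩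
  have := ofReal_integral_eq_lintegral_ofReal hi
    (Filter.Eventually.of_forall fun ω => by positivity)
  rw [← ENNReal.ofReal_pow hb]
  refine le_trans (le_of_eq ?_) (this ▸ ENNReal.ofReal_le_ofReal h)
  refine lintegral_congr fun ω => ?_
  rw [ENNReal.ofReal_pow (norm_nonneg _), ofReal_norm]

lemma sq_iff (hq : q ≠ 0) (hX : AEStronglyMeasurable X μ) (hb : 0 ≤ b) :
    MomBd μ q (fun ω => ‖X ω‖ ^ 2) (b ^ 2) ↔ MomBd μ (2 * q) X b := by
  rw [iff_lintegral hq, iff_lintegral (by lia)]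
  have h1 : ∀ ω, ‖(‖X ω‖ ^ 2)‖ₑ ^ q = ‖X ω‖ₑ ^ (2 * q) := fun ω => by
    rw [pow_mul, enorm_pow, enorm_norm]
  simp only [h1, hX, hb, true_and, ENNReal.ofReal_pow hb, ← pow_mul]
  have : AEStronglyMeasurable (fun ω => ‖X ω‖ ^ 2) μ := hX.norm.pow 2
  simp [this, sq_nonneg]

lemma sq (hq : q ≠ 0) (h : MomBd μ (2 * q) X b) : MomBd μ q (fun ω => ‖X ω‖ ^ 2) (b ^ 2) :=
  (sq_iff hq h.aesm h.nonneg).2 h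

/-- Minkowski's inequality for the squares of the coordinates: the `L^{2q}` norm of the length of
a random vector is controlled by those of its coordinates, without a dimensional factor. -/
lemma euclid {ι : Type*} [Fintype ι] {X : Ω → EuclideanSpace ℝ ι} {v : ι → ℝ} (hq : 1 ≤ q)
    (hv : ∀ i, 0 ≤ v i)
    (h : ∀ i, MomBd μ (2 * q) (fun ω => X ω i) (√(v i))) (hX : AEStronglyMeasurable X μ) :
    MomBd μ (2 * q) X (√(∑ i, v i)) := by
  rw [← sq_iff (by lia) hX (Real.sqrt_nonneg _),
    Real.sq_sqrt (Finset.sum_nonneg fun i _ => hv i)]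
  have : (fun ω => ‖X ω‖ ^ 2) = fun ω => ∑ i, ‖X ω i‖ ^ 2 := by
    ext ω; rw [EuclideanSpace.norm_sq_eq]
  rw [this]
  refine sum hq fun i _ => ?_
  have := (h i).sq (by lia)
  rwa [Real.sq_sqrt (hv i)] at this

/-- Markov's inequality at the moment of order `q`. -/
lemma markov [IsProbabilityMeasure μ] (hq : q ≠ 0) (h : MomBd μ q X b) :
    μ {ω | Real.exp 1 * b < ‖X ω‖} ≤ ENNReal.ofReal (Real.exp (-q)) := by
  rcases h.nonneg.eq_or_lt with hb | hb
  · have h0 : eLpNorm X q μ = 0 := by simpa [← hb] using h.le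
    rw [eLpNorm_eq_zero_iff h.aesm (by exact_mod_cast hq)] at h0
    have : μ {ω | Real.exp 1 * b < ‖X ω‖} = 0 := by
      rw [← hb]
      refine measure_mono_null (fun ω hω => ?_) h0
      simpa using hω
    simp [this]
  · have h1 := mul_meas_ge_le_pow_eLpNorm μ (p := (q : ℝ≥0∞)) (by exact_mod_cast hq) (by simp)
      h.aesm (ENNReal.ofReal (Real.exp 1 * b) ^ q)
    simp only [ENNReal.toReal_natCast, ENNReal.rpow_natCast] at h1
    have h2 : μ {ω | Real.exp 1 * b < ‖X ω‖} ≤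
        μ {ω | ENNReal.ofReal (Real.exp 1 * b) ^ q ≤ ‖X ω‖ₑ ^ q} := by
      refine measure_mono fun ω hω => ?_
      change ENNReal.ofReal (Real.exp 1 * b) ^ q ≤ ‖X ω‖ₑ ^ q
      gcongr
      rw [← ofReal_norm]
      exact ENNReal.ofReal_le_ofReal (le_of_lt hω)
    have hpos : 0 < Real.exp 1 * b := by positivity
    have h3 : ENNReal.ofReal (Real.exp 1 * b) ^ q *
        μ {ω | ENNReal.ofReal (Real.exp 1 * b) ^ q ≤ ‖X ω‖ₑ ^ q} ≤ ENNReal.ofReal b ^ q :=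
      h1.trans (pow_le_pow_left₀ (bot_le) h.le q)
    rw [← ENNReal.ofReal_pow hpos.le, mul_comm,
      ← ENNReal.le_div_iff_mul_le (Or.inl (by simpa using pow_pos hpos q))
      (Or.inl (by simp)), ← ENNReal.ofReal_pow hb.le, ← ENNReal.ofReal_div_of_pos (by positivity),
      ENNReal.ofReal_pow hpos.le] at h3
    refine h2.trans (h3.trans (ENNReal.ofReal_le_ofReal (le_of_eq ?_)))
    rw [mul_pow, ← Real.exp_nat_mul, mul_one, Real.exp_neg]
    field_simp

end MomBd

section Independence

variable {𝓤 𝓝 : Type*} [MeasurableSpace 𝓤] [MeasurableSpace 𝓝] [IsProbabilityMeasure μ]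
  {U : Ω → 𝓤} {N : Ω → 𝓝}

lemma IndepFun.lintegral_eq (hU : Measurable U) (hN : Measurable N) (h : IndepFun U N μ)
    {f : 𝓤 × 𝓝 → ℝ≥0∞} (hf : Measurable f) :
    ∫⁻ ω, f (U ω, N ω) ∂μ = ∫⁻ ω, ∫⁻ ω', f (U ω, N ω') ∂μ ∂μ := by
  have h1 := (indepFun_iff_map_prod_eq_prod_map_map hU.aemeasurable hN.aemeasurable).1 h
  rw [← lintegral_map hf (hU.prodMk hN), h1, lintegral_prod _ hf.aemeasurable,
    lintegral_map hf.lintegral_prod_right' hU]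
  refine lintegral_congr fun ω => ?_
  exact lintegral_map (hf.comp measurable_prodMk_left) hN

lemma IndepFun.integral_eq [NormedSpace ℝ E] (hU : Measurable U) (hN : Measurable N)
    (h : IndepFun U N μ)
    {f : 𝓤 × 𝓝 → E} (hf : StronglyMeasurable f) (hi : Integrable (fun ω => f (U ω, N ω)) μ) :
    ∫ ω, f (U ω, N ω) ∂μ = ∫ ω, ∫ ω', f (U ω, N ω') ∂μ ∂μ := by
  have h1 := (indepFun_iff_map_prod_eq_prod_map_map hU.aemeasurable hN.aemeasurable).1 h
  have hi' : Integrable f ((μ.map U).prod (μ.map N)) := by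
    rw [← h1]
    exact (integrable_map_measure hf.aestronglyMeasurable (hU.prodMk hN).aemeasurable).2 hi
  have : IsProbabilityMeasure (μ.map U) := Measure.isProbabilityMeasure_map hU.aemeasurable
  have : IsProbabilityMeasure (μ.map N) := Measure.isProbabilityMeasure_map hN.aemeasurable
  rw [← integral_map (hU.prodMk hN).aemeasurable hf.aestronglyMeasurable, h1, integral_prod _ hi',
    integral_map hU.aemeasurable (by
      exact (hf.integral_prod_right' ).aestronglyMeasurable)]
  refine integral_congr_ae (Filter.Eventually.of_forall fun ω => ?_)
  exact integral_map hN.aemeasurable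
    (hf.comp_measurable measurable_prodMk_left).aestronglyMeasurable

/-- An `L^q` bound conditional on `U` that depends on `U` in an `L^q` way is an unconditional
`L^q` bound. -/
lemma MomBd.of_indep {q : ℕ} (hq : q ≠ 0) (hU : Measurable U) (hN : Measurable N)
    (h : IndepFun U N μ) {f : 𝓤 × 𝓝 → E} (hf : StronglyMeasurable f) {b : 𝓤 → ℝ} {B : ℝ}
    (hb : ∀ u, MomBd μ q (fun ω => f (u, N ω)) (b u))
    (hB : MomBd μ q (fun ω => b (U ω)) B) : MomBd μ q (fun ω => f (U ω, N ω)) B := by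
  refine (iff_lintegral hq).2
    ⟨(hf.comp_measurable (hU.prodMk hN)).aestronglyMeasurable, hB.nonneg, ?_⟩
  rw [IndepFun.lintegral_eq hU hN h (f := fun x => ‖f x‖ₑ ^ q) (hf.enorm.pow_const q)]
  refine le_trans (lintegral_mono fun ω => ?_) ((iff_lintegral hq).1 hB).2.2
  refine (((iff_lintegral hq).1 (hb (U ω))).2.2).trans (le_of_eq ?_)
  rw [← ofReal_norm, Real.norm_of_nonneg (hb _).nonneg]

/-- Jensen's inequality: averaging over the independent variable does not increase the `L^q`
norm. -/
lemma MomBd.integral_indep [NormedSpace ℝ E] {q : ℕ} (hq : 1 ≤ q) (hU : Measurable U)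
    (hN : Measurable N) (h : IndepFun U N μ) {f : 𝓤 × 𝓝 → E} (hf : StronglyMeasurable f) {B : ℝ}
    (hB : MomBd μ q (fun ω => f (U ω, N ω)) B) :
    MomBd μ q (fun ω => ∫ ω', f (U ω, N ω') ∂μ) B := by
  have hsm : StronglyMeasurable fun u => ∫ ω', f (u, N ω') ∂μ := by
    have : StronglyMeasurable (Function.uncurry fun u ω' => f (u, N ω')) :=
      hf.comp_measurable (measurable_fst.prodMk (hN.comp measurable_snd))
    exact this.integral_prod_right
  refine (iff_lintegral (by lia)).2
    ⟨(hsm.comp_measurable hU).aestronglyMeasurable, hB.nonneg, ?_⟩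
  refine le_trans ?_ (((iff_lintegral (by lia)).1 hB).2.2)
  rw [IndepFun.lintegral_eq hU hN h (f := fun x => ‖f x‖ₑ ^ q) (hf.enorm.pow_const q)]
  refine lintegral_mono fun ω => ?_
  have hs : AEStronglyMeasurable (fun ω' => f (U ω, N ω')) μ :=
    (hf.comp_measurable (measurable_const.prodMk hN)).aestronglyMeasurable
  rw [← eLpNorm_natCast_pow (by lia)]
  refine pow_le_pow_left₀ (by positivity) ((enorm_integral_le_lintegral_enorm _).trans ?_) q
  rw [← eLpNorm_one_eq_lintegral_enorm]
  exact eLpNorm_le_eLpNorm_of_exponent_le (by exact_mod_cast hq) hs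

end Independence

section Martingale

/-- Taylor's bound for the power `p + 2` on `[0, M]`, with a slightly generous constant. -/
lemma pow_le_taylor (p : ℕ) {r s M : ℝ} (hr : 0 ≤ r) (hs : 0 ≤ s) (hrM : r ≤ M) (hsM : s ≤ M) :
    s ^ (p + 2) ≤ r ^ (p + 2) + (p + 2) * r ^ (p + 1) * (s - r)
      + (p + 2) ^ 2 * M ^ p * (s - r) ^ 2 := by
  have hM : 0 ≤ M := hr.trans hrM
  induction p with
  | zero => norm_num; nlinarith [sq_nonneg (s - r)]
  | succ p ih =>
    have h1 : s ^ (p + 3) = s * s ^ (p + 2) := by ring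
    have h2 := mul_le_mul_of_nonneg_left ih hs
    have h3 : s * (((p : ℝ) + 2) ^ 2 * M ^ p * (s - r) ^ 2)
        ≤ M * (((p : ℝ) + 2) ^ 2 * M ^ p * (s - r) ^ 2) :=
      mul_le_mul_of_nonneg_right hsM (by positivity)
    have h4 : r ^ (p + 1) * (s - r) ^ 2 ≤ M ^ (p + 1) * (s - r) ^ 2 :=
      mul_le_mul_of_nonneg_right (pow_le_pow_left₀ hr hrM _) (sq_nonneg _)
    have h5 : 0 ≤ M ^ (p + 1) * (s - r) ^ 2 := by positivity
    have h6 : s * (r ^ (p + 2) + (p + 2) * r ^ (p + 1) * (s - r)) =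
        r ^ (p + 3) + (p + 3) * r ^ (p + 2) * (s - r) + (p + 2) * (r ^ (p + 1) * (s - r) ^ 2) := by
      ring
    push_cast
    calc s ^ (p + 1 + 2) = s * s ^ (p + 2) := by ring
      _ ≤ _ := h2
      _ ≤ r ^ (p + 3) + (p + 3) * r ^ (p + 2) * (s - r) + (p + 2) * (M ^ (p + 1) * (s - r) ^ 2)
          + (p + 2) ^ 2 * (M ^ (p + 1) * (s - r) ^ 2) := by
        rw [mul_add, h6]
        have := mul_le_mul_of_nonneg_left h4 (by positivity : (0 : ℝ) ≤ (p : ℝ) + 2)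
        have h7 : M * (((p : ℝ) + 2) ^ 2 * M ^ p * (s - r) ^ 2)
          = (p + 2) ^ 2 * (M ^ (p + 1) * (s - r) ^ 2) := by ring
        linarith
      _ ≤ _ := by
        have : (0 : ℝ) ≤ p := p.cast_nonneg
        have h8 : ((p : ℝ) + 1 + 2) * r ^ (p + 1 + 1) = (p + 3) * r ^ (p + 2) := by ring
        have h9 : r ^ (p + 1 + 2) = r ^ (p + 3) := by ring
        rw [h8, h9]
        nlinarith

lemma mul_pow_le_pow_add_pow {x y : ℝ} (p : ℕ) (hx : 0 ≤ x) (hy : 0 ≤ y) :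
    x * y ^ p ≤ x ^ (p + 1) + y ^ (p + 1) := by
  rcases le_total x y with h | h
  · have : x * y ^ p ≤ y * y ^ p := mul_le_mul_of_nonneg_right h (by positivity)
    have h2 : 0 ≤ x ^ (p + 1) := by positivity
    rw [pow_succ' y]; linarith
  · have : x * y ^ p ≤ x * x ^ p :=
      mul_le_mul_of_nonneg_left (pow_le_pow_left₀ hy h _) hx
    have h2 : 0 ≤ y ^ (p + 1) := by positivity
    rw [pow_succ' x]; linarith

variable {H : Type*} [NormedAddCommGroup H] [InnerProductSpace ℝ H]

open scoped RealInnerProductSpace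

/-- The expansion of `‖S + D‖^{2m}`, `m = p + 2`, at `S`: Taylor's bound for the `m`-th power of the
squared norm. -/
lemma norm_add_pow_le (p : ℕ) (S D : H) :
    ‖S + D‖ ^ (2 * (p + 2)) ≤ ‖S‖ ^ (2 * (p + 2))
      + 2 * (p + 2) * (‖S‖ ^ (2 * (p + 1)) * ⟪S, D⟫)
      + 5 * (p + 2) ^ 2 * (‖D‖ ^ 2 * ((‖S‖ + ‖D‖) ^ 2) ^ (p + 1)) := by
  set M := (‖S‖ + ‖D‖) ^ 2 with hM
  have hS : ‖S‖ ^ 2 ≤ M := pow_le_pow_left₀ (norm_nonneg _) (by linarith [norm_nonneg D]) 2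
  have hSD : ‖S + D‖ ^ 2 ≤ M := pow_le_pow_left₀ (norm_nonneg _) (norm_add_le _ _) 2
  have h := pow_le_taylor p (sq_nonneg ‖S‖) (sq_nonneg ‖S + D‖) hS hSD
  have e : ‖S + D‖ ^ 2 - ‖S‖ ^ 2 = 2 * ⟪S, D⟫ + ‖D‖ ^ 2 := by
    rw [norm_add_sq_real]; ring
  rw [e] at h
  have hin : |2 * ⟪S, D⟫ + ‖D‖ ^ 2| ≤ 2 * (‖D‖ * (‖S‖ + ‖D‖)) := by
    have := abs_real_inner_le_norm S D
    rw [abs_le] at this ⊢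
    constructor <;> nlinarith [norm_nonneg S, norm_nonneg D]
  have h2 : (2 * ⟪S, D⟫ + ‖D‖ ^ 2) ^ 2 ≤ 4 * (‖D‖ ^ 2 * M) := by
    calc (2 * ⟪S, D⟫ + ‖D‖ ^ 2) ^ 2 = |2 * ⟪S, D⟫ + ‖D‖ ^ 2| ^ 2 := (sq_abs _).symm
      _ ≤ (2 * (‖D‖ * (‖S‖ + ‖D‖))) ^ 2 := pow_le_pow_left₀ (abs_nonneg _) hin 2
      _ = _ := by rw [hM]; ring
  have hM0 : 0 ≤ M := by positivity
  have h3 : (‖S‖ ^ 2) ^ (p + 1) * ‖D‖ ^ 2 ≤ M ^ (p + 1) * ‖D‖ ^ 2 :=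
    mul_le_mul_of_nonneg_right (pow_le_pow_left₀ (sq_nonneg _) hS _) (sq_nonneg _)
  have h4 := mul_le_mul_of_nonneg_left h2 (by positivity : 0 ≤ ((p : ℝ) + 2) ^ 2 * M ^ p)
  have h5 := mul_le_mul_of_nonneg_left h3 (by positivity : 0 ≤ ((p : ℝ) + 2))
  have h6 : 0 ≤ M ^ (p + 1) * ‖D‖ ^ 2 := by positivity
  rw [pow_mul, pow_mul, pow_mul]
  have hp : (0 : ℝ) ≤ p := p.cast_nonneg
  have h7 : ((p : ℝ) + 2) ^ 2 * M ^ p * (4 * (‖D‖ ^ 2 * M))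
      = 4 * (p + 2) ^ 2 * (M ^ (p + 1) * ‖D‖ ^ 2) := by ring
  have h8 : ((p : ℝ) + 2) * (M ^ (p + 1) * ‖D‖ ^ 2) ≤ (p + 2) ^ 2 * (M ^ (p + 1) * ‖D‖ ^ 2) := by
    refine mul_le_mul_of_nonneg_right ?_ h6
    nlinarith
  have h9 : ((p : ℝ) + 2) * (‖S‖ ^ 2) ^ (p + 1) * (2 * ⟪S, D⟫ + ‖D‖ ^ 2) =
    2 * (p + 2) * ((‖S‖ ^ 2) ^ (p + 1) * ⟪S, D⟫) + (p + 2) * ((‖S‖ ^ 2) ^ (p + 1) * ‖D‖ ^ 2) := by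
    ring
  have h10 : 5 * ((p : ℝ) + 2) ^ 2 * (‖D‖ ^ 2 * M ^ (p + 1))
    = 4 * (p + 2) ^ 2 * (M ^ (p + 1) * ‖D‖ ^ 2) + (p + 2) ^ 2 * (M ^ (p + 1) * ‖D‖ ^ 2) := by ring
  linarith

/-- One step of the moment bound for martingales in a Hilbert space. -/
lemma MomBd.add_of_orthogonal {p : ℕ} {S D : Ω → H} {A d : ℝ}
    (hS : MomBd μ (2 * (p + 2)) S (√A)) (hD : MomBd μ (2 * (p + 2)) D d) (hd : 0 < d)
    (hA : (100 * (p + 2) * d) ^ 2 ≤ A)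
    (h0 : ∫ ω, ‖S ω‖ ^ (2 * (p + 1)) * ⟪S ω, D ω⟫ ∂μ = 0) :
    MomBd μ (2 * (p + 2)) (fun ω => S ω + D ω) (√(A + (100 * (p + 2) * d) ^ 2)) := by
  have hA0 : 0 ≤ A := (sq_nonneg _).trans hA
  have hq : 2 * (p + 2) ≠ 0 := by lia
  have hp0 : (0 : ℝ) ≤ p := p.cast_nonneg
  set m : ℝ := (p : ℝ) + 2 with hm
  set t : ℝ := √A + d with ht
  have ht0 : 0 < t := by positivity
  have hSD : MomBd μ (2 * (p + 2)) (fun ω => ‖S ω‖ + ‖D ω‖) t :=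
    hS.norm.add (by lia) hD.norm
  have hadd := hS.add (by lia) hD
  have hT : MomBd μ (p + 2) (fun ω => (‖S ω‖ + ‖D ω‖) ^ 2) (t ^ 2) := by
    have := hSD.sq (by lia)
    simpa using this
  have hD2 : MomBd μ (p + 2) (fun ω => ‖D ω‖ ^ 2) (d ^ 2) := hD.sq (by lia)
  -- the second-order term, by the weighted arithmetic-geometric mean inequality
  have hpt : ∀ ω, ‖D ω‖ ^ 2 * ((‖S ω‖ + ‖D ω‖) ^ 2) ^ (p + 1) ≤
      d ^ 2 * (t ^ 2) ^ (p + 1) * ((‖D ω‖ ^ 2) ^ (p + 2) / (d ^ 2) ^ (p + 2)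
        + ((‖S ω‖ + ‖D ω‖) ^ 2) ^ (p + 2) / (t ^ 2) ^ (p + 2)) := by
    intro ω
    have h := mul_pow_le_pow_add_pow (p + 1) (x := ‖D ω‖ ^ 2 / d ^ 2)
      (y := (‖S ω‖ + ‖D ω‖) ^ 2 / t ^ 2) (by positivity) (by positivity)
    rw [div_pow, div_pow, div_pow] at h
    have h' := mul_le_mul_of_nonneg_left h (by positivity : 0 ≤ d ^ 2 * (t ^ 2) ^ (p + 1))
    refine le_trans (le_of_eq ?_) h'
    field_simp
  have hiD : Integrable (fun ω => (‖D ω‖ ^ 2) ^ (p + 2)) μ := by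
    simpa using hD2.integrable_pow (by lia)
  have hiT : Integrable (fun ω => ((‖S ω‖ + ‖D ω‖) ^ 2) ^ (p + 2)) μ := by
    simpa using hT.integrable_pow (by lia)
  have hbD : ∫ ω, (‖D ω‖ ^ 2) ^ (p + 2) ∂μ ≤ (d ^ 2) ^ (p + 2) := by
    simpa using hD2.integral_pow_le (by lia)
  have hbT : ∫ ω, ((‖S ω‖ + ‖D ω‖) ^ 2) ^ (p + 2) ∂μ ≤ (t ^ 2) ^ (p + 2) := by
    simpa using hT.integral_pow_le (by lia)
  have hiG : Integrable (fun ω => d ^ 2 * (t ^ 2) ^ (p + 1) * ((‖D ω‖ ^ 2) ^ (p + 2)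
      / (d ^ 2) ^ (p + 2) + ((‖S ω‖ + ‖D ω‖) ^ 2) ^ (p + 2) / (t ^ 2) ^ (p + 2))) μ :=
    ((hiD.div_const _).add (hiT.div_const _)).const_mul _
  have hbG : ∫ ω, d ^ 2 * (t ^ 2) ^ (p + 1) * ((‖D ω‖ ^ 2) ^ (p + 2)
      / (d ^ 2) ^ (p + 2) + ((‖S ω‖ + ‖D ω‖) ^ 2) ^ (p + 2) / (t ^ 2) ^ (p + 2)) ∂μ
      ≤ 2 * (d ^ 2 * (t ^ 2) ^ (p + 1)) := by
    rw [integral_const_mul, integral_add (hiD.div_const _) (hiT.div_const _), integral_div,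
      integral_div, mul_comm 2]
    refine mul_le_mul_of_nonneg_left ?_ (by positivity)
    have h1 := div_le_one_of_le₀ hbD (by positivity)
    have h2 := div_le_one_of_le₀ hbT (by positivity)
    linarith
  have hmeas : AEStronglyMeasurable (fun ω => ‖S ω‖ ^ (2 * (p + 1)) * ⟪S ω, D ω⟫) μ :=
    (hS.aesm.norm.pow _).mul (hS.aesm.inner hD.aesm)
  have hiI : Integrable (fun ω => ‖S ω‖ ^ (2 * (p + 1)) * ⟪S ω, D ω⟫) μ := by
    refine hiT.mono' hmeas (Filter.Eventually.of_forall fun ω => ?_)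
    rw [norm_mul, norm_pow, norm_norm, ← pow_mul]
    have h1 : ‖⟪S ω, D ω⟫‖ ≤ (‖S ω‖ + ‖D ω‖) ^ 2 := by
      refine (norm_inner_le_norm _ _).trans ?_
      nlinarith [norm_nonneg (S ω), norm_nonneg (D ω)]
    have h2 : ‖S ω‖ ^ (2 * (p + 1)) ≤ (‖S ω‖ + ‖D ω‖) ^ (2 * (p + 1)) :=
      pow_le_pow_left₀ (norm_nonneg _) (by linarith [norm_nonneg (D ω)]) _
    calc _ ≤ (‖S ω‖ + ‖D ω‖) ^ (2 * (p + 1)) * (‖S ω‖ + ‖D ω‖) ^ 2 := by gcongr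
      _ = _ := by rw [← pow_add]; ring_nf
  refine of_integral_pow_le hq hadd.aesm (Real.sqrt_nonneg _) (hadd.integrable_pow hq) ?_
  have hiS := hS.integrable_pow hq
  have hmain : ∫ ω, ‖S ω + D ω‖ ^ (2 * (p + 2)) ∂μ ≤
      (√A) ^ (2 * (p + 2)) + 5 * m ^ 2 * (2 * (d ^ 2 * (t ^ 2) ^ (p + 1))) := by
    calc ∫ ω, ‖S ω + D ω‖ ^ (2 * (p + 2)) ∂μ
        ≤ ∫ ω, ((‖S ω‖ ^ (2 * (p + 2)) + 2 * m * (‖S ω‖ ^ (2 * (p + 1)) * ⟪S ω, D ω⟫))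
          + 5 * m ^ 2 * (d ^ 2 * (t ^ 2) ^ (p + 1) * ((‖D ω‖ ^ 2) ^ (p + 2)
      / (d ^ 2) ^ (p + 2) + ((‖S ω‖ + ‖D ω‖) ^ 2) ^ (p + 2) / (t ^ 2) ^ (p + 2)))) ∂μ := by
          refine integral_mono (hadd.integrable_pow hq)
            ((hiS.add (hiI.const_mul _)).add (hiG.const_mul _)) fun ω => ?_
          refine (norm_add_pow_le p (S ω) (D ω)).trans ?_
          have := mul_le_mul_of_nonneg_left (hpt ω) (by positivity : 0 ≤ 5 * m ^ 2)
          simp only [hm] at this ⊢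
          linarith
      _ = ∫ ω, ‖S ω‖ ^ (2 * (p + 2)) ∂μ + 0 + 5 * m ^ 2 * ∫ ω, (d ^ 2 * (t ^ 2) ^ (p + 1) *
          ((‖D ω‖ ^ 2) ^ (p + 2)
      / (d ^ 2) ^ (p + 2) + ((‖S ω‖ + ‖D ω‖) ^ 2) ^ (p + 2) / (t ^ 2) ^ (p + 2))) ∂μ := by
          have e1 := integral_add (hiS.add (hiI.const_mul (2 * m))) (hiG.const_mul (5 * m ^ 2))
          have e2 := integral_add hiS (hiI.const_mul (2 * m))
          rw [integral_const_mul, h0, mul_zero] at e2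
          rw [integral_const_mul] at e1
          exact e1.trans (congrArg₂ _ e2 rfl)
      _ ≤ _ := by
          have := hS.integral_pow_le hq
          have := mul_le_mul_of_nonneg_left hbG (by positivity : 0 ≤ 5 * m ^ 2)
          linarith
  refine hmain.trans ?_
  -- it remains to compare the two sides, using that `√A` exceeds `d` by the factor `100 (p + 2)`
  have hmpos : 0 < m := by positivity
  have hdA : 100 * m * d ≤ √A := Real.le_sqrt_of_sq_le hA
  have htA : t ^ 2 ≤ A * (1 + 1 / (100 * m)) ^ 2 := by
    have : t ≤ √A * (1 + 1 / (100 * m)) := by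
      rw [ht, mul_add, mul_one, mul_one_div, add_le_add_iff_left, le_div_iff₀ (by positivity)]
      linarith
    calc t ^ 2 ≤ (√A * (1 + 1 / (100 * m))) ^ 2 := pow_le_pow_left₀ ht0.le this 2
      _ = _ := by rw [mul_pow, Real.sq_sqrt hA0]
  have hexp : ((1 + 1 / (100 * m)) ^ 2) ^ (p + 1) ≤ 3 := by
    have h1 : 1 + 1 / (100 * m) ≤ Real.exp (1 / (100 * m)) := by
      linarith [Real.add_one_le_exp (1 / (100 * m))]
    calc ((1 + 1 / (100 * m)) ^ 2) ^ (p + 1) ≤ (Real.exp (1 / (100 * m)) ^ 2) ^ (p + 1) := by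
          gcongr
      _ = Real.exp ((2 * (p + 1) : ℕ) * (1 / (100 * m))) := by
          rw [← pow_mul, ← Real.exp_nat_mul]
      _ ≤ Real.exp 1 := by
          refine Real.exp_le_exp.2 ?_
          rw [mul_one_div, div_le_one (by positivity)]
          push_cast
          simp only [hm]; linarith
      _ ≤ 3 := by linarith [Real.exp_one_lt_d9]
  have htp : (t ^ 2) ^ (p + 1) ≤ A ^ (p + 1) * 3 := by
    calc (t ^ 2) ^ (p + 1) ≤ (A * (1 + 1 / (100 * m)) ^ 2) ^ (p + 1) := by gcongr
      _ = A ^ (p + 1) * ((1 + 1 / (100 * m)) ^ 2) ^ (p + 1) := by rw [mul_pow]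
      _ ≤ _ := by gcongr
  rw [pow_mul, pow_mul, Real.sq_sqrt hA0, Real.sq_sqrt (by positivity)]
  have hbern : A ^ (p + 2) + (p + 2) * A ^ (p + 1) * (100 * m * d) ^ 2
      ≤ (A + (100 * m * d) ^ 2) ^ (p + 2) := by
    have := pow_add_mul_le_add_pow_of_sq_nonneg hA0 (sq_nonneg ((100 * m * d) ^ 2))
      (sq_nonneg _) (by positivity) (p + 2)
    refine le_trans (le_of_eq ?_) this
    push_cast
    rfl
  refine le_trans ?_ hbern
  rw [← hm]
  have h1 : d ^ 2 * (t ^ 2) ^ (p + 1) ≤ d ^ 2 * (A ^ (p + 1) * 3) := by gcongr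
  have hm1 : 1 ≤ m := by linarith
  have h2 : 0 ≤ d ^ 2 * A ^ (p + 1) := by positivity
  have h3 : m ^ 2 * (d ^ 2 * A ^ (p + 1)) ≤ m ^ 3 * (d ^ 2 * A ^ (p + 1)) := by
    gcongr; norm_num
  nlinarith

/-- Moment bound for martingales in a Hilbert space: if the increments have `L^{2m}` norm at most
`d`, the `L^{2m}` norm of the `k`-th partial sum is of order `m d √k`. Of the martingale property,
only the orthogonality of `‖S‖^{2m-2} S` to the next increment is used. -/
lemma MomBd.martingale {p : ℕ} {S D : ℕ → Ω → H} {d : ℝ} (hd : 0 < d)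
    (hS0 : ∀ ω, S 0 ω = 0) (hS : ∀ k ω, S (k + 1) ω = S k ω + D k ω)
    (hD : ∀ k, MomBd μ (2 * (p + 2)) (D k) d)
    (h0 : ∀ k, MomBd μ (2 * (p + 2)) (S k) (√((k + 1) * (100 * (p + 2) * d) ^ 2)) →
      ∫ ω, ‖S k ω‖ ^ (2 * (p + 1)) * ⟪S k ω, D k ω⟫ ∂μ = 0) (k : ℕ) :
    MomBd μ (2 * (p + 2)) (S k) (√((k + 1) * (100 * (p + 2) * d) ^ 2)) := by
  induction k with
  | zero =>
    have : S 0 = fun _ => 0 := funext hS0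
    rw [this]
    refine ⟨aestronglyMeasurable_const, Real.sqrt_nonneg _, ?_⟩
    have : eLpNorm (fun _ : Ω => (0 : H)) ((2 * (p + 2) : ℕ) : ℝ≥0∞) μ = 0 := eLpNorm_zero
    rw [this]; exact bot_le
  | succ k ih =>
    have := ih.add_of_orthogonal (hD k) hd (by
      have : (0 : ℝ) ≤ k := k.cast_nonneg
      nlinarith [sq_nonneg (100 * ((p : ℝ) + 2) * d)]) (h0 k ih)
    have e : S (k + 1) = fun ω => S k ω + D k ω := funext (hS k)
    rw [e]
    convert this using 2
    push_cast; ring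

end Martingale

end MomentBounds

/-! ### Moments of Gaussian vectors -/

section Gaussian

open scoped ENNReal NNReal

/-- A matrix as a continuous linear map between Euclidean spaces. -/
def matE {m k : Type*} [Fintype m] [Fintype k] [DecidableEq k] (T : Matrix m k ℝ) :
    EuclideanSpace ℝ k →L[ℝ] EuclideanSpace ℝ m :=
  LinearMap.toContinuousLinearMap (Matrix.toLpLin 2 2 T)

section matE

variable {m k l : Type*} [Fintype m] [Fintype k] [DecidableEq k] [Fintype l] [DecidableEq l]

lemma ofLp_matE (T : Matrix m k ℝ) (x : EuclideanSpace ℝ k) :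
    (matE T x).ofLp = T *ᵥ x.ofLp := rfl

lemma matE_apply (T : Matrix m k ℝ) (x : EuclideanSpace ℝ k) (i : m) :
    matE T x i = T i ⬝ᵥ x.ofLp := rfl

lemma matE_mul (T : Matrix m k ℝ) (R : Matrix k l ℝ) (x : EuclideanSpace ℝ l) :
    matE (T * R) x = matE T (matE R x) := by
  ext i; simp [ofLp_matE]

lemma matE_one (x : EuclideanSpace ℝ k) : matE (1 : Matrix k k ℝ) x = x := by
  ext i; simp [ofLp_matE]

omit [DecidableEq k] in
lemma inner_eq_dotProduct (x y : EuclideanSpace ℝ k) :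
    inner ℝ x y = x.ofLp ⬝ᵥ y.ofLp := by
  simp [PiLp.inner_apply, dotProduct, mul_comm]

lemma inner_matE (T : Matrix m k ℝ) [DecidableEq m] (x : EuclideanSpace ℝ m)
    (y : EuclideanSpace ℝ k) : inner ℝ x (matE T y) = inner ℝ (matE Tᵀ x) y := by
  rw [inner_eq_dotProduct, inner_eq_dotProduct, ofLp_matE, ofLp_matE, Matrix.dotProduct_mulVec,
    Matrix.mulVec_transpose]

lemma norm_matE_le (T : Matrix m k ℝ) (x : EuclideanSpace ℝ k) :
    ‖matE T x‖ ≤ frobNorm T * ‖x‖ := by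
  have h0 : 0 ≤ ∑ i, ∑ j, T i j ^ 2 :=
    Finset.sum_nonneg fun i _ => Finset.sum_nonneg fun j _ => sq_nonneg _
  rw [EuclideanSpace.norm_eq, EuclideanSpace.norm_eq, frobNorm, ← Real.sqrt_mul h0]
  refine Real.sqrt_le_sqrt ?_
  rw [Finset.sum_mul]
  refine Finset.sum_le_sum fun i _ => ?_
  rw [matE_apply, Real.norm_eq_abs, sq_abs, dotProduct]
  simpa using Finset.sum_mul_sq_le_sq_mul_sq Finset.univ (T i) x.ofLp

end matE

variable {Ω : Type*} [MeasurableSpace Ω] {μ : Measure Ω}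
variable {ι : Type*} [Fintype ι] [DecidableEq ι]

lemma hasLaw_dotProduct {X : Ω → EuclideanSpace ℝ ι} {Q : Matrix ι ι ℝ} (hQ : Q.PosSemidef)
    (hX : HasLaw X (multivariateGaussian 0 Q) μ) (u : ι → ℝ) :
    HasLaw (fun ω => u ⬝ᵥ (X ω).ofLp) (gaussianReal 0 (u ⬝ᵥ (Q *ᵥ u)).toNNReal) μ := by
  have h1 : HasLaw (fun x : EuclideanSpace ℝ ι => u ⬝ᵥ x.ofLp)
      (gaussianReal 0 (u ⬝ᵥ (Q *ᵥ u)).toNNReal) (multivariateGaussian 0 Q) := by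
    refine ⟨by unfold dotProduct; fun_prop, ?_⟩
    have e : (fun x : EuclideanSpace ℝ ι => u ⬝ᵥ x.ofLp) =
        ⇑(innerSL ℝ (WithLp.toLp 2 u : EuclideanSpace ℝ ι)) := by
      ext x; rw [innerSL_apply_apply, inner_eq_dotProduct]
    rw [e, IsGaussian.map_eq_gaussianReal, ContinuousLinearMap.integral_comp_id_comm
      IsGaussian.integrable_id, integral_id_multivariateGaussian, map_zero]
    congr 2
    have h := covarianceBilin_self (μ := multivariateGaussian 0 Q) IsGaussian.memLp_two_id
      (WithLp.toLp 2 u : EuclideanSpace ℝ ι)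
    rw [covarianceBilin_multivariateGaussian hQ] at h
    exact h.symm
  exact h1.comp hX

lemma integrable_exp_of_hasLaw {X : Ω → ℝ} {v : ℝ≥0} (hX : HasLaw X (gaussianReal 0 v) μ) (t : ℝ) :
    Integrable (fun ω => Real.exp (t * X ω)) μ ∧
      ∫ ω, Real.exp (t * X ω) ∂μ = Real.exp (v * t ^ 2 / 2) := by
  have h1 := integrable_exp_mul_gaussianReal (μ := 0) (v := v) t
  refine ⟨?_, ?_⟩
  · have := hX.map_eq ▸ h1
    exact this.comp_aemeasurable hX.aemeasurable
  · have := mgf_gaussianReal hX.map_eq t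
    simpa [mgf] using this

lemma pow_le_factorial_mul_exp (p : ℕ) (y : ℝ) :
    y ^ (2 * p) ≤ (2 * p).factorial * (Real.exp y + Real.exp (-y)) := by
  have h := Real.pow_div_factorial_le_exp |y| (abs_nonneg y) (2 * p)
  rw [div_le_iff₀ (by positivity), mul_comm (Real.exp _), pow_mul, sq_abs, ← pow_mul] at h
  refine h.trans (mul_le_mul_of_nonneg_left ?_ (by positivity))
  rcases abs_cases y with ⟨h, _⟩ | ⟨h, _⟩ <;> rw [h]
  · linarith [Real.exp_pos (-y)]
  · linarith [Real.exp_pos y]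

/-- Moments of a centered real Gaussian variable, from its moment generating function. -/
lemma momBd_gaussianReal [IsProbabilityMeasure μ] {X : Ω → ℝ} {v : ℝ≥0}
    (hX : HasLaw X (gaussianReal 0 v) μ)
    {p : ℕ} (hp : 1 ≤ p) : MomBd μ (2 * p) X (√(12 * p * v)) := by
  have hm : AEStronglyMeasurable X μ := hX.aemeasurable.aestronglyMeasurable
  have hp0 : (0 : ℝ) < p := by exact_mod_cast hp
  rcases eq_or_ne v 0 with rfl | hv
  · have h0 : X =ᵐ[μ] 0 := by
      have h2 : ∀ᵐ x ∂(μ.map X), x = 0 := by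
        rw [hX.map_eq, gaussianReal_zero_var]
        exact (ae_dirac_iff (measurableSet_singleton (0 : ℝ))).2 rfl
      exact ae_of_ae_map hX.aemeasurable h2
    refine ⟨hm, Real.sqrt_nonneg _, ?_⟩
    rw [eLpNorm_congr_ae h0]; simp
  have hv0 : (0 : ℝ) < v := by exact_mod_cast pos_iff_ne_zero.2 hv
  -- the optimal parameter of the moment generating function
  set t : ℝ := √(2 * p / v) with ht
  have ht2 : t ^ 2 = 2 * p / v := Real.sq_sqrt (by positivity)
  have ht0 : 0 < t := Real.sqrt_pos.2 (by positivity)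
  obtain ⟨i1, e1⟩ := integrable_exp_of_hasLaw hX t
  obtain ⟨i2, e2⟩ := integrable_exp_of_hasLaw hX (-t)
  have hpt : ∀ ω, ‖X ω‖ ^ (2 * p) ≤ (t ^ (2 * p))⁻¹ * ((2 * p).factorial *
      (Real.exp (t * X ω) + Real.exp (-t * X ω))) := by
    intro ω
    rw [← div_eq_inv_mul, le_div_iff₀ (by positivity), Real.norm_eq_abs, pow_mul, sq_abs, ← pow_mul]
    have := pow_le_factorial_mul_exp p (t * X ω)
    rw [mul_pow, mul_comm (t ^ _)] at this
    simpa using this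
  have hG := ((i1.add i2).const_mul ((2 * p).factorial : ℝ)).const_mul (t ^ (2 * p))⁻¹
  have hi : Integrable (fun ω => ‖X ω‖ ^ (2 * p)) μ :=
    hG.mono' (hm.norm.pow _) (Filter.Eventually.of_forall fun ω => by
      rw [Real.norm_of_nonneg (by positivity)]; exact hpt ω)
  refine MomBd.of_integral_pow_le (by lia) hm (Real.sqrt_nonneg _) hi ?_
  refine (integral_mono hi hG hpt).trans ?_
  have e3 : ∫ ω, (t ^ (2 * p))⁻¹ * (((2 * p).factorial : ℝ) *
      (Real.exp (t * X ω) + Real.exp (-t * X ω))) ∂μ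
      = (t ^ (2 * p))⁻¹ * ((2 * p).factorial * (2 * Real.exp p)) := by
    rw [integral_const_mul, integral_const_mul, integral_add i1 i2, e1, e2, neg_sq, ht2]
    have : (v : ℝ) * (2 * p / v) / 2 = p := by field_simp
    rw [this]; ring
  refine (le_of_eq e3).trans ?_
  rw [pow_mul, pow_mul, ht2, Real.sq_sqrt (by positivity)]
  have hf : ((2 * p).factorial : ℝ) ≤ (2 * p) ^ (2 * p) := by
    exact_mod_cast Nat.factorial_le_pow (2 * p)
  have h2 : (2 : ℝ) ≤ 2 ^ p := by
    calc (2 : ℝ) = 2 ^ 1 := by norm_num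
      _ ≤ 2 ^ p := pow_le_pow_right₀ (by norm_num) hp
  have he : Real.exp p ≤ 3 ^ p := by
    rw [← mul_one (p : ℝ), Real.exp_nat_mul]
    exact pow_le_pow_left₀ (Real.exp_pos _).le (by linarith [Real.exp_one_lt_d9]) p
  calc ((2 * p / v : ℝ) ^ p)⁻¹ * ((2 * p).factorial * (2 * Real.exp p))
      ≤ ((2 * p / v : ℝ) ^ p)⁻¹ * ((2 * p) ^ (2 * p) * (2 ^ p * 3 ^ p)) := by gcongr
    _ = (12 * p * v) ^ p := by
      rw [← inv_pow, pow_mul, ← mul_pow, ← mul_pow, ← mul_pow]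
      congr 1; field_simp; ring

lemma momBd_dotProduct [IsProbabilityMeasure μ] {X : Ω → EuclideanSpace ℝ ι} {Q : Matrix ι ι ℝ}
    (hQ : Q.PosSemidef) (hX : HasLaw X (multivariateGaussian 0 Q) μ) (u : ι → ℝ)
    {p : ℕ} (hp : 1 ≤ p) :
    MomBd μ (2 * p) (fun ω => u ⬝ᵥ (X ω).ofLp) (√(12 * p * (u ⬝ᵥ (Q *ᵥ u)))) := by
  have h := momBd_gaussianReal (hasLaw_dotProduct hQ hX u) hp
  rwa [Real.coe_toNNReal _ (by simpa using hQ.dotProduct_mulVec_nonneg u)] at h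

omit [DecidableEq ι] in
lemma dotProduct_row_mulVec {m : Type*} (T : Matrix m ι ℝ) (Q : Matrix ι ι ℝ) (i : m) :
    T i ⬝ᵥ (Q *ᵥ T i) = (T * Q * Tᵀ) i i := by
  rw [Matrix.dotProduct_mulVec]; rfl

/-- The length of a linear image `T X` of a Gaussian vector: the moments are governed by
`tr (T Q Tᵀ) = E ‖T X‖²`, whatever the dimension. -/
lemma momBd_matE [IsProbabilityMeasure μ] {X : Ω → EuclideanSpace ℝ ι} {Q : Matrix ι ι ℝ}
    (hQ : Q.PosSemidef) (hX : HasLaw X (multivariateGaussian 0 Q) μ) {m : Type*} [Fintype m]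
    (T : Matrix m ι ℝ) {p : ℕ} (hp : 1 ≤ p) :
    MomBd μ (2 * p) (fun ω => matE T (X ω)) (√(12 * p * (T * Q * Tᵀ).trace)) := by
  rw [Matrix.trace, Finset.mul_sum]
  have hpos : ∀ i, 0 ≤ (T * Q * Tᵀ) i i := fun i => by
    rw [← dotProduct_row_mulVec]; simpa using hQ.dotProduct_mulVec_nonneg (T i)
  refine MomBd.euclid hp (fun i => mul_nonneg (by positivity) (hpos i)) (fun i => ?_)
    (((matE T).continuous.measurable.comp_aemeasurable hX.aemeasurable).aestronglyMeasurable)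
  have := momBd_dotProduct hQ hX (T i) hp
  rw [dotProduct_row_mulVec] at this
  exact this

end Gaussian

/-! ### Quadratic forms of Gaussian vectors -/

section GaussianQuadratic

open scoped ENNReal NNReal MatrixOrder

variable {Ω : Type*} [MeasurableSpace Ω] {μ : Measure Ω}
variable {ι : Type*} [Fintype ι] [DecidableEq ι]

lemma MomBd.comp_hasLaw {𝓧 E : Type*} [MeasurableSpace 𝓧] [NormedAddCommGroup E] {ν : Measure 𝓧}
    {X : Ω → 𝓧} (hX : HasLaw X ν μ) {q : ℕ} {f : 𝓧 → E} {b : ℝ} (hf : MomBd ν q f b) :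
    MomBd μ q (fun ω => f (X ω)) b := by
  have hs : AEStronglyMeasurable f (μ.map X) := hX.map_eq ▸ hf.aesm
  refine ⟨hs.comp_aemeasurable hX.aemeasurable, hf.nonneg, ?_⟩
  have := eLpNorm_map_measure (p := (q : ℝ≥0∞)) hs hX.aemeasurable
  rw [hX.map_eq] at this
  exact this ▸ hf.le

lemma MomBd.of_comp_hasLaw {𝓧 E : Type*} [MeasurableSpace 𝓧] [NormedAddCommGroup E] {ν : Measure 𝓧}
    {X : Ω → 𝓧} (hX : HasLaw X ν μ) {q : ℕ} {f : 𝓧 → E} (hf : AEStronglyMeasurable f ν) {b : ℝ}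
    (h : MomBd μ q (fun ω => f (X ω)) b) : MomBd ν q f b := by
  refine ⟨hf, h.nonneg, ?_⟩
  have := eLpNorm_map_measure (p := (q : ℝ≥0∞)) (hX.map_eq ▸ hf) hX.aemeasurable
  rw [hX.map_eq] at this
  exact this ▸ h.le

lemma hasLaw_self {𝓧 : Type*} [MeasurableSpace 𝓧] (ν : Measure 𝓧) : HasLaw (fun x => x) ν ν :=
  ⟨aemeasurable_id, Measure.map_id⟩

lemma hasLaw_fst {α β : Type*} [MeasurableSpace α] [MeasurableSpace β] (ν : Measure α)
    (ν' : Measure β) [IsProbabilityMeasure ν] [IsProbabilityMeasure ν'] :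
    HasLaw Prod.fst ν (ν.prod ν') :=
  ⟨measurable_fst.aemeasurable, measurePreserving_fst.map_eq⟩

lemma hasLaw_snd {α β : Type*} [MeasurableSpace α] [MeasurableSpace β] (ν : Measure α)
    (ν' : Measure β) [IsProbabilityMeasure ν] [IsProbabilityMeasure ν'] :
    HasLaw Prod.snd ν' (ν.prod ν') :=
  ⟨measurable_snd.aemeasurable, measurePreserving_snd.map_eq⟩

lemma indepFun_fst_snd {α β : Type*} [MeasurableSpace α] [MeasurableSpace β] (ν : Measure α)
    (ν' : Measure β) [IsProbabilityMeasure ν] [IsProbabilityMeasure ν'] :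
    IndepFun (Prod.fst : α × β → α) Prod.snd (ν.prod ν') := by
  rw [indepFun_iff_map_prod_eq_prod_map_map measurable_fst.aemeasurable
    measurable_snd.aemeasurable, (hasLaw_fst ν ν').map_eq, (hasLaw_snd ν ν').map_eq]
  exact Measure.map_id

variable {Q : Matrix ι ι ℝ}

lemma memLp_eval_gaussian (Q : Matrix ι ι ℝ) (i : ι) (p : ℝ≥0∞) (hp : p ≠ ⊤) :
    MemLp (fun x : EuclideanSpace ℝ ι => x i) p (multivariateGaussian 0 Q) := by
  have h := IsGaussian.memLp_id (multivariateGaussian 0 Q) p hp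
  exact h.of_le (by fun_prop) (Filter.Eventually.of_forall fun x => PiLp.norm_apply_le x i)

lemma integral_eval_gaussian (Q : Matrix ι ι ℝ) (i : ι) :
    ∫ x : EuclideanSpace ℝ ι, x i ∂(multivariateGaussian 0 Q) = 0 := by
  have h := ContinuousLinearMap.integral_comp_id_comm (μ := multivariateGaussian 0 Q)
    (L := EuclideanSpace.proj (𝕜 := ℝ) i) IsGaussian.integrable_id
  rw [integral_id_multivariateGaussian] at h
  simpa using h

lemma integrable_dotProduct_gaussian (Q : Matrix ι ι ℝ) (b : ι → ℝ) :
    Integrable (fun x : EuclideanSpace ℝ ι => b ⬝ᵥ x.ofLp) (multivariateGaussian 0 Q) := by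
  unfold dotProduct
  exact integrable_finsetSum _ fun i _ =>
    ((memLp_eval_gaussian Q i 1 (by simp)).integrable le_rfl).const_mul _

lemma integral_dotProduct_gaussian (Q : Matrix ι ι ℝ) (b : ι → ℝ) :
    ∫ x : EuclideanSpace ℝ ι, b ⬝ᵥ x.ofLp ∂(multivariateGaussian 0 Q) = 0 := by
  unfold dotProduct
  rw [integral_finsetSum _ fun i _ =>
    ((memLp_eval_gaussian Q i 1 (by simp)).integrable le_rfl).const_mul _]
  simp [integral_const_mul, integral_eval_gaussian]

lemma integrable_quadratic_gaussian (Q M : Matrix ι ι ℝ) :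
    Integrable (fun x : EuclideanSpace ℝ ι => x.ofLp ⬝ᵥ (M *ᵥ x.ofLp))
      (multivariateGaussian 0 Q) := by
  simp only [dotProduct, mulVec, Finset.mul_sum]
  refine integrable_finsetSum _ fun i _ => integrable_finsetSum _ fun j _ => ?_
  have := ((memLp_eval_gaussian Q i 2 (by simp)).integrable_mul
    (memLp_eval_gaussian Q j 2 (by simp))).const_mul (M i j)
  refine this.congr (Filter.Eventually.of_forall fun x => ?_)
  simp only [Pi.mul_apply]; ring

lemma integral_quadratic_gaussian (hQ : Q.PosSemidef) (M : Matrix ι ι ℝ) :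
    ∫ x : EuclideanSpace ℝ ι, x.ofLp ⬝ᵥ (M *ᵥ x.ofLp) ∂(multivariateGaussian 0 Q)
      = (Q * M).trace := by
  have hi : ∀ i j, Integrable (fun x : EuclideanSpace ℝ ι => x.ofLp i * (M i j * x.ofLp j))
      (multivariateGaussian 0 Q) := fun i j => by
    have := ((memLp_eval_gaussian Q i 2 (by simp)).integrable_mul
      (memLp_eval_gaussian Q j 2 (by simp))).const_mul (M i j)
    refine this.congr (Filter.Eventually.of_forall fun x => ?_)
    simp only [Pi.mul_apply]; ring
  have hc : ∀ i j, ∫ x : EuclideanSpace ℝ ι, x.ofLp i * (M i j * x.ofLp j)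
      ∂(multivariateGaussian 0 Q) = Q i j * M i j := fun i j => by
    have h := covariance_eval_multivariateGaussian (μ := 0) hQ i j
    rw [covariance_eq_sub (memLp_eval_gaussian Q i 2 (by simp))
      (memLp_eval_gaussian Q j 2 (by simp)), integral_eval_gaussian, zero_mul, sub_zero] at h
    rw [← h, ← integral_mul_const]
    refine integral_congr_ae (Filter.Eventually.of_forall fun x => ?_)
    simp only [Pi.mul_apply]; ring
  simp only [dotProduct, mulVec, Finset.mul_sum]
  rw [integral_finsetSum _ fun i _ => integrable_finsetSum _ fun j _ => hi i j]
  simp_rw [integral_finsetSum _ fun j _ => hi _ j, hc, Matrix.trace, Matrix.diag, Matrix.mul_apply]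
  rw [Finset.sum_comm]
  refine Finset.sum_congr rfl fun i _ => Finset.sum_congr rfl fun j _ => ?_
  have : Q j i = Q i j := by simpa using hQ.1.apply i j
  rw [this]

/-- The rotation of the plane by `π/4` applied to a pair of independent copies of a Gaussian
vector. -/
def rot (z : EuclideanSpace ℝ ι × EuclideanSpace ℝ ι) :
    EuclideanSpace ℝ ι × EuclideanSpace ℝ ι :=
  (√2⁻¹ • (z.1 - z.2), √2⁻¹ • (z.1 + z.2))

lemma hasLaw_rot (Q : Matrix ι ι ℝ) :
    HasLaw rot ((multivariateGaussian 0 Q).prod (multivariateGaussian 0 Q))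
      ((multivariateGaussian (ι := ι) 0 Q).prod (multivariateGaussian 0 Q)) := by
  refine ⟨by unfold rot; fun_prop, ?_⟩
  have h := IsGaussian.map_rotation_eq_self (μ := multivariateGaussian (ι := ι) 0 Q)
    integral_id_multivariateGaussian (-(Real.pi / 4))
  convert h using 2
  ext z : 1
  have e : √2⁻¹ = √2 / 2 := by
    rw [Real.sqrt_inv, inv_eq_one_div, div_eq_div_iff (by positivity) (by norm_num)]
    simp
  rw [ContinuousLinearMap.rotation_apply, Real.cos_neg, Real.sin_neg, Real.cos_pi_div_four,
    Real.sin_pi_div_four, neg_neg, rot, e]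
  ext1
  · simp only [smul_sub]; module
  · simp only [smul_add]

omit [DecidableEq ι] in
lemma quadratic_sub_quadratic {h : Matrix ι ι ℝ} (hh : h.IsSymm) (x y : ι → ℝ) :
    x ⬝ᵥ (h *ᵥ x) - y ⬝ᵥ (h *ᵥ y) = (x - y) ⬝ᵥ (h *ᵥ (x + y)) := by
  have : y ⬝ᵥ (h *ᵥ x) = x ⬝ᵥ (h *ᵥ y) := by
    rw [dotProduct_mulVec, ← mulVec_transpose, hh.eq, dotProduct_comm]
  rw [mulVec_add, sub_dotProduct, dotProduct_add, dotProduct_add, this]; ring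

omit [DecidableEq ι] in
lemma dotProduct_mulVec_of_eq_transpose_mul {m : Type*} [Fintype m] {C : Matrix m ι ℝ}
    (hC : Q = Cᵀ * C) (x : ι → ℝ) :
    x ⬝ᵥ (Q *ᵥ x) = ‖(WithLp.toLp 2 (C *ᵥ x) : EuclideanSpace ℝ m)‖ ^ 2 := by
  rw [← real_inner_self_eq_norm_sq, inner_eq_dotProduct, hC, ← mulVec_mulVec, dotProduct_mulVec,
    vecMul_transpose]

lemma MomBd.congr {E : Type*} [NormedAddCommGroup E] {q : ℕ} {X Y : Ω → E} {b : ℝ}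
    (h : MomBd μ q X b) (e : ∀ ω, Y ω = X ω) : MomBd μ q Y b := by
  rwa [funext e]

/-- Moments of a bilinear form in two independent Gaussian vectors: given the first, it is a Gaussian
variable whose variance is the squared length of a linear image of the first. -/
lemma momBd_bilinear {Q : Matrix ι ι ℝ} (hQ : Q.PosSemidef) (h : Matrix ι ι ℝ) (hh : h.IsSymm)
    {p : ℕ} (hp : 1 ≤ p) :
    MomBd ((multivariateGaussian 0 Q).prod (multivariateGaussian 0 Q)) (2 * p)
      (fun z : EuclideanSpace ℝ ι × EuclideanSpace ℝ ι => z.1.ofLp ⬝ᵥ (h *ᵥ z.2.ofLp))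
      (12 * p * √((Q * h * Q * h).trace)) := by
  -- a square root of the covariance turns the conditional variance into a squared length
  obtain ⟨C, hC⟩ : ∃ C : Matrix ι ι ℝ, Q = Cᵀ * C := by
    obtain ⟨C, hC⟩ := CStarAlgebra.nonneg_iff_eq_star_mul_self.1 hQ.nonneg
    exact ⟨C, by rw [hC, star_eq_conjTranspose, conjTranspose_eq_transpose_of_trivial]⟩
  have hp0 : (0 : ℝ) ≤ p := p.cast_nonneg
  have h1 := fun u : EuclideanSpace ℝ ι =>
    momBd_dotProduct hQ (hasLaw_snd (multivariateGaussian (ι := ι) 0 Q)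
      (multivariateGaussian 0 Q)) (h *ᵥ u.ofLp) hp
  have h2 := (momBd_matE hQ (hasLaw_fst (multivariateGaussian (ι := ι) 0 Q)
      (multivariateGaussian 0 Q)) (C * h) hp).norm.const_mul (√(12 * p))
  rw [abs_of_nonneg (Real.sqrt_nonneg _), ← Real.sqrt_mul (by positivity)] at h2
  have e : √(12 * p * (12 * p * (C * h * Q * (C * h)ᵀ).trace)) =
      12 * p * √((Q * h * Q * h).trace) := by
    rw [← mul_assoc, Real.sqrt_mul (by positivity), Real.sqrt_mul_self (by positivity)]
    congr 2
    rw [transpose_mul, hh.eq, ← Matrix.mul_assoc, Matrix.trace_mul_comm]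
    simp only [← Matrix.mul_assoc]
    rw [← hC]
  rw [e] at h2
  refine MomBd.of_indep (by lia) measurable_fst measurable_snd (indepFun_fst_snd _ _)
    (f := fun z => z.1.ofLp ⬝ᵥ (h *ᵥ z.2.ofLp)) ?_
    (b := fun u => √(12 * p) * ‖matE (C * h) u‖) (fun u => ?_) h2
  · refine Continuous.stronglyMeasurable ?_
    simp only [dotProduct, mulVec]; fun_prop
  · have := h1 u
    rw [dotProduct_mulVec_of_eq_transpose_mul hC, mulVec_mulVec, Real.sqrt_mul (by positivity),
      Real.sqrt_sq (norm_nonneg _)] at this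
    refine MomBd.congr this fun z => ?_
    rw [dotProduct_mulVec, ← mulVec_transpose, hh.eq]

/-- Moments of a centered quadratic form in a Gaussian vector. The difference of the values at two
independent copies is, after a rotation, bilinear in two independent copies, so that the moments
can be computed conditionally on one of them. -/
lemma momBd_quadratic [IsProbabilityMeasure μ] {X : Ω → EuclideanSpace ℝ ι}
    (hQ : Q.PosSemidef) (hX : HasLaw X (multivariateGaussian 0 Q) μ) (h : Matrix ι ι ℝ)
    (hh : h.IsSymm) {p : ℕ} (hp : 1 ≤ p) :
    MomBd μ (2 * p) (fun ω => (X ω).ofLp ⬝ᵥ (h *ᵥ (X ω).ofLp) - (Q * h).trace)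
      (24 * p * √((Q * h * Q * h).trace)) := by
  have h1 := ((momBd_bilinear hQ h hh hp).const_mul 2).comp_hasLaw (hasLaw_rot Q)
  rw [abs_of_pos two_pos] at h1
  have h2 : MomBd ((multivariateGaussian 0 Q).prod (multivariateGaussian 0 Q)) (2 * p)
      (fun z : EuclideanSpace ℝ ι × EuclideanSpace ℝ ι =>
        z.1.ofLp ⬝ᵥ (h *ᵥ z.1.ofLp) - z.2.ofLp ⬝ᵥ (h *ᵥ z.2.ofLp))
      (2 * (12 * p * √((Q * h * Q * h).trace))) := by
    refine h1.congr fun z => ?_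
    rw [quadratic_sub_quadratic hh]
    simp only [rot, WithLp.ofLp_smul, WithLp.ofLp_sub, WithLp.ofLp_add, mulVec_smul,
      smul_dotProduct, dotProduct_smul, smul_eq_mul]
    rw [← mul_assoc, ← mul_assoc, mul_assoc 2, Real.mul_self_sqrt (by norm_num)]
    norm_num
  have hc : Continuous fun x : EuclideanSpace ℝ ι => x.ofLp ⬝ᵥ (h *ᵥ x.ofLp) := by
    simp only [dotProduct, mulVec]; fun_prop
  have h3 := MomBd.integral_indep (by lia) measurable_fst measurable_snd
    (indepFun_fst_snd _ _) (f := fun z : EuclideanSpace ℝ ι × EuclideanSpace ℝ ι =>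
        z.1.ofLp ⬝ᵥ (h *ᵥ z.1.ofLp) - z.2.ofLp ⬝ᵥ (h *ᵥ z.2.ofLp))
    ((hc.comp continuous_fst).sub (hc.comp continuous_snd)).stronglyMeasurable h2
  have e : ∫ z : EuclideanSpace ℝ ι × EuclideanSpace ℝ ι, z.2.ofLp ⬝ᵥ (h *ᵥ z.2.ofLp)
      ∂((multivariateGaussian 0 Q).prod (multivariateGaussian 0 Q)) = (Q * h).trace := by
    have := (hasLaw_snd (multivariateGaussian (ι := ι) 0 Q)
      (multivariateGaussian 0 Q)).integral_comp (f := fun x => x.ofLp ⬝ᵥ (h *ᵥ x.ofLp))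
      hc.aestronglyMeasurable
    rw [integral_quadratic_gaussian hQ] at this
    exact this
  have hi : Integrable (fun z : EuclideanSpace ℝ ι × EuclideanSpace ℝ ι =>
      z.2.ofLp ⬝ᵥ (h *ᵥ z.2.ofLp))
      ((multivariateGaussian 0 Q).prod (multivariateGaussian 0 Q)) :=
    (integrable_quadratic_gaussian Q h).comp_snd _
  have h4 : MomBd ((multivariateGaussian 0 Q).prod (multivariateGaussian 0 Q)) (2 * p)
      (fun z : EuclideanSpace ℝ ι × EuclideanSpace ℝ ι =>
        z.1.ofLp ⬝ᵥ (h *ᵥ z.1.ofLp) - (Q * h).trace)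
      (2 * (12 * p * √((Q * h * Q * h).trace))) := by
    refine h3.congr fun z => ?_
    simp only
    rw [integral_sub (integrable_const _) hi, e]
    simp
  have h5 := (MomBd.of_comp_hasLaw (hasLaw_fst _ _)
    (f := fun x : EuclideanSpace ℝ ι => x.ofLp ⬝ᵥ (h *ᵥ x.ofLp) - (Q * h).trace)
    (hc.sub continuous_const).aestronglyMeasurable h4).comp_hasLaw hX
  exact h5.mono (le_of_eq (by ring))

lemma integral_affine_sq_gaussian (hQ : Q.PosSemidef) (a : ℝ) (b : ι → ℝ) :
    ∫ x : EuclideanSpace ℝ ι, (a + b ⬝ᵥ x.ofLp) ^ 2 ∂(multivariateGaussian 0 Q)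
      = a ^ 2 + b ⬝ᵥ (Q *ᵥ b) := by
  have e : ∀ x : EuclideanSpace ℝ ι, (a + b ⬝ᵥ x.ofLp) ^ 2 =
      a ^ 2 + (2 * a) * (b ⬝ᵥ x.ofLp) + x.ofLp ⬝ᵥ (vecMulVec b b *ᵥ x.ofLp) := fun x => by
    rw [vecMulVec_mulVec]
    simp [dotProduct_smul, dotProduct_comm]
    ring
  simp_rw [e]
  have i1 := (integrable_dotProduct_gaussian Q b).const_mul (2 * a)
  have i0 : Integrable (fun _ : EuclideanSpace ℝ ι => a ^ 2) (multivariateGaussian 0 Q) :=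
    integrable_const _
  have s1 := integral_add (i0.add i1) (integrable_quadratic_gaussian Q (vecMulVec b b))
  have s2 := integral_add i0 i1
  rw [integral_const_mul, integral_dotProduct_gaussian] at s2
  refine s1.trans ?_
  rw [integral_quadratic_gaussian hQ]
  refine (congrArg₂ (· + ·) s2 rfl).trans ?_
  simp [mul_vecMulVec, trace_vecMulVec, dotProduct_comm]

/-- The second moment of a quadratic form in a Gaussian vector dominates twice the Hilbert-Schmidt
pairing, whatever the mean. It is bounded below by the variance, which is half the mean square of
the difference of the values at two independent copies; after a rotation this difference is affine in
one of two independent copies. -/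
lemma le_integral_quadratic_sq (hQ : Q.PosSemidef) {Y : Matrix ι ι ℝ} (hY : Y.IsSymm)
    (m : ι → ℝ) :
    2 * (Q * Y * Q * Y).trace ≤
      ∫ x : EuclideanSpace ℝ ι, ((m + x.ofLp) ⬝ᵥ (Y *ᵥ (m + x.ofLp))) ^ 2
        ∂(multivariateGaussian 0 Q) := by
  set γ := multivariateGaussian (ι := ι) 0 Q with hγ
  set f : EuclideanSpace ℝ ι → ℝ := fun x => (m + x.ofLp) ⬝ᵥ (Y *ᵥ (m + x.ofLp)) with hf
  have hc : Continuous f := by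
    simp only [hf, dotProduct, mulVec, Pi.add_apply]; fun_prop
  have hf2 : MemLp f 2 γ := by
    have h1 := (momBd_quadratic hQ (hasLaw_self γ) Y hY le_rfl).memLp
    have h2 := (momBd_dotProduct hQ (hasLaw_self γ) ((2 : ℝ) • (Y *ᵥ m)) le_rfl).memLp
    have h3 : MemLp (fun _ : EuclideanSpace ℝ ι => m ⬝ᵥ (Y *ᵥ m) + (Q * Y).trace) 2 γ :=
      memLp_const _
    have h4 := (h1.add h2).add (by exact_mod_cast h3)
    norm_num at h4
    refine (memLp_congr_ae (Filter.Eventually.of_forall fun x => ?_)).1 h4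
    have : x.ofLp ⬝ᵥ (Y *ᵥ m) = m ⬝ᵥ (Y *ᵥ x.ofLp) := by
      rw [dotProduct_mulVec, ← mulVec_transpose, hY.eq, dotProduct_comm]
    simp only [hf, Pi.add_apply, mulVec_add, add_dotProduct, dotProduct_add,
      dotProduct_comm (Y *ᵥ m), this]
    ring
  have hfi : Integrable f γ := hf2.integrable (by norm_num)
  have hsq : Integrable (fun x => f x ^ 2) γ := hf2.integrable_sq
  have ip : Integrable (fun z : EuclideanSpace ℝ ι × EuclideanSpace ℝ ι => f z.1 * f z.2)
      (γ.prod γ) := hfi.mul_prod hfi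
  have hi : Integrable (fun z : EuclideanSpace ℝ ι × EuclideanSpace ℝ ι => (f z.1 - f z.2) ^ 2)
      (γ.prod γ) := by
    refine (((hsq.comp_fst γ).add (hsq.comp_snd γ)).sub (ip.const_mul 2)).congr
      (Filter.Eventually.of_forall fun z => ?_)
    simp only [Pi.add_apply, Pi.sub_apply]; ring
  have hle : ∫ z, (f z.1 - f z.2) ^ 2 ∂(γ.prod γ) ≤ 2 * ∫ x, f x ^ 2 ∂γ := by
    have e : ∫ z, (f z.1 - f z.2) ^ 2 ∂(γ.prod γ) =
        (∫ z, f z.1 ^ 2 ∂(γ.prod γ) + ∫ z, f z.2 ^ 2 ∂(γ.prod γ))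
          - 2 * ∫ z, f z.1 * f z.2 ∂(γ.prod γ) := by
      have s1 := integral_add (hsq.comp_fst γ) (hsq.comp_snd γ)
      have s2 := integral_sub ((hsq.comp_fst γ).add (hsq.comp_snd γ)) (ip.const_mul 2)
      rw [← integral_const_mul, ← s1]
      refine Eq.trans ?_ s2
      refine integral_congr_ae (Filter.Eventually.of_forall fun z => ?_)
      simp only [Pi.add_apply]; ring
    have e1 : ∫ z, f z.1 ^ 2 ∂(γ.prod γ) = ∫ x, f x ^ 2 ∂γ :=
      (hasLaw_fst γ γ).integral_comp (f := fun x => f x ^ 2) hsq.1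
    have e2 : ∫ z, f z.2 ^ 2 ∂(γ.prod γ) = ∫ x, f x ^ 2 ∂γ :=
      (hasLaw_snd γ γ).integral_comp (f := fun x => f x ^ 2) hsq.1
    rw [e, e1, e2, integral_prod_mul]
    nlinarith [mul_self_nonneg (∫ x, f x ∂γ)]
  -- in the rotated variables the difference is affine in the second one
  set g : EuclideanSpace ℝ ι × EuclideanSpace ℝ ι → ℝ := fun z =>
    (2 * √2 * (m ⬝ᵥ (Y *ᵥ z.1.ofLp)) + ((2 : ℝ) • (Y *ᵥ z.1.ofLp)) ⬝ᵥ z.2.ofLp) ^ 2 with hg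
  have hgc : Continuous g := by
    simp only [hg, dotProduct, mulVec, Pi.smul_apply]; fun_prop
  have hgr : ∀ z, g (rot z) = (f z.1 - f z.2) ^ 2 := fun z => by
    simp only [hg, hf]
    congr 1
    rw [quadratic_sub_quadratic hY]
    have e1 : m + z.1.ofLp - (m + z.2.ofLp) = z.1.ofLp - z.2.ofLp := by abel
    have e2 : m + z.1.ofLp + (m + z.2.ofLp) = (2 : ℝ) • m + (z.1.ofLp + z.2.ofLp) := by
      rw [two_smul]; abel
    have e3 : (√2)⁻¹ * (√2)⁻¹ * 2 = 1 := by
      rw [← mul_inv, Real.mul_self_sqrt (by norm_num)]; norm_num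
    have e4 : 2 * √2 * (√2)⁻¹ = 2 := by field_simp
    have e5 : ∀ a b : ι → ℝ, (Y *ᵥ a) ⬝ᵥ b = a ⬝ᵥ (Y *ᵥ b) := fun a b => by
      rw [dotProduct_mulVec, ← mulVec_transpose, hY.eq]
    have e6 : ∀ a : ι → ℝ, m ⬝ᵥ (Y *ᵥ a) = a ⬝ᵥ (Y *ᵥ m) := fun a => by
      rw [dotProduct_comm, e5]
    rw [e1, e2]
    simp only [rot, WithLp.ofLp_smul, WithLp.ofLp_sub, WithLp.ofLp_add, Real.sqrt_inv, mulVec_smul,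
      mulVec_add, smul_dotProduct, dotProduct_smul, dotProduct_add, smul_eq_mul,
      e5, e6]
    linear_combination ((z.1.ofLp - z.2.ofLp) ⬝ᵥ (Y *ᵥ m)) * e4
      + ((z.1.ofLp - z.2.ofLp) ⬝ᵥ (Y *ᵥ z.1.ofLp) + (z.1.ofLp - z.2.ofLp) ⬝ᵥ (Y *ᵥ z.2.ofLp)) * e3
  have hgi : Integrable g (γ.prod γ) := by
    have hr := hasLaw_rot Q
    have : Integrable (g ∘ rot) (γ.prod γ) :=
      hi.congr (Filter.Eventually.of_forall fun z => (hgr z).symm)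
    have h2 := (integrable_map_measure (f := rot) (μ := γ.prod γ) hgc.aestronglyMeasurable
      hr.aemeasurable).2 this
    rwa [hr.map_eq] at h2
  have heq : ∫ z, (f z.1 - f z.2) ^ 2 ∂(γ.prod γ) = ∫ z, g z ∂(γ.prod γ) := by
    rw [← (hasLaw_rot Q).integral_comp hgc.aestronglyMeasurable]
    exact integral_congr_ae (Filter.Eventually.of_forall fun z => (hgr z).symm)
  have hinner : ∀ u : EuclideanSpace ℝ ι, ∫ v, g (u, v) ∂γ =
      (8 * (u.ofLp ⬝ᵥ (vecMulVec (Y *ᵥ m) (Y *ᵥ m) *ᵥ u.ofLp)))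
        + 4 * (u.ofLp ⬝ᵥ ((Y * Q * Y) *ᵥ u.ofLp)) := fun u => by
    simp only [hg]
    rw [integral_affine_sq_gaussian hQ]
    have e5 : ∀ a b : ι → ℝ, (Y *ᵥ a) ⬝ᵥ b = a ⬝ᵥ (Y *ᵥ b) := fun a b => by
      rw [dotProduct_mulVec, ← mulVec_transpose, hY.eq]
    have e7 : (√2) ^ 2 = 2 := Real.sq_sqrt (by norm_num)
    rw [← mulVec_mulVec, ← mulVec_mulVec, vecMulVec_mulVec, ← e5 m]
    simp only [mulVec_smul, smul_dotProduct, dotProduct_smul, e5, smul_eq_mul,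
      mul_pow, e7, op_smul_eq_smul]
    rw [dotProduct_comm m, e5]
    rw [show u.ofLp ⬝ᵥ (Y *ᵥ m) = m ⬝ᵥ (Y *ᵥ u.ofLp) by rw [← e5, dotProduct_comm]]
    ring
  have i1 := integrable_quadratic_gaussian Q (vecMulVec (Y *ᵥ m) (Y *ᵥ m))
  have i2 := integrable_quadratic_gaussian Q (Y * Q * Y)
  have hval : ∫ z, g z ∂(γ.prod γ) = 8 * ((Y *ᵥ m) ⬝ᵥ (Q *ᵥ (Y *ᵥ m)))
      + 4 * (Q * Y * Q * Y).trace := by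
    rw [integral_prod _ hgi]
    simp_rw [hinner]
    rw [integral_add (i1.const_mul 8) (i2.const_mul 4), integral_const_mul, integral_const_mul,
      integral_quadratic_gaussian hQ, integral_quadratic_gaussian hQ]
    simp [mul_vecMulVec, trace_vecMulVec, dotProduct_comm, Matrix.mul_assoc]
  have hpos : 0 ≤ (Y *ᵥ m) ⬝ᵥ (Q *ᵥ (Y *ᵥ m)) := by
    simpa using hQ.dotProduct_mulVec_nonneg (Y *ᵥ m)
  rw [heq, hval] at hle
  linarith

end GaussianQuadratic

/-! ### Independence and sums of Gaussian vectors -/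

section IndependentData

variable {Ω : Type*} [MeasurableSpace Ω] {μ : Measure Ω}

/-- If two independent pairs each have independent components, then the pair of the first components
is independent of the pair of the second components. -/
lemma IndepFun.prodMk_of_indepFun [IsZeroOrProbabilityMeasure μ]
    {α β γ δ : Type*} [MeasurableSpace α] [MeasurableSpace β]
    [MeasurableSpace γ] [MeasurableSpace δ] {X₁ : Ω → α} {X₂ : Ω → β} {Y₁ : Ω → γ} {Y₂ : Ω → δ}
    (hX₁ : Measurable X₁) (hX₂ : Measurable X₂) (hY₁ : Measurable Y₁) (hY₂ : Measurable Y₂)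
    (hX : IndepFun X₁ X₂ μ) (hY : IndepFun Y₁ Y₂ μ)
    (hXY : IndepFun (fun ω => (X₁ ω, X₂ ω)) (fun ω => (Y₁ ω, Y₂ ω)) μ) :
    IndepFun (fun ω => (X₁ ω, Y₁ ω)) (fun ω => (X₂ ω, Y₂ ω)) μ := by
  rw [IndepFun_iff_Indep]
  refine IndepSets.indep (hX₁.prodMk hY₁).comap_le (hX₂.prodMk hY₂).comap_le
    (isPiSystem_prod.comap fun ω => (X₁ ω, Y₁ ω)) (isPiSystem_prod.comap fun ω => (X₂ ω, Y₂ ω))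
    ?_ ?_ ?_
  · rw [← generateFrom_prod, MeasurableSpace.comap_generateFrom]; rfl
  · rw [← generateFrom_prod, MeasurableSpace.comap_generateFrom]; rfl
  rw [IndepSets_iff]
  rintro _ _ ⟨_, ⟨A, hA, B, hB, rfl⟩, rfl⟩ ⟨_, ⟨C, hC, D, hD, rfl⟩, rfl⟩
  simp only [Set.mem_ofPred_eq] at hA hB hC hD
  have h1 := hXY.measure_inter_preimage_eq_mul (A ×ˢ C) (B ×ˢ D) (hA.prod hC) (hB.prod hD)
  have h2 := hX.measure_inter_preimage_eq_mul A C hA hC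
  have h3 := hY.measure_inter_preimage_eq_mul B D hB hD
  have h4 := (hXY.comp measurable_fst measurable_fst).measure_inter_preimage_eq_mul A B hA hB
  have h5 := (hXY.comp measurable_snd measurable_snd).measure_inter_preimage_eq_mul C D hC hD
  simp only [Set.mk_preimage_prod] at *
  have e : X₁ ⁻¹' A ∩ Y₁ ⁻¹' B ∩ (X₂ ⁻¹' C ∩ Y₂ ⁻¹' D)
      = X₁ ⁻¹' A ∩ X₂ ⁻¹' C ∩ (Y₁ ⁻¹' B ∩ Y₂ ⁻¹' D) := by
    ext ω; simp only [Set.mem_inter_iff]; tauto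
  rw [e, h1, h2, h3]
  have h4' : μ (X₁ ⁻¹' A ∩ Y₁ ⁻¹' B) = μ (X₁ ⁻¹' A) * μ (Y₁ ⁻¹' B) := h4
  have h5' : μ (X₂ ⁻¹' C ∩ Y₂ ⁻¹' D) = μ (X₂ ⁻¹' C) * μ (Y₂ ⁻¹' D) := h5
  rw [h4', h5']
  ring

/-- The first `T` terms of a sequence, continued by zero. -/
def trunc {E : Type*} [Zero E] (T : ℕ) (w : ℕ → E) : ℕ → E := fun t => if t < T then w t else 0

lemma trunc_apply {E : Type*} [Zero E] {T t : ℕ} (h : t < T) (w : ℕ → E) : trunc T w t = w t :=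
  if_pos h

lemma measurable_trunc {E : Type*} [Zero E] [MeasurableSpace E] (T : ℕ) :
    Measurable (trunc T : (ℕ → E) → ℕ → E) := by
  refine measurable_pi_iff.2 fun t => ?_
  unfold trunc
  split_ifs <;> fun_prop

/-- The past of a sequence of independent variables is independent of its future. -/
lemma iIndepFun.indepFun_trunc_shift {E : Type*} [Zero E] [MeasurableSpace E] {w : ℕ → Ω → E}
    (hw : iIndepFun w μ) (hm : ∀ t, Measurable (w t)) (T : ℕ) :
    IndepFun (fun ω => trunc T fun t => w t ω) (fun ω i => w (T + i) ω) μ := by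
  rw [IndepFun_iff_Indep]
  have h := indep_iSup_of_disjoint (m := fun t => MeasurableSpace.comap (w t) inferInstance)
    (fun t => (hm t).comap_le) ((iIndepFun_iff_iIndep _ _ _).1 hw)
    (S := {t | t < T}) (T := {t | T ≤ t}) (by
      rw [Set.disjoint_left]; intro t h1 h2; simp only [Set.mem_ofPred_eq] at h1 h2; lia)
  refine indep_of_indep_of_le_left (indep_of_indep_of_le_right h ?_) ?_
  · rw [← measurable_iff_comap_le]
    refine @measurable_pi_lambda Ω ℕ (fun _ => E) (⨆ i ∈ {t | T ≤ t}, _) _ _ fun i => ?_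
    refine (comap_measurable (w (T + i))).mono ?_ le_rfl
    exact le_iSup₂_of_le (T + i) (by simp) le_rfl
  · rw [← measurable_iff_comap_le]
    refine @measurable_pi_lambda Ω ℕ (fun _ => E) (⨆ i ∈ {t | t < T}, _) _ _ fun t => ?_
    by_cases ht : t < T
    · have e : (fun ω => trunc T (fun t => w t ω) t) = w t := by
        ext ω; exact trunc_apply ht _
      rw [e]
      refine (comap_measurable (w t)).mono ?_ le_rfl
      exact le_iSup₂_of_le t (by simpa using ht) le_rfl
    · have e : (fun ω => trunc T (fun t => w t ω) t) = fun _ => 0 := by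
        ext ω; simp [trunc, ht]
      rw [e]
      exact measurable_const

end IndependentData

section GaussianSum

variable {Ω : Type*} [MeasurableSpace Ω] {μ : Measure Ω}

lemma charFun_map_matE {m k : Type*} [Fintype m] [Fintype k] [DecidableEq k] [DecidableEq m]
    (ν : Measure (EuclideanSpace ℝ k)) (T : Matrix m k ℝ) (t : EuclideanSpace ℝ m) :
    charFun (ν.map (matE T)) t = charFun ν (matE Tᵀ t) := by
  rw [charFun_apply, charFun_apply, integral_map (by fun_prop) (by fun_prop)]
  refine integral_congr_ae (Filter.Eventually.of_forall fun x => ?_)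
  simp only
  rw [real_inner_comm, inner_matE, real_inner_comm]

lemma transpose_mulVec_quadratic {m k : Type*} [Fintype m] [Fintype k] (T : Matrix m k ℝ)
    (Q : Matrix k k ℝ) (t : m → ℝ) :
    (Tᵀ *ᵥ t) ⬝ᵥ (Q *ᵥ (Tᵀ *ᵥ t)) = t ⬝ᵥ ((T * Q * Tᵀ) *ᵥ t) := by
  rw [← mulVec_mulVec, ← mulVec_mulVec, dotProduct_mulVec t T, mulVec_transpose]

/-- Linear combinations of independent Gaussian vectors are Gaussian; possibly degenerate covariances
are allowed. -/
lemma hasLaw_add_gaussian [IsProbabilityMeasure μ] {m k l : Type*} [Fintype m] [Fintype k]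
    [DecidableEq k] [DecidableEq m] [Fintype l] [DecidableEq l]
    {X : Ω → EuclideanSpace ℝ k} {Y : Ω → EuclideanSpace ℝ l} {Q : Matrix k k ℝ} {R : Matrix l l ℝ}
    (hQ : Q.PosSemidef) (hR : R.PosSemidef) (hX : HasLaw X (multivariateGaussian 0 Q) μ)
    (hY : HasLaw Y (multivariateGaussian 0 R) μ) (hXY : IndepFun X Y μ)
    (T : Matrix m k ℝ) (U : Matrix m l ℝ) :
    HasLaw (fun ω => matE T (X ω) + matE U (Y ω))
      (multivariateGaussian 0 (T * Q * Tᵀ + U * R * Uᵀ)) μ := by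
  have hXm := hX.aemeasurable
  have hYm := hY.aemeasurable
  have hTX : AEMeasurable (fun ω => matE T (X ω)) μ := by fun_prop
  have hUY : AEMeasurable (fun ω => matE U (Y ω)) μ := by fun_prop
  refine ⟨hTX.add hUY, ?_⟩
  have h1 : (T * Q * Tᵀ).PosSemidef := by
    simpa using hQ.mul_mul_conjTranspose_same T
  have h2 : (U * R * Uᵀ).PosSemidef := by
    simpa using hR.mul_mul_conjTranspose_same U
  have : IsProbabilityMeasure (μ.map fun ω => matE T (X ω) + matE U (Y ω)) :=
    Measure.isProbabilityMeasure_map (hTX.add hUY)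
  refine Measure.ext_of_charFun ?_
  ext t
  have hind : IndepFun (fun ω => matE T (X ω)) (fun ω => matE U (Y ω)) μ :=
    hXY.comp (φ := matE T) (ψ := matE U) (by fun_prop) (by fun_prop)
  have e := hind.charFun_map_add_eq_mul hTX hUY
  have e' : charFun (μ.map fun ω => matE T (X ω) + matE U (Y ω)) t =
      charFun (μ.map fun ω => matE T (X ω)) t * charFun (μ.map fun ω => matE U (Y ω)) t :=
    congrFun e t
  have eX : μ.map (fun ω => matE T (X ω)) = (multivariateGaussian 0 Q).map (matE T) := by
    rw [← hX.map_eq, AEMeasurable.map_map_of_aemeasurable (by fun_prop) hXm]; rfl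
  have eY : μ.map (fun ω => matE U (Y ω)) = (multivariateGaussian 0 R).map (matE U) := by
    rw [← hY.map_eq, AEMeasurable.map_map_of_aemeasurable (by fun_prop) hYm]; rfl
  rw [e', eX, eY, charFun_map_matE, charFun_map_matE, charFun_multivariateGaussian hQ,
    charFun_multivariateGaussian hR, charFun_multivariateGaussian (h1.add h2), ← Complex.exp_add]
  congr 1
  simp only [inner_zero_right, Complex.ofReal_zero, zero_mul, zero_sub, ofLp_matE]
  rw [transpose_mulVec_quadratic, transpose_mulVec_quadratic, add_mulVec, dotProduct_add]
  push_cast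
  ring

end GaussianSum

/-! ### The exploration process -/

section Exploration

variable {n d : ℕ}

/-- A realization of the noise sequence and of the sequence of exploratory actions. -/
abbrev Data (n d : ℕ) := (ℕ → EuclideanSpace ℝ (Fin n)) × (ℕ → EuclideanSpace ℝ (Fin d))

/-- The data up to noise index `T` and action index `J`, continued by zero. -/
def Data.past (T J : ℕ) (u : Data n d) : Data n d := (trunc T u.1, trunc J u.2)

lemma Data.measurable_past (T J : ℕ) : Measurable (Data.past T J : Data n d → Data n d) :=
  ((measurable_trunc T).comp measurable_fst).prodMk ((measurable_trunc J).comp measurable_snd)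

/-- The noise accumulated by the closed loop `x ↦ L x + w` started at zero. -/
def loopNoise (L : Matrix (Fin n) (Fin n) ℝ) (w : ℕ → EuclideanSpace ℝ (Fin n)) :
    ℕ → EuclideanSpace ℝ (Fin n)
  | 0 => 0
  | j + 1 => matE L (loopNoise L w j) + w j

/-- The covariance of the noise accumulated by the closed loop. -/
def loopCov (L W : Matrix (Fin n) (Fin n) ℝ) : ℕ → Matrix (Fin n) (Fin n) ℝ
  | 0 => 0
  | j + 1 => L * loopCov L W j * Lᵀ + W

lemma measurable_loopNoise (L : Matrix (Fin n) (Fin n) ℝ) (j : ℕ) :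
    Measurable fun w : ℕ → EuclideanSpace ℝ (Fin n) => loopNoise L w j := by
  induction j with
  | zero => exact measurable_const
  | succ j ih => exact ((matE L).continuous.measurable.comp ih).add (measurable_pi_apply j)

lemma loopNoise_congr (L : Matrix (Fin n) (Fin n) ℝ) {w w' : ℕ → EuclideanSpace ℝ (Fin n)} {j : ℕ}
    (h : ∀ i < j, w i = w' i) : loopNoise L w j = loopNoise L w' j := by
  induction j with
  | zero => rfl
  | succ j ih =>
    simp only [loopNoise]
    rw [ih fun i hi => h i (by lia), h j (by lia)]

lemma posSemidef_loopCov {W : Matrix (Fin n) (Fin n) ℝ} (L : Matrix (Fin n) (Fin n) ℝ)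
    (hW : W.PosSemidef) (j : ℕ) : (loopCov L W j).PosSemidef := by
  induction j with
  | zero => exact Matrix.PosSemidef.zero
  | succ j ih =>
    refine Matrix.PosSemidef.add ?_ hW
    simpa using ih.mul_mul_conjTranspose_same L

lemma fromBlocks_diagonal_eq (C : Matrix (Fin n) (Fin n) ℝ) (D : Matrix (Fin d) (Fin d) ℝ) :
    fromBlocks C 0 0 D =
      (fromRows 1 0 : Matrix (Fin n ⊕ Fin d) (Fin n) ℝ) * C *
        (fromRows 1 0 : Matrix (Fin n ⊕ Fin d) (Fin n) ℝ)ᵀ +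
      (fromRows 0 1 : Matrix (Fin n ⊕ Fin d) (Fin d) ℝ) * D *
        (fromRows 0 1 : Matrix (Fin n ⊕ Fin d) (Fin d) ℝ)ᵀ := by
  simp only [fromRows_mul, transpose_fromRows, mul_fromCols, transpose_one,
    transpose_zero, Matrix.one_mul, Matrix.zero_mul, Matrix.mul_one, Matrix.mul_zero]
  ext (i | i) (j | j) <;> simp

/-- The stationary covariance, split at time `j`: the covariance of a state remembered from time `0`
and that of the noise accumulated since. -/
lemma eq_pow_mul_add_loopCov {L W Sig : Matrix (Fin n) (Fin n) ℝ} (h : Sig = L * Sig * Lᵀ + W)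
    (j : ℕ) : Sig = L ^ j * Sig * (L ^ j)ᵀ + loopCov L W j := by
  induction j with
  | zero => simp [loopCov]
  | succ j ih =>
    rw [loopCov, ← add_assoc, pow_succ', transpose_mul]
    have e : L * L ^ j * Sig * ((L ^ j)ᵀ * Lᵀ) + L * loopCov L W j * Lᵀ
        = L * (L ^ j * Sig * (L ^ j)ᵀ + loopCov L W j) * Lᵀ := by
      simp only [Matrix.mul_add, Matrix.add_mul, Matrix.mul_assoc]
    rw [e, ← ih]
    exact h

namespace LQProblem

variable (S : LQProblem n d)

/-- The closed-loop matrix of the policy `x ↦ -K x`. -/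
abbrev loop (K : Matrix (Fin d) (Fin n) ℝ) : Matrix (Fin n) (Fin n) ℝ := S.A - S.B * K

/-- The state at time `t`, as a vector of Euclidean space. -/
def state (K : Matrix (Fin d) (Fin n) ℝ) (s : ℕ) (x : EuclideanSpace ℝ (Fin n)) (u : Data n d)
    (t : ℕ) : EuclideanSpace ℝ (Fin n) :=
  WithLp.toLp 2 (S.trajectory K s x.ofLp (fun t => (u.1 t).ofLp) (fun k => (u.2 k).ofLp) t)

/-- The pair `z = (x, a)` of the `k`-th exploratory tuple. -/
def regressor (K : Matrix (Fin d) (Fin n) ℝ) (s : ℕ) (x : EuclideanSpace ℝ (Fin n)) (u : Data n d)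
    (k : ℕ) : EuclideanSpace ℝ (Fin n ⊕ Fin d) :=
  WithLp.toLp 2 (Sum.elim
    (S.exploreState K s x.ofLp (fun t => (u.1 t).ofLp) (fun k => (u.2 k).ofLp) k) (u.2 k).ofLp)

/-- The part of the pair `z = (x, a)` that is generated in the `k`-th block, independently of
everything before that block. -/
def blockPart (K : Matrix (Fin d) (Fin n) ℝ) (s : ℕ) (u : Data n d) (k : ℕ) :
    EuclideanSpace ℝ (Fin n ⊕ Fin d) :=
  matE (fromRows 1 0) (loopNoise (S.loop K) (fun i => u.1 (k * s + i)) (s - 1)) +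
    matE (fromRows 0 1) (u.2 k)

/-- The map sending the state at the beginning of a block to its contribution to `z = (x, a)`. -/
abbrev carry (K : Matrix (Fin d) (Fin n) ℝ) (s : ℕ) : Matrix (Fin n ⊕ Fin d) (Fin n) ℝ :=
  fromRows (S.loop K ^ (s - 1)) 0

/-- The block matrix `(A  B)`. -/
abbrev dyn : Matrix (Fin n) (Fin n ⊕ Fin d) ℝ := fromCols S.A S.B

/-- The covariance of `blockPart`. -/
abbrev blockCov (K : Matrix (Fin d) (Fin n) ℝ) (SigA : Matrix (Fin d) (Fin d) ℝ) (s : ℕ) :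
    Matrix (Fin n ⊕ Fin d) (Fin n ⊕ Fin d) ℝ :=
  fromBlocks (loopCov (S.loop K) S.W (s - 1)) 0 0 SigA

variable {S} {K : Matrix (Fin d) (Fin n) ℝ} {s : ℕ}

lemma state_zero (x : EuclideanSpace ℝ (Fin n)) (u : Data n d) : S.state K s x u 0 = x := rfl

lemma state_succ_of_mod_ne {t : ℕ} (ht : (t + 1) % s ≠ 0) (x : EuclideanSpace ℝ (Fin n))
    (u : Data n d) : S.state K s x u (t + 1) = matE (S.loop K) (S.state K s x u t) + u.1 t := by
  ext i
  simp only [state, trajectory, ht, if_false, PiLp.add_apply, ofLp_matE, loop, sub_mulVec,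
    mulVec_neg, ← mulVec_mulVec, Pi.add_apply, Pi.sub_apply, Pi.neg_apply]
  ring

lemma state_succ_of_mod_eq {t : ℕ} (ht : (t + 1) % s = 0) (x : EuclideanSpace ℝ (Fin n))
    (u : Data n d) : S.state K s x u (t + 1) =
      matE S.A (S.state K s x u t) + matE S.B (u.2 (t / s)) + u.1 t := by
  ext i
  simp only [state, trajectory, ht, if_true, PiLp.add_apply, ofLp_matE, Pi.add_apply]

lemma measurable_state (S : LQProblem n d) (K : Matrix (Fin d) (Fin n) ℝ) (s t : ℕ) :
    Measurable fun z : EuclideanSpace ℝ (Fin n) × Data n d => S.state K s z.1 z.2 t := by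
  induction t with
  | zero => exact measurable_fst
  | succ t ih =>
    have h1 : Measurable fun z : EuclideanSpace ℝ (Fin n) × Data n d => z.2.1 t :=
      (measurable_pi_apply t).comp (measurable_fst.comp measurable_snd)
    have h2 : Measurable fun z : EuclideanSpace ℝ (Fin n) × Data n d => z.2.2 (t / s) :=
      (measurable_pi_apply _).comp (measurable_snd.comp measurable_snd)
    by_cases ht : (t + 1) % s = 0
    · simp_rw [state_succ_of_mod_eq ht]
      fun_prop
    · simp_rw [state_succ_of_mod_ne ht]
      fun_prop

/-- The state at time `t` depends only on the noise before `t` and on the actions of the completed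
blocks. -/
lemma state_past {T J t : ℕ} (hT : t ≤ T) (hJ : t / s ≤ J)
    (x : EuclideanSpace ℝ (Fin n)) (u : Data n d) :
    S.state K s x (u.past T J) t = S.state K s x u t := by
  induction t with
  | zero => rfl
  | succ t ih =>
    have ih' := ih (by lia) ((Nat.div_le_div_right (by lia)).trans hJ)
    have e1 : (u.past T J).1 t = u.1 t := trunc_apply (by lia) _
    by_cases ht : (t + 1) % s = 0
    · have hlt : t / s < J := by
        refine lt_of_lt_of_le ?_ hJ
        rw [Nat.succ_div_of_dvd (Nat.dvd_of_mod_eq_zero ht)]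
        lia
      have e2 : (u.past T J).2 (t / s) = u.2 (t / s) := trunc_apply hlt _
      rw [state_succ_of_mod_eq ht, state_succ_of_mod_eq ht, ih', e1, e2]
    · rw [state_succ_of_mod_ne ht, state_succ_of_mod_ne ht, ih', e1]

lemma state_block (k : ℕ) {j : ℕ} (hj : j < s) (x : EuclideanSpace ℝ (Fin n)) (u : Data n d) :
    S.state K s x u (k * s + j) = matE (S.loop K ^ j) (S.state K s x u (k * s)) +
      loopNoise (S.loop K) (fun i => u.1 (k * s + i)) j := by
  induction j with
  | zero => simp [loopNoise, matE_one]
  | succ j ih =>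
    have ht : (k * s + j + 1) % s ≠ 0 := by
      rw [add_assoc, Nat.mul_add_mod_of_lt hj]
      lia
    rw [← add_assoc, state_succ_of_mod_ne ht, ih (by lia), loopNoise, map_add, pow_succ', matE_mul,
      add_assoc]

lemma regressor_eq (hs : 1 ≤ s) (k : ℕ) (x : EuclideanSpace ℝ (Fin n)) (u : Data n d) :
    S.regressor K s x u k =
      matE (S.carry K s) (S.state K s x u (k * s)) + S.blockPart K s u k := by
  have h := state_block (S := S) (K := K) k (j := s - 1) (by lia : s - 1 < s) x u
  have h' := congrArg WithLp.ofLp h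
  ext i
  simp only [regressor, exploreState, blockPart, PiLp.add_apply, ofLp_matE, fromRows_mulVec,
    one_mulVec, zero_mulVec]
  rcases i with i | i
  · have := congrFun h' i
    simp only [state, PiLp.add_apply, ofLp_matE] at this
    simp only [Sum.elim_inl, Pi.zero_apply, add_zero]
    exact this
  · simp

lemma state_next (hs : 1 ≤ s) (k : ℕ) (x : EuclideanSpace ℝ (Fin n)) (u : Data n d) :
    S.state K s x u ((k + 1) * s) = matE S.dyn (S.regressor K s x u k) +
      u.1 (k * s + (s - 1)) := by
  have e : (k + 1) * s = k * s + (s - 1) + 1 := by rw [add_mul]; lia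
  have e1 : (k * s + (s - 1)) / s = k := by
    rw [mul_comm, Nat.mul_add_div (by lia), Nat.div_eq_of_lt (by lia), add_zero]
  rw [e, state_succ_of_mod_eq (by rw [← e]; simp), e1]
  congr 1
  ext i
  simp only [regressor, exploreState, state, PiLp.add_apply, ofLp_matE, fromCols_mulVec,
    Sum.elim_comp_inl, Sum.elim_comp_inr, Pi.add_apply]

lemma regressor_past (hs : 1 ≤ s) {T J k : ℕ} (hT : k * s + (s - 1) ≤ T) (hJ : k < J)
    (x : EuclideanSpace ℝ (Fin n)) (u : Data n d) :
    S.regressor K s x (u.past T J) k = S.regressor K s x u k := by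
  rw [regressor_eq hs, regressor_eq hs, state_past (by lia)
    (by rw [Nat.mul_div_cancel _ (by lia)]; lia)]
  congr 1
  simp only [blockPart]
  have e2 : (u.past T J).2 k = u.2 k := trunc_apply hJ _
  rw [e2]
  congr 2
  exact loopNoise_congr _ fun i hi => trunc_apply (by lia) _

lemma measurable_regressor (S : LQProblem n d) (K : Matrix (Fin d) (Fin n) ℝ) (s k : ℕ) :
    Measurable fun z : EuclideanSpace ℝ (Fin n) × Data n d => S.regressor K s z.1 z.2 k := by
  have h := measurable_state S K s (k * s + (s - 1))
  have h2 : Measurable fun z : EuclideanSpace ℝ (Fin n) × Data n d => z.2.2 k :=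
    (measurable_pi_apply _).comp (measurable_snd.comp measurable_snd)
  have e : (fun z : EuclideanSpace ℝ (Fin n) × Data n d => S.regressor K s z.1 z.2 k) =
      fun z => matE (fromRows 1 0) (S.state K s z.1 z.2 (k * s + (s - 1))) +
        matE (fromRows 0 1) (z.2.2 k) := by
    ext z i
    simp only [regressor, exploreState, PiLp.add_apply, ofLp_matE, fromRows_mulVec,
      one_mulVec, zero_mulVec, state]
    rcases i with i | i <;> simp
  rw [e]
  fun_prop

end LQProblem

/-! ### Laws and independence along the trajectory -/

section Laws

variable {Ω : Type*} [MeasurableSpace Ω] {μ : Measure Ω} [IsProbabilityMeasure μ]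
  {S : LQProblem n d} {SigA : Matrix (Fin d) (Fin d) ℝ}
  {m₀ : EuclideanSpace ℝ (Fin n)} {Sig₀ : Matrix (Fin n) (Fin n) ℝ}
  {x₀ : Ω → EuclideanSpace ℝ (Fin n)} {Hhat : Ω → Matrix (Fin n) (Fin n) ℝ}
  {w : ℕ → Ω → EuclideanSpace ℝ (Fin n)} {a : ℕ → Ω → EuclideanSpace ℝ (Fin d)}

/-- The random data of a data collection. -/
def dataOf (w : ℕ → Ω → EuclideanSpace ℝ (Fin n)) (a : ℕ → Ω → EuclideanSpace ℝ (Fin d)) (ω : Ω) :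
    Data n d := (fun t => w t ω, fun k => a k ω)

namespace IsDataCollection

variable (h : IsDataCollection μ S.W SigA m₀ Sig₀ x₀ Hhat w a)
include h

omit [IsProbabilityMeasure μ] in
lemma measurable_dataOf : Measurable (dataOf w a) :=
  (measurable_pi_lambda _ h.measurable_noise).prodMk (measurable_pi_lambda _ h.measurable_action)

/-- The data before noise index `T` and action index `J` are independent of the later data. -/
lemma indepFun_past_future (T J : ℕ) :
    IndepFun (fun ω => (dataOf w a ω).past T J)
      (fun ω => ((fun i => w (T + i) ω), fun j => a (J + j) ω)) μ := by
  have mw : Measurable fun ω t => w t ω := measurable_pi_lambda _ h.measurable_noise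
  have ma : Measurable fun ω k => a k ω := measurable_pi_lambda _ h.measurable_action
  have hw := iIndepFun.indepFun_trunc_shift h.indep_noise h.measurable_noise T
  have ha := iIndepFun.indepFun_trunc_shift h.indep_action h.measurable_action J
  refine IndepFun.prodMk_of_indepFun ((measurable_trunc T).comp mw)
    (measurable_pi_lambda _ fun i => h.measurable_noise (T + i)) ((measurable_trunc J).comp ma)
    (measurable_pi_lambda _ fun j => h.measurable_action (J + j)) hw ha ?_
  exact h.indep_noise_action.comp
    (φ := fun w : ℕ → EuclideanSpace ℝ (Fin n) => (trunc T w, fun i => w (T + i)))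
    (ψ := fun a : ℕ → EuclideanSpace ℝ (Fin d) => (trunc J a, fun i => a (J + i)))
    ((measurable_trunc T).prodMk (by fun_prop)) ((measurable_trunc J).prodMk (by fun_prop))

lemma indepFun_past_noise (T J : ℕ) :
    IndepFun (fun ω => (dataOf w a ω).past T J) (w T) μ :=
  (h.indepFun_past_future T J).comp (φ := id) (ψ := fun z : Data n d => z.1 0) measurable_id
    (by fun_prop)

lemma indepFun_past_blockPart (K : Matrix (Fin d) (Fin n) ℝ) (s k : ℕ) :
    IndepFun (fun ω => (dataOf w a ω).past (k * s) k)
      (fun ω => S.blockPart K s (dataOf w a ω) k) μ := by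
  refine (h.indepFun_past_future (k * s) k).comp (φ := id)
    (ψ := fun z : Data n d => matE (fromRows 1 0) (loopNoise (S.loop K) z.1 (s - 1)) +
      matE (fromRows 0 1) (z.2 0)) measurable_id ?_
  have : Measurable fun z : Data n d => loopNoise (S.loop K) z.1 (s - 1) :=
    (measurable_loopNoise (S.loop K) (s - 1)).comp measurable_fst
  exact ((matE _).continuous.measurable.comp this).add
    ((matE _).continuous.measurable.comp ((measurable_pi_apply 0).comp measurable_snd))

lemma hasLaw_loopNoise (L : Matrix (Fin n) (Fin n) ℝ) (T j : ℕ) :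
    HasLaw (fun ω => loopNoise L (fun i => w (T + i) ω) j)
      (multivariateGaussian 0 (loopCov L S.W j)) μ := by
  induction j with
  | zero =>
    refine ⟨aemeasurable_const, ?_⟩
    simp [loopNoise, loopCov, multivariateGaussian]
  | succ j ih =>
    have hind : IndepFun (fun ω => loopNoise L (fun i => w (T + i) ω) j) (w (T + j)) μ := by
      have hi := (h.indepFun_past_noise (T + j) 0).comp
        (φ := fun u : Data n d => loopNoise L (fun i => u.1 (T + i)) j) (ψ := id)
        ((measurable_loopNoise L j).comp (by fun_prop)) measurable_id
      refine hi.congr (Filter.Eventually.of_forall fun ω => ?_) Filter.EventuallyEq.rfl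
      exact loopNoise_congr L fun i hi => trunc_apply (by lia) _
    have := hasLaw_add_gaussian (posSemidef_loopCov L S.posSemidef_W j) S.posSemidef_W ih
      (h.law_noise (T + j)) hind L 1
    simp only [matE_one, Matrix.one_mul, transpose_one, Matrix.mul_one] at this
    exact this

lemma hasLaw_blockPart (hA : SigA.PosSemidef) (K : Matrix (Fin d) (Fin n) ℝ) (s k : ℕ) :
    HasLaw (fun ω => S.blockPart K s (dataOf w a ω) k)
      (multivariateGaussian 0 (S.blockCov K SigA s)) μ := by
  have hind : IndepFun (fun ω => loopNoise (S.loop K) (fun i => w (k * s + i) ω) (s - 1)) (a k) μ :=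
    h.indep_noise_action.comp
      (φ := fun w : ℕ → EuclideanSpace ℝ (Fin n) =>
        loopNoise (S.loop K) (fun i => w (k * s + i)) (s - 1))
      (ψ := fun a : ℕ → EuclideanSpace ℝ (Fin d) => a k)
      ((measurable_loopNoise _ _).comp (by fun_prop)) (by fun_prop)
  have := hasLaw_add_gaussian (posSemidef_loopCov (S.loop K) S.posSemidef_W (s - 1)) hA
    (h.hasLaw_loopNoise (S.loop K) (k * s) (s - 1)) (h.law_action k) hind
    (fromRows 1 0 : Matrix (Fin n ⊕ Fin d) (Fin n) ℝ)
    (fromRows 0 1 : Matrix (Fin n ⊕ Fin d) (Fin d) ℝ)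
  rw [LQProblem.blockCov, fromBlocks_diagonal_eq]
  exact this

end IsDataCollection

end Laws

end Exploration

/-! ### Frobenius norms, semidefinite matrices and vectorization -/

section Frobenius

variable {m k l : Type*} [Fintype m] [Fintype k] [Fintype l]

/-- The entries of a matrix as a vector of Euclidean space; the Frobenius norm is its length. -/
def entries (X : Matrix m k ℝ) : EuclideanSpace ℝ (m × k) := WithLp.toLp 2 fun p => X p.1 p.2

lemma frobNorm_eq_norm (X : Matrix m k ℝ) : frobNorm X = ‖entries X‖ := by
  rw [EuclideanSpace.norm_eq, frobNorm, Fintype.sum_prod_type]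
  simp [entries]

omit [Fintype m] [Fintype k] in
lemma entries_add (X Y : Matrix m k ℝ) : entries (X + Y) = entries X + entries Y := rfl

omit [Fintype m] [Fintype k] in
lemma entries_sub (X Y : Matrix m k ℝ) : entries (X - Y) = entries X - entries Y := rfl

lemma frobNorm_nonneg (X : Matrix m k ℝ) : 0 ≤ frobNorm X := Real.sqrt_nonneg _

lemma frobNorm_add_le (X Y : Matrix m k ℝ) : frobNorm (X + Y) ≤ frobNorm X + frobNorm Y := by
  simp only [frobNorm_eq_norm, entries_add]; exact norm_add_le _ _

lemma frobNorm_sq (X : Matrix m k ℝ) : frobNorm X ^ 2 = ∑ i, ∑ j, X i j ^ 2 :=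
  Real.sq_sqrt (Finset.sum_nonneg fun _ _ => Finset.sum_nonneg fun _ _ => sq_nonneg _)

lemma frobNorm_transpose (X : Matrix m k ℝ) : frobNorm Xᵀ = frobNorm X := by
  rw [frobNorm, frobNorm, Finset.sum_comm]; rfl

lemma frobNorm_sq_eq_trace (X : Matrix m k ℝ) : frobNorm X ^ 2 = (X * Xᵀ).trace := by
  rw [frobNorm_sq]
  simp [Matrix.trace, Matrix.mul_apply, sq]

lemma trace_mul_eq_sum (X : Matrix m k ℝ) (Y : Matrix k m ℝ) :
    (X * Y).trace = ∑ i, ∑ j, X i j * Y j i := by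
  simp [Matrix.trace, Matrix.mul_apply]

lemma trace_mul_le_frobNorm (X : Matrix m k ℝ) (Y : Matrix k m ℝ) :
    (X * Y).trace ≤ frobNorm X * frobNorm Y := by
  have h := real_inner_le_norm (entries X) (entries Yᵀ)
  rw [← frobNorm_eq_norm, ← frobNorm_eq_norm, frobNorm_transpose] at h
  refine le_trans (le_of_eq ?_) h
  rw [trace_mul_eq_sum, inner_eq_dotProduct, dotProduct, Fintype.sum_prod_type]
  rfl

lemma frobNorm_mul_le (X : Matrix m k ℝ) (Y : Matrix k l ℝ) :
    frobNorm (X * Y) ≤ frobNorm X * frobNorm Y := by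
  refine abs_le_of_sq_le_sq' ?_ (mul_nonneg (frobNorm_nonneg _) (frobNorm_nonneg _)) |>.2
  rw [mul_pow, frobNorm_sq, frobNorm_sq, ← frobNorm_transpose Y, frobNorm_sq, Finset.sum_mul]
  refine Finset.sum_le_sum fun i _ => ?_
  rw [Finset.mul_sum]
  refine Finset.sum_le_sum fun j _ => ?_
  rw [Matrix.mul_apply]
  exact Finset.sum_mul_sq_le_sq_mul_sq Finset.univ (X i) fun c => Y c j

lemma frobNorm_mul_le_specNorm [DecidableEq m] (D : Matrix m m ℝ) (X : Matrix m k ℝ) :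
    frobNorm (D * X) ≤ specNorm D * frobNorm X := by
  refine abs_le_of_sq_le_sq' ?_ (mul_nonneg (norm_nonneg _) (frobNorm_nonneg _)) |>.2
  rw [mul_pow, ← frobNorm_transpose (D * X), ← frobNorm_transpose X, frobNorm_sq, frobNorm_sq,
    Finset.mul_sum]
  refine Finset.sum_le_sum fun j _ => ?_
  have h := ContinuousLinearMap.le_opNorm (Matrix.toEuclideanCLM (n := m) (𝕜 := ℝ) D)
    (WithLp.toLp 2 fun i => X i j)
  have h2 := pow_le_pow_left₀ (norm_nonneg _) h 2
  rw [mul_pow, EuclideanSpace.norm_sq_eq, EuclideanSpace.norm_sq_eq] at h2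
  refine le_trans (le_of_eq ?_) (h2.trans (le_of_eq ?_))
  · refine Finset.sum_congr rfl fun i _ => ?_
    rw [Real.norm_eq_abs, sq_abs]
    rfl
  · congr 1
    refine Finset.sum_congr rfl fun i _ => ?_
    rw [Real.norm_eq_abs, sq_abs]
    rfl

lemma frobNorm_transpose_mul_mul_le [DecidableEq m] (D : Matrix m m ℝ) (X : Matrix m k ℝ) :
    frobNorm (Xᵀ * D * X) ≤ specNorm D * frobNorm X ^ 2 := by
  rw [Matrix.mul_assoc]
  refine (frobNorm_mul_le _ _).trans ?_
  rw [frobNorm_transpose]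
  have := mul_le_mul_of_nonneg_left (frobNorm_mul_le_specNorm D X) (frobNorm_nonneg X)
  linarith

end Frobenius

section PosSemidef

variable {ι : Type*} [Fintype ι] [DecidableEq ι]

open scoped MatrixOrder in
lemma exists_eq_transpose_mul_self {A : Matrix ι ι ℝ} (hA : A.PosSemidef) :
    ∃ C : Matrix ι ι ℝ, A = Cᵀ * C := by
  obtain ⟨C, hC⟩ := CStarAlgebra.nonneg_iff_eq_star_mul_self.1 hA.nonneg
  exact ⟨C, by rw [hC, star_eq_conjTranspose, conjTranspose_eq_transpose_of_trivial]⟩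

lemma trace_mul_nonneg {A B : Matrix ι ι ℝ} (hA : A.PosSemidef) (hB : B.PosSemidef) :
    0 ≤ (A * B).trace := by
  obtain ⟨C, rfl⟩ := exists_eq_transpose_mul_self hA
  rw [Matrix.mul_assoc, Matrix.trace_mul_comm]
  have : (C * B * Cᵀ).PosSemidef := by simpa using hB.mul_mul_conjTranspose_same C
  exact this.trace_nonneg

lemma trace_mul_le_trace_mul {A B C : Matrix ι ι ℝ} (hA : A.PosSemidef)
    (hBC : (C - B).PosSemidef) : (A * B).trace ≤ (A * C).trace := by
  have := trace_mul_nonneg hA hBC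
  rw [Matrix.mul_sub, trace_sub] at this
  linarith

lemma smul_trace_le_trace_mul {A B : Matrix ι ι ℝ} (hA : A.PosSemidef) {κ : ℝ}
    (hB : (B - κ • (1 : Matrix ι ι ℝ)).PosSemidef) : κ * A.trace ≤ (A * B).trace := by
  have := trace_mul_le_trace_mul hA hB
  simpa using this

omit [Fintype ι] in
lemma posSemidef_of_sub_smul_one {B : Matrix ι ι ℝ} {κ : ℝ} (hκ : 0 ≤ κ)
    (hB : (B - κ • (1 : Matrix ι ι ℝ)).PosSemidef) : B.PosSemidef := by
  have := hB.add (Matrix.PosSemidef.one.smul hκ)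
  simpa using this

/-- If `Q ⪰ κ I`, the Hilbert-Schmidt pairing with `Q` on both sides dominates `κ²` times the
Frobenius norm. -/
lemma sq_mul_frobNorm_sq_le_trace {Q Y : Matrix ι ι ℝ} {κ : ℝ} (hκ : 0 ≤ κ)
    (hQ : (Q - κ • (1 : Matrix ι ι ℝ)).PosSemidef) (hY : Y.IsSymm) :
    κ ^ 2 * frobNorm Y ^ 2 ≤ (Q * Y * Q * Y).trace := by
  have hQ0 := posSemidef_of_sub_smul_one hκ hQ
  have h1 : (Y * Q * Y).PosSemidef := by
    have := hQ0.mul_mul_conjTranspose_same Y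
    rwa [conjTranspose_eq_transpose_of_trivial, hY.eq] at this
  have h2 : (Y * Y).PosSemidef := by
    have := posSemidef_conjTranspose_mul_self Y
    rwa [conjTranspose_eq_transpose_of_trivial, hY.eq] at this
  have h3 := smul_trace_le_trace_mul h1 hQ
  have h4 := smul_trace_le_trace_mul h2 hQ
  have e1 : (Q * Y * Q * Y).trace = (Y * Q * Y * Q).trace := by
    rw [Matrix.mul_assoc, Matrix.mul_assoc, Matrix.trace_mul_comm, ← Matrix.mul_assoc]
  have e2 : (Y * Q * Y).trace = (Y * Y * Q).trace := by
    rw [Matrix.trace_mul_comm, ← Matrix.mul_assoc]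
  have e3 : frobNorm Y ^ 2 = (Y * Y).trace := by rw [frobNorm_sq_eq_trace, hY.eq]
  rw [e1, e3]
  rw [e2] at h3
  nlinarith

end PosSemidef

section Svec

variable {ι : Type*} [DecidableEq ι]

lemma svec_mk (X : Matrix ι ι ℝ) (i j : ι) :
    svec X s(i, j) = (if i = j then 1 else √2) * ((X i j + X j i) / 2) := rfl

lemma svec_mk_of_isSymm {X : Matrix ι ι ℝ} (hX : X.IsSymm) (i j : ι) :
    svec X s(i, j) = (if i = j then 1 else √2) * X i j := by
  rw [svec_mk, hX.apply i j]; ring_nf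

lemma isSymm_smat (v : Sym2 ι → ℝ) : (smat v).IsSymm := by
  ext i j
  simp only [smat, transpose_apply, of_apply]
  rw [Sym2.eq_swap]
  simp only [eq_comm]

lemma svec_smat (v : Sym2 ι → ℝ) : svec (smat v) = v := by
  ext e
  induction e using Sym2.ind with
  | _ i j =>
    rw [svec_mk_of_isSymm (isSymm_smat v)]
    simp only [smat, of_apply]
    split_ifs <;> simp

lemma smat_svec {X : Matrix ι ι ℝ} (hX : X.IsSymm) : smat (svec X) = X := by
  ext i j
  simp only [smat, of_apply]
  rw [svec_mk_of_isSymm hX]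
  split_ifs <;> simp

lemma smat_add (v v' : Sym2 ι → ℝ) : smat (v + v') = smat v + smat v' := by
  ext i j
  simp [smat, mul_add]

lemma sum_sum_mk_eq_sum_sym2 [Fintype ι] (g : Sym2 ι → ℝ) :
    ∑ i, ∑ j, g s(i, j) = ∑ e : Sym2 ι, (if e.IsDiag then 1 else 2) * g e := by
  rw [← Fintype.sum_prod_type' (f := fun i j => g s(i, j)),
    ← Finset.sum_fiberwise (s := Finset.univ) (g := fun p : ι × ι => s(p.1, p.2))]
  refine Finset.sum_congr rfl fun e _ => ?_
  induction e using Sym2.ind with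
  | _ a b =>
    have h1 : ∑ p ∈ Finset.univ.filter (fun p : ι × ι => s(p.1, p.2) = s(a, b)), g s(p.1, p.2)
        = ∑ p ∈ Finset.univ.filter (fun p : ι × ι => s(p.1, p.2) = s(a, b)), g s(a, b) :=
      Finset.sum_congr rfl fun p hp => by rw [(Finset.mem_filter.1 hp).2]
    rw [h1, Finset.sum_const, nsmul_eq_mul]
    congr 1
    have h2 : Finset.univ.filter (fun p : ι × ι => s(p.1, p.2) = s(a, b))
        = {(a, b), (b, a)} := by
      ext ⟨c, d⟩; simp [Prod.ext_iff]
    rw [h2]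
    simp only [Sym2.mk_isDiag_iff]
    split_ifs with hab
    · simp [hab]
    · rw [Finset.card_pair (by simp; tauto)]; simp

lemma svec_dotProduct_svec [Fintype ι] {X Y : Matrix ι ι ℝ} (hX : X.IsSymm) (hY : Y.IsSymm) :
    svec X ⬝ᵥ svec Y = (X * Y).trace := by
  have h : ∀ i j, X i j * Y j i =
      (fun e : Sym2 ι => (if e.IsDiag then 1 else 2)⁻¹ * (svec X e * svec Y e)) s(i, j) := by
    intro i j
    simp only [svec_mk_of_isSymm hX, svec_mk_of_isSymm hY, Sym2.mk_isDiag_iff]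
    rw [hY.apply i j]
    split_ifs
    · simp
    · have : √2 * √2 = 2 := Real.mul_self_sqrt (by norm_num)
      linear_combination (-(X i j * Y i j) / 2) * this
  rw [trace_mul_eq_sum]
  simp_rw [h]
  refine Eq.trans ?_ (sum_sum_mk_eq_sum_sym2 fun e : Sym2 ι =>
    (if e.IsDiag then 1 else 2)⁻¹ * (svec X e * svec Y e)).symm
  refine Finset.sum_congr rfl fun e _ => ?_
  split_ifs <;> simp

omit [DecidableEq ι] in
lemma isSymm_vecMulVec_self (z : ι → ℝ) : (vecMulVec z z).IsSymm := by
  ext i j; simp [vecMulVec_apply, mul_comm]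

lemma svec_vecMulVec_dotProduct [Fintype ι] (z : ι → ℝ) {Y : Matrix ι ι ℝ} (hY : Y.IsSymm) :
    svec (vecMulVec z z) ⬝ᵥ svec Y = z ⬝ᵥ (Y *ᵥ z) := by
  rw [svec_dotProduct_svec (isSymm_vecMulVec_self z) hY, vecMulVec_mul, trace_vecMulVec,
    dotProduct_mulVec, dotProduct_comm]

variable [Fintype ι]

lemma frobNorm_smat (v : Sym2 ι → ℝ) :
    frobNorm (smat v) = ‖(WithLp.toLp 2 v : EuclideanSpace ℝ (Sym2 ι))‖ := by
  have h : frobNorm (smat v) ^ 2 = ‖(WithLp.toLp 2 v : EuclideanSpace ℝ (Sym2 ι))‖ ^ 2 := by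
    rw [frobNorm_sq_eq_trace, (isSymm_smat v).eq, ← svec_dotProduct_svec (isSymm_smat v)
      (isSymm_smat v), svec_smat, ← real_inner_self_eq_norm_sq, inner_eq_dotProduct]
  exact (sq_eq_sq₀ (frobNorm_nonneg _) (norm_nonneg _)).1 h

/-- The vectorization of `z zᵀ`, as a vector of Euclidean space. -/
def outerVec (z : EuclideanSpace ℝ ι) : EuclideanSpace ℝ (Sym2 ι) :=
  WithLp.toLp 2 (svec (vecMulVec z.ofLp z.ofLp))

lemma inner_outerVec (z : EuclideanSpace ℝ ι) (y : EuclideanSpace ℝ (Sym2 ι)) :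
    inner ℝ (outerVec z) y = z.ofLp ⬝ᵥ (smat y.ofLp *ᵥ z.ofLp) := by
  rw [inner_eq_dotProduct, ← svec_vecMulVec_dotProduct _ (isSymm_smat _), svec_smat]; rfl

lemma norm_outerVec (z : EuclideanSpace ℝ ι) : ‖outerVec z‖ = ‖z‖ ^ 2 := by
  have h : ‖outerVec z‖ ^ 2 = (‖z‖ ^ 2) ^ 2 := by
    rw [← real_inner_self_eq_norm_sq, inner_outerVec]
    simp only [outerVec]
    rw [smat_svec (isSymm_vecMulVec_self _), vecMulVec_mulVec]
    rw [← real_inner_self_eq_norm_sq, inner_eq_dotProduct]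
    simp [sq]
  exact (sq_eq_sq₀ (norm_nonneg _) (sq_nonneg _)).1 h

omit [Fintype ι] in
lemma continuous_outerVec : Continuous (outerVec : EuclideanSpace ℝ ι → _) := by
  refine (PiLp.continuous_toLp 2 _).comp (continuous_pi fun e => ?_)
  induction e using Sym2.ind with
  | _ i j =>
    simp only [svec_mk, vecMulVec_apply]
    fun_prop

end Svec

/-! ### Least squares, projections and Lyapunov equations -/

section LeastSquares

variable {m k : Type*} [Fintype m] [Fintype k] [DecidableEq k]

/-- A design matrix with a quantitative lower bound: the Gram matrix is invertible, and its inverse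
has the reciprocal bound. -/
lemma gram_inv_bound {Ψ : Matrix m k ℝ} {c : ℝ} (hc : 0 < c)
    (h : ∀ y : k → ℝ, c * (y ⬝ᵥ y) ≤ (Ψ *ᵥ y) ⬝ᵥ (Ψ *ᵥ y)) :
    IsUnit (Ψᵀ * Ψ).det ∧ ∀ b : k → ℝ,
      ‖(WithLp.toLp 2 ((Ψᵀ * Ψ)⁻¹ *ᵥ b) : EuclideanSpace ℝ k)‖ ≤
        ‖(WithLp.toLp 2 b : EuclideanSpace ℝ k)‖ / c := by
  have hq : ∀ y : k → ℝ, y ⬝ᵥ ((Ψᵀ * Ψ) *ᵥ y) = (Ψ *ᵥ y) ⬝ᵥ (Ψ *ᵥ y) := fun y => by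
    rw [← mulVec_mulVec, dotProduct_mulVec, vecMul_transpose]
  have hn : ∀ y : k → ℝ, y ⬝ᵥ y = ‖(WithLp.toLp 2 y : EuclideanSpace ℝ k)‖ ^ 2 := fun y => by
    rw [← real_inner_self_eq_norm_sq, inner_eq_dotProduct]
  have hu : IsUnit (Ψᵀ * Ψ).det := by
    rw [← Matrix.isUnit_iff_isUnit_det, ← Matrix.mulVec_injective_iff_isUnit]
    rw [← Matrix.coe_mulVecLin, ← LinearMap.ker_eq_bot, LinearMap.ker_eq_bot']
    intro y hy
    have hy' : (Ψᵀ * Ψ) *ᵥ y = 0 := hy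
    have h1 := h y
    rw [← hq, hy', dotProduct_zero] at h1
    have h2 : y ⬝ᵥ y ≤ 0 := by
      by_contra! h3
      nlinarith
    have h3 : y ⬝ᵥ y = 0 := le_antisymm h2 (by rw [hn]; positivity)
    exact dotProduct_self_eq_zero.1 h3
  refine ⟨hu, fun b => ?_⟩
  set y := (Ψᵀ * Ψ)⁻¹ *ᵥ b with hy
  have hb : (Ψᵀ * Ψ) *ᵥ y = b := by
    rw [hy, mulVec_mulVec, Matrix.mul_nonsing_inv _ hu, one_mulVec]
  have h1 := h y
  rw [← hq, hb, hn] at h1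
  have h2 := real_inner_le_norm (WithLp.toLp 2 y : EuclideanSpace ℝ k) (WithLp.toLp 2 b)
  rw [inner_eq_dotProduct] at h2
  rw [le_div_iff₀ hc]
  rcases (norm_nonneg (WithLp.toLp 2 y : EuclideanSpace ℝ k)).eq_or_lt with h0 | h0
  · rw [← h0]; simp
  · by_contra! h3
    have := mul_lt_mul_of_pos_left h3 h0
    simp only at h2
    nlinarith

end LeastSquares

section Projection

variable {E : Type*} [NormedAddCommGroup E] [InnerProductSpace ℝ E]

/-- If `p` is the closest point to `x` on the segment from `p` to `y`, then `p` is at least as close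
to `y` as `x` is. -/
lemma norm_sub_le_of_forall_segment {p x y : E}
    (h : ∀ t : ℝ, 0 ≤ t → t ≤ 1 → ‖p - x‖ ≤ ‖p + t • (y - p) - x‖) : ‖y - p‖ ≤ ‖y - x‖ := by
  have hin : 0 ≤ inner ℝ (p - x) (y - p) := by
    by_contra! hneg
    set i := inner ℝ (p - x) (y - p) with hi
    set b := ‖y - p‖ ^ 2 with hb
    have hb0 : 0 ≤ b := by positivity
    -- the derivative along the segment is negative, so a short step decreases the distance
    set t : ℝ := -i / (-i + b + 1) with ht
    have hden : 0 < -i + b + 1 := by linarith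
    have ht0 : 0 < t := div_pos (by linarith) hden
    have ht1 : t ≤ 1 := (div_le_one hden).2 (by linarith)
    have h1 := h t ht0.le ht1
    have h2 := pow_le_pow_left₀ (norm_nonneg _) h1 2
    have e : p + t • (y - p) - x = (p - x) + t • (y - p) := by abel
    rw [e, norm_add_sq_real, inner_smul_right, norm_smul, mul_pow, Real.norm_eq_abs, sq_abs,
      ← hi, ← hb] at h2
    have h3 : 0 ≤ t * (2 * i + t * b) := by nlinarith
    have h4 : 0 ≤ 2 * i + t * b := nonneg_of_mul_nonneg_right h3 ht0
    have h5 : t * b ≤ -i := by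
      rw [ht, div_mul_eq_mul_div, div_le_iff₀ hden]
      nlinarith
    linarith
  have e : ‖y - x‖ ^ 2 = ‖p - x‖ ^ 2 + 2 * inner ℝ (p - x) (y - p) + ‖y - p‖ ^ 2 := by
    rw [← norm_add_sq_real]; congr 2; abel
  refine abs_le_of_sq_le_sq' ?_ (norm_nonneg _) |>.2
  nlinarith [sq_nonneg ‖p - x‖]

/-- Projecting onto a convex set does not increase the distance to a point of that set. -/
lemma IsFrobProj.frobNorm_sub_le {ι : Type*} [Fintype ι] {D X P Y : Matrix ι ι ℝ}
    (h : IsFrobProj D X P) (hY : (Y - D).PosSemidef) : frobNorm (Y - P) ≤ frobNorm (Y - X) := by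
  simp only [frobNorm_eq_norm, entries_sub]
  refine norm_sub_le_of_forall_segment fun t ht0 ht1 => ?_
  have h1 : (P + t • (Y - P) - D).PosSemidef := by
    have := (h.1.smul (by linarith : 0 ≤ 1 - t)).add (hY.smul ht0)
    convert this using 1
    module
  have h2 := h.2 _ h1
  simp only [frobNorm_eq_norm] at h2
  exact h2

end Projection

section Stability

open Filter Topology

variable {n d : ℕ}

open scoped Matrix.Norms.Frobenius in
/-- The powers of a matrix of spectral radius less than one tend to zero (Gelfand's formula). -/
lemma LQProblem.IsStable.tendsto_pow {S : LQProblem n d} {K : Matrix (Fin d) (Fin n) ℝ}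
    (h : S.IsStable K) : Tendsto (fun j => frobNorm (S.loop K ^ j)) atTop (𝓝 0) := by
  set L := S.loop K with hL
  set Lc := L.map (algebraMap ℝ ℂ) with hLc
  have hr : spectralRadius ℂ Lc < 1 := h
  obtain ⟨r, hr1, hr2⟩ := exists_between hr
  have hg := spectrum.pow_nnnorm_pow_one_div_tendsto_nhds_spectralRadius Lc
  have hev : ∀ᶠ j : ℕ in atTop, (‖Lc ^ j‖₊ : ENNReal) ≤ r ^ j := by
    filter_upwards [hg.eventually (gt_mem_nhds hr1), eventually_gt_atTop 0] with j hj hj0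
    have := ENNReal.rpow_le_rpow hj.le (by positivity : (0 : ℝ) ≤ j)
    rwa [← ENNReal.rpow_mul, one_div, inv_mul_cancel₀ (by positivity), ENNReal.rpow_one,
      ENNReal.rpow_natCast] at this
  have hnorm : ∀ j, frobNorm (L ^ j) = ‖Lc ^ j‖ := fun j => by
    have e : Lc ^ j = (L ^ j).map (algebraMap ℝ ℂ) := by
      rw [hLc]
      exact (map_pow ((algebraMap ℝ ℂ).mapMatrix) L j).symm
    rw [e, Matrix.frobenius_norm_def, frobNorm, Real.sqrt_eq_rpow]
    simp
  have ht : Tendsto (fun j : ℕ => (‖Lc ^ j‖₊ : ENNReal)) atTop (𝓝 0) :=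
    tendsto_of_tendsto_of_tendsto_of_le_of_le' tendsto_const_nhds
      (ENNReal.tendsto_pow_atTop_nhds_zero_of_lt_one hr2)
      (Eventually.of_forall fun _ => bot_le) hev
  have ht2 : Tendsto (fun j : ℕ => ‖Lc ^ j‖₊) atTop (𝓝 0) := by
    rw [← ENNReal.tendsto_coe]; exact ht
  simp_rw [hnorm]
  exact NNReal.tendsto_coe.2 ht2

variable {S : LQProblem n d} {K : Matrix (Fin d) (Fin n) ℝ}
  {G : Matrix (Fin n ⊕ Fin d) (Fin n ⊕ Fin d) ℝ}

lemma LQProblem.fromRows_transpose (S : LQProblem n d) :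
    Matrix.fromRows S.Aᵀ S.Bᵀ = S.dynᵀ := by
  rw [LQProblem.dyn, transpose_fromCols]

/-- The value matrix solves the Lyapunov equation with the running cost of the policy. -/
lemma LQProblem.IsStateActionMatrix.valueMatrix_eq (hG : S.IsStateActionMatrix K G) :
    LQProblem.valueMatrix K G = (S.loop K)ᵀ * LQProblem.valueMatrix K G * S.loop K
      + (S.M + Kᵀ * S.N * K) := by
  set H := LQProblem.valueMatrix K G with hH
  have e1 : S.dyn * fromRows (1 : Matrix (Fin n) (Fin n) ℝ) (-K) = S.loop K := by
    rw [LQProblem.dyn, fromCols_mul_fromRows]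
    simp [sub_eq_add_neg]
  have e2 : fromCols (1 : Matrix (Fin n) (Fin n) ℝ) (-Kᵀ) * S.dynᵀ = (S.loop K)ᵀ := by
    rw [← e1, transpose_mul, transpose_fromRows]; simp
  have e3 : fromCols (1 : Matrix (Fin n) (Fin n) ℝ) (-Kᵀ) * S.costMatrix *
      fromRows (1 : Matrix (Fin n) (Fin n) ℝ) (-K) = S.M + Kᵀ * S.N * K := by
    rw [LQProblem.costMatrix, fromCols_mul_fromBlocks, fromCols_mul_fromRows]
    simp
  have hG' : G = S.dynᵀ * H * S.dyn + S.costMatrix := by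
    rw [← S.fromRows_transpose]; exact hG
  calc H = fromCols (1 : Matrix (Fin n) (Fin n) ℝ) (-Kᵀ) * G *
        fromRows (1 : Matrix (Fin n) (Fin n) ℝ) (-K) := rfl
    _ = (fromCols (1 : Matrix (Fin n) (Fin n) ℝ) (-Kᵀ) * S.dynᵀ) * H *
        (S.dyn * fromRows (1 : Matrix (Fin n) (Fin n) ℝ) (-K)) + (S.M + Kᵀ * S.N * K) := by
      conv_lhs => rw [hG', Matrix.mul_add, Matrix.add_mul, e3]
      simp only [Matrix.mul_assoc]
    _ = _ := by rw [e1, e2]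

/-- Uniqueness for the Lyapunov equation of a stable matrix. -/
lemma eq_zero_of_eq_transpose_mul_mul {L D : Matrix (Fin n) (Fin n) ℝ}
    (hL : Tendsto (fun j => frobNorm (L ^ j)) atTop (𝓝 0)) (h : D = Lᵀ * D * L) : D = 0 := by
  have hj : ∀ j, D = (L ^ j)ᵀ * D * L ^ j := fun j => by
    induction j with
    | zero => simp
    | succ j ih =>
      have e : (L ^ (j + 1))ᵀ * D * L ^ (j + 1) = (L ^ j)ᵀ * (Lᵀ * D * L) * L ^ j := by
        rw [pow_succ', transpose_mul]
        simp only [Matrix.mul_assoc]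
      rw [e, ← h]; exact ih
  have hb : ∀ j, frobNorm D ≤ frobNorm (L ^ j) * frobNorm D * frobNorm (L ^ j) := fun j => by
    conv_lhs => rw [hj j]
    refine (frobNorm_mul_le _ _).trans ?_
    refine mul_le_mul_of_nonneg_right ?_ (frobNorm_nonneg _)
    refine (frobNorm_mul_le _ _).trans ?_
    rw [frobNorm_transpose]
  have h0 : frobNorm D ≤ 0 := by
    have ht : Tendsto (fun j => frobNorm (L ^ j) * frobNorm D * frobNorm (L ^ j)) atTop (𝓝 0) := by
      simpa using (hL.mul_const (frobNorm D)).mul hL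
    exact ge_of_tendsto' ht hb
  have h1 : entries D = 0 := by
    rw [← norm_eq_zero, ← frobNorm_eq_norm]; exact le_antisymm h0 (frobNorm_nonneg _)
  ext i j
  exact congrFun (congrArg WithLp.ofLp h1) (i, j)

/-- The solution of a Lyapunov equation of a stable matrix with positive semidefinite right-hand
side is positive semidefinite: it is symmetric by uniqueness, and its quadratic form decreases to
zero along the orbits of the matrix. -/
lemma posSemidef_of_lyapunov {L H C : Matrix (Fin n) (Fin n) ℝ}
    (hL : Tendsto (fun j => frobNorm (L ^ j)) atTop (𝓝 0)) (hC : C.PosSemidef)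
    (h : H = Lᵀ * H * L + C) : H.PosSemidef := by
  have hCs : Cᵀ = C := hC.1
  have hsymm : H.IsHermitian := by
    have : H - Hᵀ = 0 := by
      refine eq_zero_of_eq_transpose_mul_mul hL ?_
      have ht : Hᵀ = Lᵀ * Hᵀ * L + C := by
        conv_lhs => rw [h]
        rw [transpose_add, transpose_mul, transpose_mul, transpose_transpose, hCs, Matrix.mul_assoc]
      have e1 : Lᵀ * H * L = H - C := eq_sub_of_add_eq h.symm
      have e2 : Lᵀ * Hᵀ * L = Hᵀ - C := eq_sub_of_add_eq ht.symm
      rw [Matrix.mul_sub, Matrix.sub_mul, e1, e2]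
      abel
    rw [IsHermitian, conjTranspose_eq_transpose_of_trivial]
    exact (sub_eq_zero.1 this).symm
  have hquad : ∀ x : Fin n → ℝ, (L *ᵥ x) ⬝ᵥ (H *ᵥ (L *ᵥ x)) ≤ x ⬝ᵥ (H *ᵥ x) := fun x => by
    conv_rhs => rw [h, add_mulVec, dotProduct_add, ← mulVec_mulVec, ← mulVec_mulVec,
      dotProduct_mulVec x, vecMul_transpose]
    have := hC.dotProduct_mulVec_nonneg x
    simp only [star_trivial] at this
    linarith
  refine PosSemidef.of_dotProduct_mulVec_nonneg hsymm fun x => ?_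
  have hj : ∀ j, (L ^ j *ᵥ x) ⬝ᵥ (H *ᵥ (L ^ j *ᵥ x)) ≤ x ⬝ᵥ (H *ᵥ x) := fun j => by
    induction j with
    | zero => simp
    | succ j ih =>
      rw [pow_succ', ← mulVec_mulVec]
      exact (hquad _).trans ih
  simp only [star_trivial]
  have hLx : Tendsto (fun j => matE (L ^ j) (WithLp.toLp 2 x)) atTop (𝓝 0) := by
    refine squeeze_zero_norm (fun j => norm_matE_le _ _) ?_
    simpa using hL.mul_const ‖(WithLp.toLp 2 x : EuclideanSpace ℝ (Fin n))‖
  have hcont : Continuous fun y : EuclideanSpace ℝ (Fin n) => y.ofLp ⬝ᵥ (H *ᵥ y.ofLp) := by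
    simp only [dotProduct, mulVec]; fun_prop
  have hlim := (hcont.tendsto 0).comp hLx
  simp only [WithLp.ofLp_zero, zero_dotProduct] at hlim
  exact le_of_tendsto' hlim hj

/-- `G` lies in the convex set onto which the estimate is projected. -/
lemma LQProblem.IsStateActionMatrix.posSemidef_sub (hS : S.IsStable K)
    (hG : S.IsStateActionMatrix K G) : (G - S.costMatrix).PosSemidef := by
  have hC : (S.M + Kᵀ * S.N * K).PosSemidef := by
    refine S.posDef_M.posSemidef.add ?_
    simpa using S.posDef_N.posSemidef.conjTranspose_mul_mul_same K
  have hH := posSemidef_of_lyapunov hS.tendsto_pow hC hG.valueMatrix_eq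
  have e : G - S.costMatrix = S.dynᵀ * LQProblem.valueMatrix K G * S.dyn := by
    rw [sub_eq_iff_eq_add, ← S.fromRows_transpose]; exact hG
  rw [e]
  simpa using hH.conjTranspose_mul_mul_same S.dyn

end Stability

/-! ### Moments of the exploration process -/

section MartingaleIndep

variable {Ω : Type*} [MeasurableSpace Ω] {μ : Measure Ω} [IsProbabilityMeasure μ]
  {H : Type*} [NormedAddCommGroup H] [InnerProductSpace ℝ H]
  {𝓤 𝓝 : Type*} [MeasurableSpace 𝓤] [MeasurableSpace 𝓝]

omit [IsProbabilityMeasure μ] in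
lemma integrable_pow_mul_inner {p : ℕ} {S D : Ω → H} {b d : ℝ} (hS : MomBd μ (2 * (p + 2)) S b)
    (hD : MomBd μ (2 * (p + 2)) D d) :
    Integrable (fun ω => ‖S ω‖ ^ (2 * (p + 1)) * inner ℝ (S ω) (D ω)) μ := by
  have hi := (hS.norm.add (by lia) hD.norm).integrable_pow (by lia)
  refine hi.mono' ((hS.aesm.norm.pow _).mul (hS.aesm.inner hD.aesm))
    (Filter.Eventually.of_forall fun ω => ?_)
  rw [norm_mul, norm_pow, norm_norm]
  have h1 := norm_inner_le_norm (𝕜 := ℝ) (S ω) (D ω)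
  rw [Real.norm_of_nonneg (by positivity : 0 ≤ ‖S ω‖ + ‖D ω‖)]
  set x := ‖S ω‖
  set y := ‖D ω‖
  have hx : 0 ≤ x := norm_nonneg _
  have hy : 0 ≤ y := norm_nonneg _
  calc x ^ (2 * (p + 1)) * ‖inner ℝ (S ω) (D ω)‖ ≤ x ^ (2 * (p + 1)) * (x * y) := by gcongr
    _ ≤ (x + y) ^ (2 * (p + 1)) * ((x + y) * (x + y)) := by gcongr <;> linarith
    _ = (x + y) ^ (2 * (p + 2)) := by ring

/-- Moments of a martingale whose increments are functions of the past and of an independent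
variable, with mean zero given the past. -/
lemma MomBd.martingale_indep [CompleteSpace H] {p : ℕ} (hp : 2 ≤ p) {S D : ℕ → Ω → H} {d : ℝ} (hd : 0 ≤ d)
    (hS0 : ∀ ω, S 0 ω = 0) (hS : ∀ k ω, S (k + 1) ω = S k ω + D k ω)
    (hD : ∀ k, MomBd μ (2 * p) (D k) d)
    {U : ℕ → Ω → 𝓤} {N : ℕ → Ω → 𝓝} (hU : ∀ k, Measurable (U k)) (hN : ∀ k, Measurable (N k))
    (hind : ∀ k, IndepFun (U k) (N k) μ)
    {σ : ℕ → 𝓤 → H} (hσ : ∀ k, StronglyMeasurable (σ k)) (hSσ : ∀ k ω, S k ω = σ k (U k ω))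
    {f : ℕ → 𝓤 × 𝓝 → H} (hf : ∀ k, StronglyMeasurable (f k))
    (hDf : ∀ k ω, D k ω = f k (U k ω, N k ω))
    (hint : ∀ k u, Integrable (fun ω => f k (u, N k ω)) μ)
    (hmean : ∀ k u, ∫ ω, f k (u, N k ω) ∂μ = 0) (k : ℕ) :
    MomBd μ (2 * p) (S k) (100 * p * d * √(k + 1)) := by
  obtain ⟨p, rfl⟩ : ∃ p', p = p' + 2 := ⟨p - 2, by lia⟩
  have h0 : ∀ k b, MomBd μ (2 * (p + 2)) (S k) b →
      ∫ ω, ‖S k ω‖ ^ (2 * (p + 1)) * inner ℝ (S k ω) (D k ω) ∂μ = 0 := by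
    intro k b hb
    have hi := integrable_pow_mul_inner hb (hD k)
    simp only [hSσ, hDf] at hi ⊢
    have hg : StronglyMeasurable fun z : 𝓤 × 𝓝 =>
        ‖σ k z.1‖ ^ (2 * (p + 1)) * inner ℝ (σ k z.1) (f k z) := by
      have h1 : StronglyMeasurable fun z : 𝓤 × 𝓝 => σ k z.1 :=
        (hσ k).comp_measurable measurable_fst
      exact (h1.norm.pow _).mul (h1.inner (hf k))
    rw [IndepFun.integral_eq (hU k) (hN k) (hind k) hg hi]
    simp only [integral_const_mul, integral_inner (hint k _), hmean, inner_zero_right, mul_zero,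
      integral_zero]
  -- the basic bound needs a positive size of the increments; `d = 0` is reached as a limit
  have key : ∀ d' > d, MomBd μ (2 * (p + 2)) (S k)
      (100 * ((p + 2 : ℕ) : ℝ) * d' * √(k + 1)) := fun d' hd' => by
    have h := MomBd.martingale (p := p) (hd.trans_lt hd') hS0 hS (fun k => (hD k).mono hd'.le)
      (fun k hk => h0 k _ hk) k
    have hd0 : 0 ≤ d' := hd.trans hd'.le
    rw [Real.sqrt_mul (by positivity), Real.sqrt_sq (by positivity)] at h
    refine h.mono (le_of_eq ?_)
    push_cast; ring
  refine ⟨(key (d + 1) (by linarith)).aesm, by positivity, ?_⟩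
  have ht : Filter.Tendsto (fun d' : ℝ => ENNReal.ofReal (100 * ((p + 2 : ℕ) : ℝ) * d' * √(k + 1)))
      (nhdsWithin d (Set.Ioi d)) (nhds (ENNReal.ofReal (100 * ((p + 2 : ℕ) : ℝ) * d * √(k + 1)))) :=
    ((ENNReal.continuous_ofReal.comp (by fun_prop)).tendsto d).mono_left nhdsWithin_le_nhds
  exact ge_of_tendsto ht (Filter.eventually_of_mem self_mem_nhdsWithin fun d' hd' => (key d' hd').le)

end MartingaleIndep

section BlockCovariance

variable {n d : ℕ}

lemma posSemidef_fromBlocks_diagonal {C : Matrix (Fin n) (Fin n) ℝ} {D : Matrix (Fin d) (Fin d) ℝ}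
    (hC : C.PosSemidef) (hD : D.PosSemidef) : (fromBlocks C 0 0 D).PosSemidef := by
  rw [fromBlocks_diagonal_eq]
  refine Matrix.PosSemidef.add ?_ ?_
  · have := hC.mul_mul_conjTranspose_same (fromRows 1 0 : Matrix (Fin n ⊕ Fin d) (Fin n) ℝ)
    rwa [conjTranspose_eq_transpose_of_trivial] at this
  · have := hD.mul_mul_conjTranspose_same (fromRows 0 1 : Matrix (Fin n ⊕ Fin d) (Fin d) ℝ)
    rwa [conjTranspose_eq_transpose_of_trivial] at this

lemma trace_conj_le_trace_conj {ι m : Type*} [Fintype ι] [Fintype m] [DecidableEq ι]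
    {B C : Matrix ι ι ℝ} (h : (C - B).PosSemidef) (T : Matrix m ι ℝ) :
    (T * B * Tᵀ).trace ≤ (T * C * Tᵀ).trace := by
  have := (h.mul_mul_conjTranspose_same T).trace_nonneg
  rw [conjTranspose_eq_transpose_of_trivial, Matrix.mul_sub, Matrix.sub_mul, trace_sub] at this
  linarith

/-- `tr (T Q Tᵀ) ≤ ‖T‖_F² ‖Q‖_F`. -/
lemma trace_conj_le {ι m : Type*} [Fintype ι] [Fintype m] [DecidableEq ι]
    (Q : Matrix ι ι ℝ) (T : Matrix m ι ℝ) :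
    (T * Q * Tᵀ).trace ≤ frobNorm T ^ 2 * frobNorm Q := by
  refine (trace_mul_le_frobNorm _ _).trans ?_
  rw [frobNorm_transpose]
  have := mul_le_mul_of_nonneg_right (frobNorm_mul_le T Q) (frobNorm_nonneg T)
  linarith

variable {S : LQProblem n d} {K : Matrix (Fin d) (Fin n) ℝ} {Sig : Matrix (Fin n) (Fin n) ℝ}
  {SigA : Matrix (Fin d) (Fin d) ℝ}

lemma LQProblem.IsStationaryCov.posSemidef_sub_blockCov (hSig : S.IsStationaryCov K Sig)
    (hpos : Sig.PosSemidef) (s : ℕ) :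
    (fromBlocks Sig 0 0 SigA - S.blockCov K SigA s).PosSemidef := by
  have e := eq_pow_mul_add_loopCov hSig (s - 1)
  have h := hpos.mul_mul_conjTranspose_same (S.loop K ^ (s - 1))
  rw [conjTranspose_eq_transpose_of_trivial, ← sub_eq_iff_eq_add.2 e] at h
  have := posSemidef_fromBlocks_diagonal h (Matrix.PosSemidef.zero (n := Fin d) (R := ℝ))
  convert this using 1
  rw [LQProblem.blockCov, sub_eq_add_neg, fromBlocks_neg, fromBlocks_add]
  simp [sub_eq_add_neg]

lemma LQProblem.dyn_conj (S : LQProblem n d) (Sig : Matrix (Fin n) (Fin n) ℝ)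
    (SigA : Matrix (Fin d) (Fin d) ℝ) :
    S.dyn * fromBlocks Sig 0 0 SigA * S.dynᵀ = S.nextCov Sig SigA := by
  rw [LQProblem.dyn, fromCols_mul_fromBlocks, transpose_fromCols, fromCols_mul_fromRows,
    LQProblem.nextCov]
  simp

lemma posSemidef_diag_sub_smul_one {κ : ℝ}
    (hSig : (Sig - κ • (1 : Matrix (Fin n) (Fin n) ℝ)).PosSemidef)
    (hA : (SigA - κ • (1 : Matrix (Fin d) (Fin d) ℝ)).PosSemidef) :
    (fromBlocks Sig 0 0 SigA - κ • (1 : Matrix (Fin n ⊕ Fin d) (Fin n ⊕ Fin d) ℝ)).PosSemidef := by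
  have := posSemidef_fromBlocks_diagonal hSig hA
  convert this using 1
  rw [← fromBlocks_one, fromBlocks_smul, sub_eq_add_neg, fromBlocks_neg, fromBlocks_add]
  simp [sub_eq_add_neg]

/-- `κ ‖(A B)‖_F² ≤ tr Σ_G`. -/
lemma LQProblem.smul_frobNorm_dyn_sq_le {κ : ℝ} (S : LQProblem n d)
    (hSig : (Sig - κ • (1 : Matrix (Fin n) (Fin n) ℝ)).PosSemidef)
    (hA : (SigA - κ • (1 : Matrix (Fin d) (Fin d) ℝ)).PosSemidef) :
    κ * frobNorm S.dyn ^ 2 ≤ (S.nextCov Sig SigA).trace := by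
  have := trace_conj_le_trace_conj (posSemidef_diag_sub_smul_one hSig hA) S.dyn
  rw [S.dyn_conj] at this
  refine le_trans (le_of_eq ?_) this
  rw [frobNorm_sq_eq_trace]
  simp

/-- If all nonzero eigenvalues of `W` are at least `κ`, then `κ xᵀ W x ≤ ‖W x‖²`. -/
lemma smul_quadratic_le_norm_sq {ι : Type*} [Fintype ι] [DecidableEq ι] {W : Matrix ι ι ℝ}
    (hW : W.PosSemidef) {κ : ℝ} (h : (W * W - κ • W).PosSemidef) (x : ι → ℝ) :
    κ * (x ⬝ᵥ (W *ᵥ x)) ≤ (W *ᵥ x) ⬝ᵥ (W *ᵥ x) := by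
  have h1 := h.dotProduct_mulVec_nonneg x
  have hs : Wᵀ = W := hW.1
  simp only [star_trivial, sub_mulVec, dotProduct_sub, smul_mulVec, dotProduct_smul, smul_eq_mul]
    at h1
  have e : x ⬝ᵥ ((W * W) *ᵥ x) = (W *ᵥ x) ⬝ᵥ (W *ᵥ x) := by
    rw [← mulVec_mulVec, dotProduct_mulVec x, ← mulVec_transpose, hs]
  linarith

end BlockCovariance

section ProcessMoments

variable {n d : ℕ} {S : LQProblem n d} {K : Matrix (Fin d) (Fin n) ℝ}
  {Sig : Matrix (Fin n) (Fin n) ℝ} {SigA : Matrix (Fin d) (Fin d) ℝ}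

/-- The exploration period `s` is long enough for a state of size `α` at the beginning of a block
to be forgotten when the exploratory action of the block is taken. -/
structure LQProblem.IsBurnIn (S : LQProblem n d) (K : Matrix (Fin d) (Fin n) ℝ)
    (Sig : Matrix (Fin n) (Fin n) ℝ) (SigA : Matrix (Fin d) (Fin d) ℝ) (κ α : ℝ) (s : ℕ) :
    Prop where
  one_le : 1 ≤ s
  loop_le : frobNorm (S.loop K ^ (s - 1)) * α ≤ √(Sig.trace + SigA.trace)
  dyn_le : frobNorm S.dyn * (frobNorm (S.loop K ^ (s - 1)) * α) ≤ √κ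
  cov : (S.blockCov K SigA s - (κ / 2) • (1 : Matrix (Fin n ⊕ Fin d) (Fin n ⊕ Fin d) ℝ)).PosSemidef

/-- The hypotheses on the system and its stationary covariances. -/
structure LQProblem.IsNondegenerate (S : LQProblem n d) (K : Matrix (Fin d) (Fin n) ℝ)
    (Sig : Matrix (Fin n) (Fin n) ℝ) (SigA : Matrix (Fin d) (Fin d) ℝ) (κ : ℝ) : Prop where
  pos : 0 < κ
  stationary : S.IsStationaryCov K Sig
  cov_state : (Sig - κ • (1 : Matrix (Fin n) (Fin n) ℝ)).PosSemidef
  cov_action : (SigA - κ • (1 : Matrix (Fin d) (Fin d) ℝ)).PosSemidef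
  noise : (S.W * S.W - κ • S.W).PosSemidef
  le_nextCov : κ ≤ frobNorm (S.nextCov Sig SigA)

lemma frobNorm_carry (s : ℕ) : frobNorm (S.carry K s) = frobNorm (S.loop K ^ (s - 1)) := by
  simp [frobNorm, LQProblem.carry]

lemma momBd_of_sqrt_le {Ω E : Type*} [MeasurableSpace Ω] {μ : Measure Ω} [NormedAddCommGroup E]
    {q : ℕ} {X : Ω → E} {a b c : ℝ} (h : MomBd μ q X (√a)) (hc : 0 ≤ c)
    (hab : a ≤ c ^ 2 * b) : MomBd μ q X (c * √b) := by
  refine h.mono ?_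
  rw [← Real.sqrt_sq hc, ← Real.sqrt_mul (sq_nonneg c)]
  exact Real.sqrt_le_sqrt hab

variable {Ω : Type*} [MeasurableSpace Ω] {μ : Measure Ω} [IsProbabilityMeasure μ]
  {m₀ : EuclideanSpace ℝ (Fin n)} {Sig₀ : Matrix (Fin n) (Fin n) ℝ}
  {x₀ : Ω → EuclideanSpace ℝ (Fin n)} {Hhat : Ω → Matrix (Fin n) (Fin n) ℝ}
  {w : ℕ → Ω → EuclideanSpace ℝ (Fin n)} {a : ℕ → Ω → EuclideanSpace ℝ (Fin d)} {κ α : ℝ}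
  {s p : ℕ} {x : EuclideanSpace ℝ (Fin n)}

namespace LQProblem.IsNondegenerate

lemma posSemidef_state (hS : S.IsNondegenerate K Sig SigA κ) : Sig.PosSemidef :=
  posSemidef_of_sub_smul_one hS.pos.le hS.cov_state

lemma posSemidef_action (hS : S.IsNondegenerate K Sig SigA κ) : SigA.PosSemidef :=
  posSemidef_of_sub_smul_one hS.pos.le hS.cov_action

lemma trace_nonneg (hS : S.IsNondegenerate K Sig SigA κ) : 0 ≤ Sig.trace + SigA.trace :=
  add_nonneg hS.posSemidef_state.trace_nonneg hS.posSemidef_action.trace_nonneg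

lemma trace_pos (hS : S.IsNondegenerate K Sig SigA κ) : 0 < Sig.trace + SigA.trace := by
  have hn : 0 < n := by
    rcases Nat.eq_zero_or_pos n with rfl | h
    · have h1 := hS.le_nextCov
      have h2 : frobNorm (S.nextCov Sig SigA) = 0 := by simp [frobNorm]
      linarith [hS.pos]
    · exact h
  have h1 := hS.cov_state.trace_nonneg
  rw [trace_sub, trace_smul, trace_one, Fintype.card_fin, smul_eq_mul] at h1
  have h2 : 0 < κ * n := mul_pos hS.pos (by exact_mod_cast hn)
  linarith [hS.posSemidef_action.trace_nonneg]

lemma posSemidef_blockCov (hS : S.IsNondegenerate K Sig SigA κ) (s : ℕ) :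
    (S.blockCov K SigA s).PosSemidef :=
  posSemidef_fromBlocks_diagonal (posSemidef_loopCov _ S.posSemidef_W _) hS.posSemidef_action

lemma trace_blockCov_le (hS : S.IsNondegenerate K Sig SigA κ) (s : ℕ) :
    (S.blockCov K SigA s).trace ≤ Sig.trace + SigA.trace := by
  have := (hS.stationary.posSemidef_sub_blockCov (SigA := SigA) hS.posSemidef_state s).trace_nonneg
  have e : (fromBlocks Sig 0 0 SigA).trace = Sig.trace + SigA.trace := by
    simp [Matrix.trace, Fintype.sum_sum_type]
  rw [trace_sub, e] at this
  linarith

/-- The part of `z_k` generated in the block is a centred Gaussian vector of bounded covariance. -/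
lemma momBd_blockPart (hS : S.IsNondegenerate K Sig SigA κ)
    (h : IsDataCollection μ S.W SigA m₀ Sig₀ x₀ Hhat w a) (s k : ℕ) (hp : 1 ≤ p) :
    MomBd μ (8 * p) (fun ω => S.blockPart K s (dataOf w a ω) k)
      (7 * √(p * (Sig.trace + SigA.trace))) := by
  have h1 := momBd_matE (hS.posSemidef_blockCov s) (h.hasLaw_blockPart hS.posSemidef_action K s k)
    (1 : Matrix (Fin n ⊕ Fin d) (Fin n ⊕ Fin d) ℝ) (p := 4 * p) (by lia)
  simp only [matE_one, Matrix.one_mul, transpose_one, Matrix.mul_one] at h1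
  rw [show 2 * (4 * p) = 8 * p by ring] at h1
  have := hS.trace_nonneg
  refine momBd_of_sqrt_le h1 (by norm_num) ?_
  have h2 := mul_le_mul_of_nonneg_left (hS.trace_blockCov_le s) (by positivity : (0 : ℝ) ≤ p)
  push_cast
  nlinarith [mul_nonneg (Nat.cast_nonneg p : (0 : ℝ) ≤ p) this]

lemma momBd_regressor_of_state (hS : S.IsNondegenerate K Sig SigA κ)
    (h : IsDataCollection μ S.W SigA m₀ Sig₀ x₀ Hhat w a) (hs : S.IsBurnIn K Sig SigA κ α s)
    (hp : 1 ≤ p) {k : ℕ}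
    (hst : MomBd μ (8 * p) (fun ω => S.state K s x (dataOf w a ω) (k * s)) (α * √p)) :
    MomBd μ (8 * p) (fun ω => S.regressor K s x (dataOf w a ω) k)
      (8 * √(p * (Sig.trace + SigA.trace))) := by
  have h1 : MomBd μ (8 * p)
      (fun ω => matE (S.carry K s) (S.state K s x (dataOf w a ω) (k * s)))
      (frobNorm (S.carry K s) * (α * √p)) :=
    hst.of_le_mul ((matE _).continuous.comp_aestronglyMeasurable hst.aesm) (frobNorm_nonneg _)
      fun ω => norm_matE_le _ _
  have h2 := h1.add (by lia) (hS.momBd_blockPart h s k hp)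
  simp only [← regressor_eq hs.one_le] at h2
  refine h2.mono ?_
  rw [frobNorm_carry, Real.sqrt_mul (Nat.cast_nonneg p)]
  have := mul_le_mul_of_nonneg_right hs.loop_le (Real.sqrt_nonneg p)
  linarith

/-- The states at the beginning of the blocks have moments of size `α √p`, uniformly in time. -/
lemma momBd_state (hS : S.IsNondegenerate K Sig SigA κ)
    (h : IsDataCollection μ S.W SigA m₀ Sig₀ x₀ Hhat w a) (hs : S.IsBurnIn K Sig SigA κ α s)
    (hp : 1 ≤ p) (hx : ‖x‖ ≤ α * √p)
    (hα : frobNorm S.dyn * (8 * √(Sig.trace + SigA.trace)) + 7 * √S.W.trace ≤ α) (k : ℕ) :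
    MomBd μ (8 * p) (fun ω => S.state K s x (dataOf w a ω) (k * s)) (α * √p) := by
  induction k with
  | zero =>
    simp only [Nat.zero_mul, state_zero]
    exact (MomBd.const x).mono hx
  | succ k ih =>
    simp only [state_next hs.one_le]
    have hz := hS.momBd_regressor_of_state h hs hp ih
    have h1 : MomBd μ (8 * p)
        (fun ω => matE S.dyn (S.regressor K s x (dataOf w a ω) k))
        (frobNorm S.dyn * (8 * √(p * (Sig.trace + SigA.trace)))) :=
      hz.of_le_mul ((matE _).continuous.comp_aestronglyMeasurable hz.aesm) (frobNorm_nonneg _)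
        fun ω => norm_matE_le _ _
    have h2 := momBd_matE S.posSemidef_W (h.law_noise (k * s + (s - 1)))
      (1 : Matrix (Fin n) (Fin n) ℝ) (p := 4 * p) (by lia)
    simp only [matE_one, Matrix.one_mul, transpose_one, Matrix.mul_one] at h2
    rw [show 2 * (4 * p) = 8 * p by ring] at h2
    have hW := S.posSemidef_W.trace_nonneg
    have h3 := momBd_of_sqrt_le (b := p * S.W.trace) (c := 7) h2 (by norm_num) (by
      push_cast
      nlinarith [mul_nonneg (Nat.cast_nonneg p : (0 : ℝ) ≤ p) hW])
    refine (h1.add (by lia) h3).mono ?_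
    rw [Real.sqrt_mul (Nat.cast_nonneg p), Real.sqrt_mul (Nat.cast_nonneg p)]
    have := mul_le_mul_of_nonneg_right hα (Real.sqrt_nonneg p)
    linarith

lemma momBd_regressor (hS : S.IsNondegenerate K Sig SigA κ)
    (h : IsDataCollection μ S.W SigA m₀ Sig₀ x₀ Hhat w a) (hs : S.IsBurnIn K Sig SigA κ α s)
    (hp : 1 ≤ p) (hx : ‖x‖ ≤ α * √p)
    (hα : frobNorm S.dyn * (8 * √(Sig.trace + SigA.trace)) + 7 * √S.W.trace ≤ α) (k : ℕ) :
    MomBd μ (8 * p) (fun ω => S.regressor K s x (dataOf w a ω) k)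
      (8 * √(p * (Sig.trace + SigA.trace))) :=
  hS.momBd_regressor_of_state h hs hp (hS.momBd_state h hs hp hx hα k)

/-- The images `T (A B) z_k` are controlled by `‖T‖_F² ‖Σ_G‖_F`, rather than by the larger
`‖T (A B)‖_F² (tr Σ + tr Σₐ)`. -/
lemma momBd_dyn_regressor (hS : S.IsNondegenerate K Sig SigA κ)
    (h : IsDataCollection μ S.W SigA m₀ Sig₀ x₀ Hhat w a) (hs : S.IsBurnIn K Sig SigA κ α s)
    (hp : 1 ≤ p) (hx : ‖x‖ ≤ α * √p)
    (hα : frobNorm S.dyn * (8 * √(Sig.trace + SigA.trace)) + 7 * √S.W.trace ≤ α)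
    (T : Matrix (Fin n) (Fin n) ℝ) (k : ℕ) :
    MomBd μ (4 * p) (fun ω => matE T (matE S.dyn (S.regressor K s x (dataOf w a ω) k)))
      (6 * frobNorm T * √(p * frobNorm (S.nextCov Sig SigA))) := by
  have hst := (hS.momBd_state h hs hp hx hα k).mono_exp (q := 4 * p) (by lia)
  have h1 : MomBd μ (4 * p)
      (fun ω => matE (T * S.dyn) (matE (S.carry K s) (S.state K s x (dataOf w a ω) (k * s))))
      (frobNorm T * frobNorm S.dyn * frobNorm (S.carry K s) * (α * √p)) := by
    refine hst.of_le_mul ((matE _).continuous.comp_aestronglyMeasurable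
      ((matE _).continuous.comp_aestronglyMeasurable hst.aesm))
      (mul_nonneg (mul_nonneg (frobNorm_nonneg _) (frobNorm_nonneg _)) (frobNorm_nonneg _))
      fun ω => ?_
    refine (norm_matE_le _ _).trans ?_
    rw [mul_assoc _ (frobNorm (S.carry K s))]
    exact mul_le_mul (frobNorm_mul_le _ _) (norm_matE_le _ _) (norm_nonneg _)
      (mul_nonneg (frobNorm_nonneg _) (frobNorm_nonneg _))
  have h2 := momBd_matE (hS.posSemidef_blockCov s) (h.hasLaw_blockPart hS.posSemidef_action K s k)
    (T * S.dyn) (p := 2 * p) (by lia)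
  rw [show 2 * (2 * p) = 4 * p by ring] at h2
  have htr : ((T * S.dyn) * S.blockCov K SigA s * (T * S.dyn)ᵀ).trace ≤
      frobNorm T ^ 2 * frobNorm (S.nextCov Sig SigA) := by
    refine (trace_conj_le_trace_conj
      (hS.stationary.posSemidef_sub_blockCov (SigA := SigA) hS.posSemidef_state s) _).trans ?_
    refine le_trans (le_of_eq ?_) (trace_conj_le (S.nextCov Sig SigA) T)
    rw [← S.dyn_conj, transpose_mul]
    simp only [Matrix.mul_assoc]
  have hF := frobNorm_nonneg (S.nextCov Sig SigA)
  have hT := frobNorm_nonneg T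
  have h3 := momBd_of_sqrt_le (b := p * frobNorm (S.nextCov Sig SigA)) (c := 5 * frobNorm T) h2
    (by positivity) (by
      have := mul_le_mul_of_nonneg_left htr (by positivity : (0 : ℝ) ≤ p)
      push_cast
      nlinarith [mul_nonneg (Nat.cast_nonneg p : (0 : ℝ) ≤ p) (mul_nonneg (sq_nonneg (frobNorm T)) hF)])
  have h4 := h1.add (by lia) h3
  simp only [← map_add, ← regressor_eq hs.one_le, matE_mul] at h4
  refine h4.mono ?_
  rw [frobNorm_carry, Real.sqrt_mul (Nat.cast_nonneg p)]
  have h5 : frobNorm S.dyn * (frobNorm (S.loop K ^ (s - 1)) * α) ≤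
      √(frobNorm (S.nextCov Sig SigA)) := hs.dyn_le.trans (Real.sqrt_le_sqrt hS.le_nextCov)
  have h6 := mul_le_mul_of_nonneg_left h5 (mul_nonneg hT (Real.sqrt_nonneg p))
  linarith

end LQProblem.IsNondegenerate

end ProcessMoments

/-! ### Fluctuations of the regression noise and of the Gram matrix -/

section TensorSquare

variable {ι : Type*} [Fintype ι]

/-- The tensor square `v ⊗ v` of a Euclidean vector. -/
def tensorSq (v : EuclideanSpace ℝ ι) : EuclideanSpace ℝ (ι × ι) :=
  WithLp.toLp 2 fun e => v e.1 * v e.2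

lemma inner_tensorSq (v y : EuclideanSpace ℝ ι) :
    inner ℝ (tensorSq v) (tensorSq y) = inner ℝ v y ^ 2 := by
  simp only [inner_eq_dotProduct, dotProduct, tensorSq, sq, Fintype.sum_prod_type,
    Finset.sum_mul_sum]
  refine Finset.sum_congr rfl fun i _ => Finset.sum_congr rfl fun j _ => ?_
  ring

lemma norm_tensorSq (v : EuclideanSpace ℝ ι) : ‖tensorSq v‖ = ‖v‖ ^ 2 := by
  have h : ‖tensorSq v‖ ^ 2 = (‖v‖ ^ 2) ^ 2 := by
    rw [← real_inner_self_eq_norm_sq, inner_tensorSq, real_inner_self_eq_norm_sq]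
  exact (sq_eq_sq₀ (norm_nonneg _) (sq_nonneg _)).1 h

omit [Fintype ι] in
lemma continuous_tensorSq : Continuous (tensorSq : EuclideanSpace ℝ ι → _) := by
  refine (PiLp.continuous_toLp 2 _).comp (continuous_pi fun e => ?_)
  fun_prop

end TensorSquare

section Martingales

variable {n d : ℕ}

/-- The part of `yᵀ h y + 2 yᵀ h v + vᵀ h v - tr (W h)` that depends on the noise `v`. -/
def noiseTerm (W h : Matrix (Fin n) (Fin n) ℝ) (y v : EuclideanSpace ℝ (Fin n)) : ℝ :=
  2 * ((h *ᵥ y.ofLp) ⬝ᵥ v.ofLp) + (v.ofLp ⬝ᵥ (h *ᵥ v.ofLp) - (W * h).trace)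

lemma continuous_noiseTerm (W h : Matrix (Fin n) (Fin n) ℝ) :
    Continuous fun z : EuclideanSpace ℝ (Fin n) × EuclideanSpace ℝ (Fin n) =>
      noiseTerm W h z.1 z.2 := by
  simp only [noiseTerm, dotProduct, mulVec]
  fun_prop

variable (S : LQProblem n d) (K : Matrix (Fin d) (Fin n) ℝ)

/-- The regression noise `Ψᵀ ξ` accumulated over the first `k` exploratory tuples. -/
def LQProblem.noiseSum (h : Matrix (Fin n) (Fin n) ℝ) (s : ℕ) (x : EuclideanSpace ℝ (Fin n))
    (u : Data n d) (k : ℕ) : EuclideanSpace ℝ (Sym2 (Fin n ⊕ Fin d)) :=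
  ∑ j ∈ Finset.range k, noiseTerm S.W h (matE S.dyn (S.regressor K s x u j))
    (u.1 (j * s + (s - 1))) • outerVec (S.regressor K s x u j)

/-- The mean of `vec(z zᵀ) ⊗ vec(z zᵀ)` for `z ∼ 𝒩(m, Q)`. -/
def meanTensor {ι : Type*} [Fintype ι] [DecidableEq ι] (Q : Matrix ι ι ℝ)
    (m : EuclideanSpace ℝ ι) : EuclideanSpace ℝ (Sym2 ι × Sym2 ι) :=
  ∫ ζ, tensorSq (outerVec (m + ζ)) ∂(multivariateGaussian 0 Q)

/-- The deviation of `∑ vec(z zᵀ) ⊗ vec(z zᵀ)` over the first `k` exploratory tuples from the sum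
of the conditional means, each given the data before its block. -/
def LQProblem.designSum (SigA : Matrix (Fin d) (Fin d) ℝ) (s : ℕ) (x : EuclideanSpace ℝ (Fin n))
    (u : Data n d) (k : ℕ) :
    EuclideanSpace ℝ (Sym2 (Fin n ⊕ Fin d) × Sym2 (Fin n ⊕ Fin d)) :=
  ∑ j ∈ Finset.range k, (tensorSq (outerVec (S.regressor K s x u j)) -
    meanTensor (S.blockCov K SigA s) (matE (S.carry K s) (S.state K s x u (j * s))))

lemma measurable_tensorSq_outerVec {ι : Type*} [Fintype ι] [DecidableEq ι] :
    Measurable (fun z : EuclideanSpace ℝ ι => tensorSq (outerVec z)) :=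
  (continuous_tensorSq.comp continuous_outerVec).measurable

lemma measurable_meanTensor {ι : Type*} [Fintype ι] [DecidableEq ι] (Q : Matrix ι ι ℝ) :
    Measurable (meanTensor Q) := by
  have h : StronglyMeasurable (Function.uncurry fun m ζ : EuclideanSpace ℝ ι =>
      tensorSq (outerVec (m + ζ))) :=
    ((continuous_tensorSq.comp continuous_outerVec).comp
      (continuous_fst.add continuous_snd)).stronglyMeasurable
  exact (h.integral_prod_right (ν := multivariateGaussian 0 Q)).measurable

lemma integrable_tensorSq_outerVec {ι : Type*} [Fintype ι] [DecidableEq ι] (Q : Matrix ι ι ℝ)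
    (m : EuclideanSpace ℝ ι) :
    Integrable (fun ζ : EuclideanSpace ℝ ι => tensorSq (outerVec (m + ζ))) (multivariateGaussian 0 Q) := by
  have h1 : MemLp (fun ζ : EuclideanSpace ℝ ι => m + ζ) 4 (multivariateGaussian 0 Q) :=
    (memLp_const m).add (IsGaussian.memLp_id _ 4 (by simp))
  have h2 := h1.integrable_norm_pow (p := 4) (by norm_num)
  refine h2.mono' (((continuous_tensorSq.comp continuous_outerVec).comp
    (continuous_const.add continuous_id)).aestronglyMeasurable)
    (Filter.Eventually.of_forall fun ζ => ?_)
  rw [norm_tensorSq, norm_outerVec, ← pow_mul]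

variable {S K}

lemma measurable_noiseIncrement (h : Matrix (Fin n) (Fin n) ℝ) (s : ℕ)
    (x : EuclideanSpace ℝ (Fin n)) (k : ℕ) :
    Measurable fun z : Data n d × EuclideanSpace ℝ (Fin n) =>
      noiseTerm S.W h (matE S.dyn (S.regressor K s x z.1 k)) z.2 •
        outerVec (S.regressor K s x z.1 k) := by
  have hr : Measurable fun z : Data n d × EuclideanSpace ℝ (Fin n) => S.regressor K s x z.1 k :=
    (LQProblem.measurable_regressor S K s k).comp (measurable_const.prodMk measurable_fst)
  have hy := (matE S.dyn).continuous.measurable.comp hr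
  have h1 := (continuous_noiseTerm S.W h).measurable.comp (hy.prodMk measurable_snd)
  exact h1.smul (continuous_outerVec.measurable.comp hr)

lemma measurable_noiseSum (s k : ℕ) :
    Measurable fun z : (EuclideanSpace ℝ (Fin n) × (Fin n → Fin n → ℝ)) × Data n d =>
      S.noiseSum K (Matrix.of z.1.2) s z.1.1 z.2 k := by
  unfold LQProblem.noiseSum
  refine Finset.measurable_sum _ fun j _ => ?_
  have hr : Measurable fun z : (EuclideanSpace ℝ (Fin n) × (Fin n → Fin n → ℝ)) × Data n d =>
      S.regressor K s z.1.1 z.2 j :=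
    (LQProblem.measurable_regressor S K s j).comp
      ((measurable_fst.comp measurable_fst).prodMk measurable_snd)
  have hy := (matE S.dyn).continuous.measurable.comp hr
  have hv : Measurable fun z : (EuclideanSpace ℝ (Fin n) × (Fin n → Fin n → ℝ)) × Data n d =>
      z.2.1 (j * s + (s - 1)) := by fun_prop
  have hc : Continuous fun z : (Fin n → Fin n → ℝ) ×
      (EuclideanSpace ℝ (Fin n) × EuclideanSpace ℝ (Fin n)) =>
      noiseTerm S.W (Matrix.of z.1) z.2.1 z.2.2 := by
    simp only [noiseTerm, dotProduct, mulVec, Matrix.trace, Matrix.diag, Matrix.mul_apply,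
      Matrix.of_apply]
    fun_prop
  have hh : Measurable fun z : (EuclideanSpace ℝ (Fin n) × (Fin n → Fin n → ℝ)) × Data n d =>
      z.1.2 := by fun_prop
  exact (hc.measurable.comp (hh.prodMk (hy.prodMk hv))).smul
    (continuous_outerVec.measurable.comp hr)

lemma measurable_designSum (SigA : Matrix (Fin d) (Fin d) ℝ) (s k : ℕ) :
    Measurable fun z : EuclideanSpace ℝ (Fin n) × Data n d =>
      S.designSum K SigA s z.1 z.2 k := by
  unfold LQProblem.designSum
  refine Finset.measurable_sum _ fun j _ => ?_
  refine (measurable_tensorSq_outerVec.comp (LQProblem.measurable_regressor S K s j)).sub ?_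
  exact (measurable_meanTensor _).comp
    ((matE _).continuous.measurable.comp (LQProblem.measurable_state S K s (j * s)))

lemma noiseSum_past {s : ℕ} (hs : 1 ≤ s) (h : Matrix (Fin n) (Fin n) ℝ)
    (x : EuclideanSpace ℝ (Fin n)) (u : Data n d) (k : ℕ) :
    S.noiseSum K h s x (u.past (k * s + (s - 1)) (k + 1)) k = S.noiseSum K h s x u k := by
  unfold LQProblem.noiseSum
  refine Finset.sum_congr rfl fun j hj => ?_
  have hj' : j * s + s ≤ k * s := by
    have := Nat.mul_le_mul_right s (Finset.mem_range.1 hj : j + 1 ≤ k)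
    rwa [Nat.succ_mul] at this
  have e : (u.past (k * s + (s - 1)) (k + 1)).1 (j * s + (s - 1)) = u.1 (j * s + (s - 1)) :=
    trunc_apply (by lia) _
  rw [LQProblem.regressor_past hs (by lia) (by have := Finset.mem_range.1 hj; lia), e]

lemma designSum_past {s : ℕ} (hs : 1 ≤ s) (SigA : Matrix (Fin d) (Fin d) ℝ)
    (x : EuclideanSpace ℝ (Fin n)) (u : Data n d) (k : ℕ) :
    S.designSum K SigA s x (u.past (k * s) k) k = S.designSum K SigA s x u k := by
  unfold LQProblem.designSum
  refine Finset.sum_congr rfl fun j hj => ?_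
  have hj1 := Finset.mem_range.1 hj
  have hj' : j * s + s ≤ k * s := by
    have := Nat.mul_le_mul_right s (hj1 : j + 1 ≤ k)
    rwa [Nat.succ_mul] at this
  rw [LQProblem.regressor_past hs (by lia) hj1, LQProblem.state_past (by lia)
    (by rw [Nat.mul_div_cancel _ (by lia)]; lia)]

variable {Sig : Matrix (Fin n) (Fin n) ℝ} {SigA : Matrix (Fin d) (Fin d) ℝ}
  {Ω : Type*} [MeasurableSpace Ω] {μ : Measure Ω} [IsProbabilityMeasure μ]
  {m₀ : EuclideanSpace ℝ (Fin n)} {Sig₀ : Matrix (Fin n) (Fin n) ℝ}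
  {x₀ : Ω → EuclideanSpace ℝ (Fin n)} {Hhat : Ω → Matrix (Fin n) (Fin n) ℝ}
  {w : ℕ → Ω → EuclideanSpace ℝ (Fin n)} {a : ℕ → Ω → EuclideanSpace ℝ (Fin d)} {κ α : ℝ}
  {s p : ℕ} {x : EuclideanSpace ℝ (Fin n)}

omit [IsProbabilityMeasure μ] in
lemma integral_noiseTerm {W h : Matrix (Fin n) (Fin n) ℝ} (hW : W.PosSemidef)
    (y : EuclideanSpace ℝ (Fin n)) {v : Ω → EuclideanSpace ℝ (Fin n)}
    (hv : HasLaw v (multivariateGaussian 0 W) μ) :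
    Integrable (fun ω => noiseTerm W h y (v ω)) μ ∧ ∫ ω, noiseTerm W h y (v ω) ∂μ = 0 := by
  have i1 := (integrable_dotProduct_gaussian W (h *ᵥ y.ofLp)).const_mul 2
  have i2 := (integrable_quadratic_gaussian W h).sub (integrable_const (W * h).trace)
  have i3 : Integrable (noiseTerm W h y) (multivariateGaussian 0 W) := i1.add i2
  refine ⟨?_, ?_⟩
  · rw [← hv.map_eq] at i3
    exact i3.comp_aemeasurable hv.aemeasurable
  · have hm : AEStronglyMeasurable (noiseTerm W h y) (μ.map v) := by
      rw [hv.map_eq]; exact i3.1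
    rw [← integral_map hv.aemeasurable hm, hv.map_eq]
    have e : ∫ v, noiseTerm W h y v ∂(multivariateGaussian 0 W) =
      (∫ v, 2 * ((h *ᵥ y.ofLp) ⬝ᵥ v.ofLp) ∂(multivariateGaussian 0 W)) +
        ∫ v, (v.ofLp ⬝ᵥ (h *ᵥ v.ofLp) - (W * h).trace) ∂(multivariateGaussian 0 W) :=
      integral_add i1 i2
    rw [e, integral_const_mul, integral_dotProduct_gaussian,
      integral_sub (integrable_quadratic_gaussian W h) (integrable_const _),
      integral_quadratic_gaussian hW]
    simp

/-- The regression noise given the regressor: a Gaussian part, whose variance is at most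
`κ⁻¹ ‖W h y‖²` by the spectral gap of `W`, and a Gaussian chaos. -/
lemma momBd_noiseTerm {W h : Matrix (Fin n) (Fin n) ℝ} (hW : W.PosSemidef) (hκ : 0 < κ)
    (hgap : (W * W - κ • W).PosSemidef) (hh : h.IsSymm)
    {v : Ω → EuclideanSpace ℝ (Fin n)} (hv : HasLaw v (multivariateGaussian 0 W) μ) (hp : 1 ≤ p)
    (y : EuclideanSpace ℝ (Fin n)) :
    MomBd μ (2 * p) (fun ω => noiseTerm W h y (v ω))
      (7 * √(p / κ) * ‖matE (W * h) y‖ + 24 * p * frobNorm (W * h)) := by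
  have h1 := (momBd_dotProduct hW hv (h *ᵥ y.ofLp) hp).const_mul 2
  have h2 := momBd_quadratic hW hv h hh hp
  refine (h1.add (by lia) h2).mono (add_le_add ?_ ?_)
  · have hy : (W *ᵥ (h *ᵥ y.ofLp)) ⬝ᵥ (W *ᵥ (h *ᵥ y.ofLp)) = ‖matE (W * h) y‖ ^ 2 := by
      rw [← real_inner_self_eq_norm_sq, inner_eq_dotProduct, ofLp_matE, mulVec_mulVec]
    have h3 := smul_quadratic_le_norm_sq hW hgap (h *ᵥ y.ofLp)
    rw [hy] at h3
    rw [abs_of_pos two_pos]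
    have e : 7 * √(p / κ) * ‖matE (W * h) y‖ = √(49 * (p / κ) * ‖matE (W * h) y‖ ^ 2) := by
      rw [Real.sqrt_mul (by positivity), Real.sqrt_sq (norm_nonneg _), Real.sqrt_mul (by norm_num),
        show (49 : ℝ) = 7 ^ 2 by norm_num, Real.sqrt_sq (by norm_num)]
    have e2 : ∀ r : ℝ, 2 * √r = √(4 * r) := fun r => by
      rw [Real.sqrt_mul (by norm_num), show (4 : ℝ) = 2 ^ 2 by norm_num,
        Real.sqrt_sq (by norm_num)]
    rw [e, e2]
    refine Real.sqrt_le_sqrt ?_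
    have h4 : h *ᵥ y.ofLp ⬝ᵥ (W *ᵥ (h *ᵥ y.ofLp)) ≤ ‖matE (W * h) y‖ ^ 2 / κ := by
      rw [le_div_iff₀ hκ]; linarith
    have h5 := mul_le_mul_of_nonneg_left h4 (by positivity : (0 : ℝ) ≤ 48 * p)
    have h6 : (0 : ℝ) ≤ p * (‖matE (W * h) y‖ ^ 2 / κ) := by positivity
    have e3 : (p / κ) * ‖matE (W * h) y‖ ^ 2 = p * (‖matE (W * h) y‖ ^ 2 / κ) := by ring
    rw [mul_assoc 49, e3]
    linarith
  · refine mul_le_mul_of_nonneg_left ?_ (by positivity)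
    have h3 := trace_mul_le_frobNorm (W * h) (W * h)
    rw [← Matrix.mul_assoc] at h3
    calc √((W * h * W * h).trace) ≤ √(frobNorm (W * h) * frobNorm (W * h)) := Real.sqrt_le_sqrt h3
      _ = frobNorm (W * h) := Real.sqrt_mul_self (frobNorm_nonneg _)

namespace LQProblem.IsNondegenerate

variable (hS : S.IsNondegenerate K Sig SigA κ)
  (h : IsDataCollection μ S.W SigA m₀ Sig₀ x₀ Hhat w a) (hs : S.IsBurnIn K Sig SigA κ α s)
  (hp : 2 ≤ p) (hx : ‖x‖ ≤ α * √p)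
  (hα : frobNorm S.dyn * (8 * √(Sig.trace + SigA.trace)) + 7 * √S.W.trace ≤ α)
include hS h hs hp hx hα

lemma momBd_outerVec_regressor (k : ℕ) :
    MomBd μ (4 * p) (fun ω => outerVec (S.regressor K s x (dataOf w a ω) k))
      (64 * (p * (Sig.trace + SigA.trace))) := by
  have h1 := hS.momBd_regressor h hs (by lia) hx hα k
  have h2 := (MomBd.sq (q := 4 * p) (by lia)
    (by rw [show 2 * (4 * p) = 8 * p by ring]; exact h1))
  have ht := hS.trace_nonneg
  rw [mul_pow, Real.sq_sqrt (by positivity)] at h2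
  refine MomBd.of_norm_le (continuous_outerVec.comp_aestronglyMeasurable h1.aesm)
    (h2.mono (by norm_num)) fun ω => (norm_outerVec _).le

lemma momBd_noiseIncrement {h' : Matrix (Fin n) (Fin n) ℝ} (hh : h'.IsSymm) (k : ℕ) :
    MomBd μ (2 * p) (fun ω => noiseTerm S.W h'
        (matE S.dyn (S.regressor K s x (dataOf w a ω) k)) (w (k * s + (s - 1)) ω) •
          outerVec (S.regressor K s x (dataOf w a ω) k))
      (5000 / κ * p ^ 2 * frobNorm (S.W * h') * (Sig.trace + SigA.trace) *
        frobNorm (S.nextCov Sig SigA)) := by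
  set T := k * s + (s - 1) with hT
  set F := frobNorm (S.W * h') with hF
  set f := frobNorm (S.nextCov Sig SigA) with hf
  set t := Sig.trace + SigA.trace with ht
  have hF0 : 0 ≤ F := frobNorm_nonneg _
  have ht0 : 0 ≤ t := hS.trace_nonneg
  have hκ := hS.pos
  have hfκ : 1 ≤ f / κ := (one_le_div hκ).2 hS.le_nextCov
  have hpast : ∀ ω, S.regressor K s x ((dataOf w a ω).past T (k + 1)) k =
      S.regressor K s x (dataOf w a ω) k := fun ω =>
    regressor_past hs.one_le le_rfl (by lia) _ _
  -- condition on the data before the noise of the exploratory round of the block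
  have key := MomBd.of_indep (q := 2 * p) (by lia)
    ((Data.measurable_past T (k + 1)).comp h.measurable_dataOf) (h.measurable_noise T)
    (h.indepFun_past_noise T (k + 1))
    (measurable_noiseIncrement (S := S) (K := K) h' s x k).stronglyMeasurable
    (b := fun u => (7 * √(p / κ) * ‖matE (S.W * h') (matE S.dyn (S.regressor K s x u k))‖ +
      24 * p * F) * ‖outerVec (S.regressor K s x u k)‖)
    (B := 5000 / κ * p ^ 2 * F * t * f) ?_ ?_
  · simp only [Function.comp_apply, hpast] at key
    exact key
  · intro u
    have h1 := momBd_noiseTerm S.posSemidef_W hκ hS.noise hh (h.law_noise T) (p := p) (by lia)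
      (matE S.dyn (S.regressor K s x u k))
    have h2 := h1.of_le_mul (X := fun ω => noiseTerm S.W h'
        (matE S.dyn (S.regressor K s x u k)) (w T ω) • outerVec (S.regressor K s x u k))
      (h1.aesm.smul_const _) (norm_nonneg (outerVec (S.regressor K s x u k)))
      fun ω => by rw [norm_smul, mul_comm]
    exact (mul_comm ‖outerVec (S.regressor K s x u k)‖ _) ▸ h2
  · simp only [Function.comp_apply, hpast]
    have h1 := (hS.momBd_dyn_regressor h hs (by lia) hx hα (S.W * h') k).norm.const_mul
      (7 * √(p / κ))
    rw [abs_of_nonneg (by positivity)] at h1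
    have h2 := h1.add (by lia) (MomBd.const (μ := μ) (q := 4 * p) (24 * p * F))
    have h3 := (hS.momBd_outerVec_regressor h hs hp hx hα k).norm
    rw [show 4 * p = 2 * (2 * p) by ring] at h2 h3
    refine (h2.mul h3).mono ?_
    rw [Real.norm_of_nonneg (by positivity), ← hF, ← hf]
    have e : √(p / κ) * √(p * f) = p * √(f / κ) := by
      rw [← Real.sqrt_mul (by positivity), show (p : ℝ) / κ * (p * f) = p ^ 2 * (f / κ) by ring,
        Real.sqrt_mul (by positivity), Real.sqrt_sq (by positivity)]
    have h4 : √(f / κ) ≤ f / κ := by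
      rw [Real.sqrt_le_left (by positivity)]
      nlinarith
    have h5 : 7 * √(p / κ) * (6 * F * √(p * f)) + 24 * p * F ≤ 66 * (p * F * (f / κ)) := by
      have e2 : 7 * √(p / κ) * (6 * F * √(p * f)) = 42 * F * (√(p / κ) * √(p * f)) := by ring
      rw [e2, e]
      have hpF : 0 ≤ (p : ℝ) * F := by positivity
      nlinarith [mul_le_mul_of_nonneg_left h4 hpF, mul_le_mul_of_nonneg_left hfκ hpF]
    refine (mul_le_mul_of_nonneg_right h5 (by positivity)).trans ?_
    have : 0 ≤ p ^ 2 * F * t * (f / κ) := by positivity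
    calc 66 * (p * F * (f / κ)) * (64 * (p * t)) = 4224 * (p ^ 2 * F * t * (f / κ)) := by ring
      _ ≤ 5000 * (p ^ 2 * F * t * (f / κ)) := by linarith
      _ = _ := by ring

/-- Moments of the accumulated regression noise. -/
lemma momBd_noiseSum {h' : Matrix (Fin n) (Fin n) ℝ} (hh : h'.IsSymm) (k : ℕ) :
    MomBd μ (2 * p) (fun ω => S.noiseSum K h' s x (dataOf w a ω) k)
      (100 * p * (5000 / κ * p ^ 2 * frobNorm (S.W * h') * (Sig.trace + SigA.trace) *
        frobNorm (S.nextCov Sig SigA)) * √(k + 1)) := by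
  have hpast : ∀ k ω, S.regressor K s x ((dataOf w a ω).past (k * s + (s - 1)) (k + 1)) k =
      S.regressor K s x (dataOf w a ω) k := fun k ω =>
    regressor_past hs.one_le le_rfl (by lia) _ _
  have hterm := fun (k : ℕ) (u : Data n d) => integral_noiseTerm (h := h') S.posSemidef_W
    (matE S.dyn (S.regressor K s x u k)) (h.law_noise (k * s + (s - 1)))
  refine MomBd.martingale_indep (p := p) hp (S := fun k ω => S.noiseSum K h' s x (dataOf w a ω) k)
    (U := fun k ω => (dataOf w a ω).past (k * s + (s - 1)) (k + 1))
    (N := fun k => w (k * s + (s - 1)))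
    (σ := fun k u => S.noiseSum K h' s x u k)
    (f := fun k z => noiseTerm S.W h' (matE S.dyn (S.regressor K s x z.1 k)) z.2 •
        outerVec (S.regressor K s x z.1 k))
    (hS.momBd_noiseIncrement h hs hp hx hα hh 0).nonneg (fun ω => Finset.sum_range_zero _)
    (fun k ω => Finset.sum_range_succ _ _) (fun k => hS.momBd_noiseIncrement h hs hp hx hα hh k)
    (fun k => (Data.measurable_past _ _).comp h.measurable_dataOf)
    (fun k => h.measurable_noise _) (fun k => h.indepFun_past_noise _ _)
    (fun k => ?_) (fun k ω => (noiseSum_past hs.one_le _ _ _ _).symm) (fun k => ?_) (fun k ω => ?_)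
    (fun k u => ?_) (fun k u => ?_) k
  · exact ((measurable_noiseSum (S := S) (K := K) s k).comp
      ((measurable_const (a := (x, fun i j => h' i j))).prodMk measurable_id)).stronglyMeasurable
  · exact (measurable_noiseIncrement (S := S) (K := K) h' s x k).stronglyMeasurable
  · simp only [hpast]; rfl
  · exact (hterm k u).1.smul_const (outerVec (S.regressor K s x u k))
  · refine (integral_smul_const _ (outerVec (S.regressor K s x u k))).trans ?_
    rw [(hterm k u).2, zero_smul]

/-- Moments of the fluctuation of the Gram matrix around its conditional means. -/
lemma momBd_designSum (k : ℕ) :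
    MomBd μ (2 * p) (fun ω => S.designSum K SigA s x (dataOf w a ω) k)
      (100 * p * (8192 * (p * (Sig.trace + SigA.trace)) ^ 2) * √(k + 1)) := by
  set Q := S.blockCov K SigA s with hQ
  have hcont : Continuous fun z : EuclideanSpace ℝ (Fin n ⊕ Fin d) => tensorSq (outerVec z) :=
    continuous_tensorSq.comp continuous_outerVec
  have hms : ∀ k, Measurable fun u : Data n d =>
      matE (S.carry K s) (S.state K s x u (k * s)) := fun k =>
    (matE _).continuous.measurable.comp
      ((measurable_state S K s (k * s)).comp (measurable_const.prodMk measurable_id))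
  have hpast : ∀ k ω, S.state K s x ((dataOf w a ω).past (k * s) k) (k * s) =
      S.state K s x (dataOf w a ω) (k * s) := fun k ω =>
    state_past le_rfl (by rw [Nat.mul_div_cancel _ (by have := hs.one_le; lia)]) _ _
  have hlaw := fun k => h.hasLaw_blockPart hS.posSemidef_action K s k
  have hmU : ∀ k, Measurable fun ω => (dataOf w a ω).past (k * s) k := fun k =>
    (Data.measurable_past _ _).comp h.measurable_dataOf
  have hmN : ∀ k, Measurable fun ω => S.blockPart K s (dataOf w a ω) k := fun k => by
    refine Measurable.comp (g := fun u : Data n d => S.blockPart K s u k) ?_ h.measurable_dataOf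
    exact ((matE _).continuous.measurable.comp ((measurable_loopNoise _ _).comp
      (by fun_prop))).add ((matE _).continuous.measurable.comp (by fun_prop))
  have hmean : ∀ k m, ∫ ω, tensorSq (outerVec (m + S.blockPart K s (dataOf w a ω) k)) ∂μ
      = meanTensor Q m := fun k m => by
    have := (hlaw k).integral_comp (f := fun ζ => tensorSq (outerVec (m + ζ)))
      (hcont.comp (continuous_const.add continuous_id)).aestronglyMeasurable
    exact this
  have hint : ∀ (k : ℕ) (m : EuclideanSpace ℝ (Fin n ⊕ Fin d)), Integrable
      (fun ω => tensorSq (outerVec (m + S.blockPart K s (dataOf w a ω) k))) μ := fun k m => by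
    have := integrable_tensorSq_outerVec Q m
    rw [← (hlaw k).map_eq] at this
    exact this.comp_aemeasurable (hlaw k).aemeasurable
  have hcent : ∀ (k : ℕ) (m : EuclideanSpace ℝ (Fin n ⊕ Fin d)),
      Integrable (fun ω => tensorSq (outerVec (m + S.blockPart K s (dataOf w a ω) k)) -
        meanTensor Q m) μ ∧
      ∫ ω, (tensorSq (outerVec (m + S.blockPart K s (dataOf w a ω) k)) -
        meanTensor Q m) ∂μ = 0 := fun k m => by
    refine ⟨(hint k m).sub (integrable_const _), ?_⟩
    rw [integral_sub (hint k m) (integrable_const _), hmean]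
    simp
  have hV : ∀ k, MomBd μ (2 * p)
      (fun ω => tensorSq (outerVec (S.regressor K s x (dataOf w a ω) k)))
      (4096 * (p * (Sig.trace + SigA.trace)) ^ 2) := fun k => by
    have h1 := hS.momBd_outerVec_regressor h hs hp hx hα k
    have h2 := MomBd.sq (q := 2 * p) (by lia)
      (by rw [show 2 * (2 * p) = 4 * p by ring]; exact h1)
    refine MomBd.of_norm_le (continuous_tensorSq.comp_aestronglyMeasurable h1.aesm)
      (h2.mono (by ring_nf; rfl)) fun ω => (norm_tensorSq _).le
  have hf0 : ∀ k : ℕ, StronglyMeasurable fun z : Data n d × EuclideanSpace ℝ (Fin n ⊕ Fin d) =>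
      tensorSq (outerVec (matE (S.carry K s) (S.state K s x z.1 (k * s)) + z.2)) := fun k =>
    (hcont.measurable.comp (((hms k).comp measurable_fst).add measurable_snd)).stronglyMeasurable
  have hg : ∀ k, MomBd μ (2 * p) (fun ω => meanTensor Q
      (matE (S.carry K s) (S.state K s x (dataOf w a ω) (k * s))))
      (4096 * (p * (Sig.trace + SigA.trace)) ^ 2) := fun k => by
    have := MomBd.integral_indep (q := 2 * p) (by lia) (hmU k) (hmN k)
      (h.indepFun_past_blockPart K s k) (hf0 k) (B := 4096 * (p * (Sig.trace + SigA.trace)) ^ 2) (by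
        simp only [hpast, ← regressor_eq hs.one_le]
        exact hV k)
    simp only [hpast, hmean] at this
    exact this
  have ht := hS.trace_nonneg
  refine MomBd.martingale_indep (p := p) hp
    (S := fun k ω => S.designSum K SigA s x (dataOf w a ω) k)
    (U := fun k ω => (dataOf w a ω).past (k * s) k)
    (N := fun k ω => S.blockPart K s (dataOf w a ω) k)
    (σ := fun k u => S.designSum K SigA s x u k)
    (f := fun k z => tensorSq (outerVec (matE (S.carry K s) (S.state K s x z.1 (k * s)) + z.2)) -
      meanTensor Q (matE (S.carry K s) (S.state K s x z.1 (k * s))))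
    (by positivity) (fun ω => Finset.sum_range_zero _)
    (fun k ω => Finset.sum_range_succ _ _)
    (fun k => ((hV k).sub (by lia) (hg k)).mono (by linarith))
    hmU hmN (fun k => h.indepFun_past_blockPart K s k)
    (fun k => ?_) (fun k ω => (designSum_past hs.one_le _ _ _ _).symm) (fun k => ?_) (fun k ω => ?_)
    (fun k u => ?_) (fun k u => ?_) k
  · exact ((measurable_designSum (S := S) (K := K) SigA s k).comp
      (measurable_const.prodMk measurable_id)).stronglyMeasurable
  · exact (hf0 k).sub ((measurable_meanTensor Q).comp
      ((hms k).comp measurable_fst)).stronglyMeasurable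
  · simp only [hpast, ← regressor_eq hs.one_le]
    rfl
  · exact hcent k (matE (S.carry K s) (S.state K s x u (k * s))) |>.1
  · exact hcent k (matE (S.carry K s) (S.state K s x u (k * s))) |>.2

end LQProblem.IsNondegenerate

/-- Every conditional mean of the Gram matrix is bounded below, whatever the state. -/
lemma le_inner_meanTensor {ι : Type*} [Fintype ι] [DecidableEq ι] {Q : Matrix ι ι ℝ}
    (hκ : 0 ≤ κ) (hQ : (Q - κ • (1 : Matrix ι ι ℝ)).PosSemidef) (m : EuclideanSpace ℝ ι)
    (y : EuclideanSpace ℝ (Sym2 ι)) :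
    2 * κ ^ 2 * ‖y‖ ^ 2 ≤ inner ℝ (meanTensor Q m) (tensorSq y) := by
  have h1 := le_integral_quadratic_sq (posSemidef_of_sub_smul_one hκ hQ) (isSymm_smat y.ofLp) m.ofLp
  have h2 := sq_mul_frobNorm_sq_le_trace hκ hQ (isSymm_smat y.ofLp)
  rw [frobNorm_smat] at h2
  have e : inner ℝ (meanTensor Q m) (tensorSq y) =
      ∫ ζ : EuclideanSpace ℝ ι, ((m.ofLp + ζ.ofLp) ⬝ᵥ (smat y.ofLp *ᵥ (m.ofLp + ζ.ofLp))) ^ 2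
        ∂(multivariateGaussian 0 Q) := by
    rw [meanTensor, real_inner_comm,
      ← integral_inner (integrable_tensorSq_outerVec Q m)]
    refine integral_congr_ae (Filter.Eventually.of_forall fun ζ => ?_)
    simp only
    rw [real_inner_comm, inner_tensorSq, inner_outerVec]
    rfl
  rw [e]
  have e2 : (WithLp.toLp 2 y.ofLp : EuclideanSpace ℝ (Sym2 ι)) = y := rfl
  rw [e2] at h2
  linarith

/-- A small fluctuation leaves a lower bound for the Gram matrix. -/
lemma le_sum_inner_sq {ε : ℝ} (hκ : 0 ≤ κ) {s : ℕ}
    (hQ : (S.blockCov K SigA s - κ • (1 : Matrix (Fin n ⊕ Fin d) (Fin n ⊕ Fin d) ℝ)).PosSemidef)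
    {u : Data n d} {τ : ℕ} (hD : ‖S.designSum K SigA s x u τ‖ ≤ ε)
    (y : EuclideanSpace ℝ (Sym2 (Fin n ⊕ Fin d))) :
    (2 * κ ^ 2 * τ - ε) * ‖y‖ ^ 2 ≤
      ∑ j ∈ Finset.range τ, inner ℝ (outerVec (S.regressor K s x u j)) y ^ 2 := by
  have h1 := neg_le_of_abs_le (abs_real_inner_le_norm (S.designSum K SigA s x u τ) (tensorSq y))
  rw [norm_tensorSq] at h1
  have h2 := mul_le_mul_of_nonneg_right hD (sq_nonneg ‖y‖)
  have h3 : inner ℝ (S.designSum K SigA s x u τ) (tensorSq y) =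
      ∑ j ∈ Finset.range τ, inner ℝ (outerVec (S.regressor K s x u j)) y ^ 2 -
      ∑ j ∈ Finset.range τ, inner ℝ (meanTensor (S.blockCov K SigA s)
        (matE (S.carry K s) (S.state K s x u (j * s)))) (tensorSq y) := by
    rw [LQProblem.designSum, sum_inner, ← Finset.sum_sub_distrib]
    simp only [inner_sub_left, inner_tensorSq]
  have h4 : (τ : ℝ) * (2 * κ ^ 2 * ‖y‖ ^ 2) ≤
      ∑ j ∈ Finset.range τ, inner ℝ (meanTensor (S.blockCov K SigA s)
        (matE (S.carry K s) (S.state K s x u (j * s)))) (tensorSq y) := by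
    have := Finset.card_nsmul_le_sum (Finset.range τ) (fun j =>
      inner ℝ (meanTensor (S.blockCov K SigA s)
        (matE (S.carry K s) (S.state K s x u (j * s)))) (tensorSq y)) (2 * κ ^ 2 * ‖y‖ ^ 2)
      fun j _ => le_inner_meanTensor hκ hQ _ y
    simpa using this
  linarith

end Martingales

/-! ### The error of the estimate and the exploration period -/

section EstimateError

variable {n d : ℕ} {S : LQProblem n d} {K : Matrix (Fin d) (Fin n) ℝ}

lemma LQProblem.cost_eq_quadratic (S : LQProblem n d) (x : Fin n → ℝ) (v : Fin d → ℝ) :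
    S.cost x v = Sum.elim x v ⬝ᵥ (S.costMatrix *ᵥ Sum.elim x v) := by
  rw [LQProblem.cost, LQProblem.costMatrix, fromBlocks_mulVec]
  simp [dotProduct, Fintype.sum_sum_type]

/-- The regression target at one tuple: a quadratic form of the regressor plus noise. -/
lemma LQProblem.targetVec_eq {h : Matrix (Fin n) (Fin n) ℝ} (hh : h.IsSymm) {s : ℕ} (hs : 1 ≤ s)
    (x : EuclideanSpace ℝ (Fin n)) (u : Data n d) {τ : ℕ} (k : Fin τ) :
    S.targetVec K s x.ofLp (fun t => (u.1 t).ofLp) (fun k => (u.2 k).ofLp) h τ k =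
      (S.regressor K s x u k).ofLp ⬝ᵥ
        ((S.costMatrix + S.dynᵀ * h * S.dyn) *ᵥ (S.regressor K s x u k).ofLp) +
      noiseTerm S.W h (matE S.dyn (S.regressor K s x u k)) (u.1 (k * s + (s - 1))) := by
  have hW : S.W.IsSymm := S.posSemidef_W.1
  set z := S.regressor K s x u k with hz
  set v := u.1 (k * s + (s - 1)) with hv
  have hnext : S.nextState K s x.ofLp (fun t => (u.1 t).ofLp) (fun k => (u.2 k).ofLp) k =
      S.dyn *ᵥ z.ofLp + v.ofLp := congrArg WithLp.ofLp (state_next (K := K) hs k x u)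
  have hcost : S.cost (S.exploreState K s x.ofLp (fun t => (u.1 t).ofLp)
      (fun k => (u.2 k).ofLp) k) (u.2 k).ofLp = z.ofLp ⬝ᵥ (S.costMatrix *ᵥ z.ofLp) :=
    S.cost_eq_quadratic _ _
  have hcomm : (S.dyn *ᵥ z.ofLp) ⬝ᵥ (h *ᵥ v.ofLp) = (h *ᵥ (S.dyn *ᵥ z.ofLp)) ⬝ᵥ v.ofLp := by
    rw [dotProduct_mulVec, ← mulVec_transpose, hh.eq]
  have hcomm2 : v.ofLp ⬝ᵥ (h *ᵥ (S.dyn *ᵥ z.ofLp)) = (h *ᵥ (S.dyn *ᵥ z.ofLp)) ⬝ᵥ v.ofLp :=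
    dotProduct_comm _ _
  have hquad : z.ofLp ⬝ᵥ ((S.dynᵀ * h * S.dyn) *ᵥ z.ofLp) =
      (S.dyn *ᵥ z.ofLp) ⬝ᵥ (h *ᵥ (S.dyn *ᵥ z.ofLp)) := by
    rw [← mulVec_mulVec, ← mulVec_mulVec, dotProduct_mulVec z.ofLp, vecMul_transpose]
  simp only [LQProblem.targetVec]
  rw [hcost, hnext, sub_dotProduct, svec_vecMulVec_dotProduct _ hh, svec_dotProduct_svec hW hh,
    add_mulVec, dotProduct_add, hquad, noiseTerm, ofLp_matE, mulVec_add, dotProduct_add,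
    add_dotProduct, add_dotProduct, hcomm, hcomm2]
  ring

/-- The error of the least-squares estimate, given a lower bound for the Gram matrix: the
contribution of the error in the value matrix, and that of the regression noise. -/
lemma LQProblem.IsStateActionMatrix.frobNorm_sub_estimate_le
    {G : Matrix (Fin n ⊕ Fin d) (Fin n ⊕ Fin d) ℝ} (hG : S.IsStateActionMatrix K G)
    {h : Matrix (Fin n) (Fin n) ℝ} (hh : h.IsSymm) {s : ℕ} (hs : 1 ≤ s)
    {x : EuclideanSpace ℝ (Fin n)} {u : Data n d} {τ : ℕ} {c : ℝ} (hc : 0 < c)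
    (hgram : ∀ y : EuclideanSpace ℝ (Sym2 (Fin n ⊕ Fin d)), c * ‖y‖ ^ 2 ≤
      ∑ j ∈ Finset.range τ, inner ℝ (outerVec (S.regressor K s x u j)) y ^ 2) :
    IsUnit ((S.designMatrix K s x.ofLp (fun t => (u.1 t).ofLp) (fun k => (u.2 k).ofLp) τ)ᵀ *
      S.designMatrix K s x.ofLp (fun t => (u.1 t).ofLp) (fun k => (u.2 k).ofLp) τ).det ∧
    frobNorm (G - S.estimate K s x.ofLp (fun t => (u.1 t).ofLp) (fun k => (u.2 k).ofLp) h τ) ≤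
      specNorm (LQProblem.valueMatrix K G - h) * frobNorm S.dyn ^ 2 +
        ‖S.noiseSum K h s x u τ‖ / c := by
  set Ψ := S.designMatrix K s x.ofLp (fun t => (u.1 t).ofLp) (fun k => (u.2 k).ofLp) τ with hΨ
  have hrow : ∀ k : Fin τ, Ψ k = (outerVec (S.regressor K s x u k)).ofLp := fun k => rfl
  obtain ⟨hu, hinv⟩ := gram_inv_bound (Ψ := Ψ) hc fun y => by
    have h1 := hgram (WithLp.toLp 2 y)
    rw [← real_inner_self_eq_norm_sq, inner_eq_dotProduct, Finset.sum_range] at h1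
    refine h1.trans (le_of_eq ?_)
    simp only [dotProduct, mulVec] at *
    refine Finset.sum_congr rfl fun k _ => ?_
    rw [inner_eq_dotProduct, hrow, sq]; rfl
  refine ⟨hu, ?_⟩
  set G' := S.costMatrix + S.dynᵀ * h * S.dyn with hG'
  have hG's : G'.IsSymm := by
    have h1 : S.costMatrix.IsSymm := by
      have hM : S.M.IsSymm := S.posDef_M.1
      have hN : S.N.IsSymm := S.posDef_N.1
      exact hM.fromBlocks (by simp) hN
    refine h1.add ?_
    rw [Matrix.IsSymm, transpose_mul, transpose_mul, transpose_transpose, hh.eq, Matrix.mul_assoc]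
  set ξ : Fin τ → ℝ := fun k =>
    noiseTerm S.W h (matE S.dyn (S.regressor K s x u k)) (u.1 (k * s + (s - 1))) with hξ
  have htarget : S.targetVec K s x.ofLp (fun t => (u.1 t).ofLp) (fun k => (u.2 k).ofLp) h τ =
      Ψ *ᵥ svec G' + ξ := by
    ext k
    rw [LQProblem.targetVec_eq hh hs, ← hG', ← svec_vecMulVec_dotProduct _ hG's]
    rfl
  have hnoise : (WithLp.toLp 2 (Ψᵀ *ᵥ ξ) : EuclideanSpace ℝ (Sym2 (Fin n ⊕ Fin d))) =
      S.noiseSum K h s x u τ := by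
    rw [LQProblem.noiseSum, Finset.sum_range]
    ext e
    simp only [mulVec, dotProduct, transpose_apply, WithLp.ofLp_sum, Finset.sum_apply,
      PiLp.smul_apply, smul_eq_mul, hrow, hξ]
    exact Finset.sum_congr rfl fun k _ => mul_comm _ _
  have hest : S.estimate K s x.ofLp (fun t => (u.1 t).ofLp) (fun k => (u.2 k).ofLp) h τ =
      G' + smat ((Ψᵀ * Ψ)⁻¹ *ᵥ (Ψᵀ *ᵥ ξ)) := by
    rw [LQProblem.estimate, htarget, ← hΨ, mulVec_add, mulVec_add, mulVec_mulVec _ Ψᵀ Ψ,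
      mulVec_mulVec _ (Ψᵀ * Ψ)⁻¹, Matrix.nonsing_inv_mul _ hu, one_mulVec, smat_add,
      smat_svec hG's]
  have hGe : G = S.dynᵀ * LQProblem.valueMatrix K G * S.dyn + S.costMatrix := by
    rw [← S.fromRows_transpose]; exact hG
  have e : G - S.estimate K s x.ofLp (fun t => (u.1 t).ofLp) (fun k => (u.2 k).ofLp) h τ =
      S.dynᵀ * (LQProblem.valueMatrix K G - h) * S.dyn +
        -smat ((Ψᵀ * Ψ)⁻¹ *ᵥ (Ψᵀ *ᵥ ξ)) := by
    rw [hest, Matrix.mul_sub, Matrix.sub_mul]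
    conv_lhs => rw [hGe]
    rw [hG']
    abel
  rw [e]
  refine (frobNorm_add_le _ _).trans (add_le_add (frobNorm_transpose_mul_mul_le _ _) ?_)
  have e2 : frobNorm (-smat ((Ψᵀ * Ψ)⁻¹ *ᵥ (Ψᵀ *ᵥ ξ))) =
      frobNorm (smat ((Ψᵀ * Ψ)⁻¹ *ᵥ (Ψᵀ *ᵥ ξ))) := by simp [frobNorm]
  rw [e2, frobNorm_smat, ← hnoise]
  exact hinv _

end EstimateError

section BurnIn

open Filter Topology

variable {n d : ℕ} {S : LQProblem n d} {K : Matrix (Fin d) (Fin n) ℝ}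
  {Sig : Matrix (Fin n) (Fin n) ℝ} {SigA : Matrix (Fin d) (Fin d) ℝ} {κ : ℝ}

lemma dotProduct_mulVec_le {ι : Type*} [Fintype ι] [DecidableEq ι] (T : Matrix ι ι ℝ)
    (y : ι → ℝ) : y ⬝ᵥ (T *ᵥ y) ≤ frobNorm T * (y ⬝ᵥ y) := by
  have h1 := real_inner_le_norm (WithLp.toLp 2 y : EuclideanSpace ℝ ι) (matE T (WithLp.toLp 2 y))
  have h2 := norm_matE_le T (WithLp.toLp 2 y)
  have h3 : y ⬝ᵥ y = ‖(WithLp.toLp 2 y : EuclideanSpace ℝ ι)‖ ^ 2 := by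
    rw [← real_inner_self_eq_norm_sq, inner_eq_dotProduct]
  rw [inner_eq_dotProduct] at h1
  refine h1.trans ?_
  rw [h3]
  nlinarith [norm_nonneg (WithLp.toLp 2 y : EuclideanSpace ℝ ι)]

/-- For a stable policy, every sufficiently long exploration period forgets initial states of a
given size. -/
lemma LQProblem.IsNondegenerate.exists_isBurnIn (hS : S.IsNondegenerate K Sig SigA κ)
    (hK : S.IsStable K) (α : ℝ) : ∃ s₀, ∀ s, s₀ ≤ s → S.IsBurnIn K Sig SigA κ α s := by
  have hL := hK.tendsto_pow
  have h1 : ∀ᶠ j in atTop, frobNorm (S.loop K ^ j) * α < √(Sig.trace + SigA.trace) := by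
    have := hL.mul_const α
    rw [zero_mul] at this
    exact this.eventually (gt_mem_nhds (Real.sqrt_pos.2 hS.trace_pos))
  have h2 : ∀ᶠ j in atTop, frobNorm S.dyn * (frobNorm (S.loop K ^ j) * α) < √κ := by
    have := (hL.mul_const α).const_mul (frobNorm S.dyn)
    rw [zero_mul, mul_zero] at this
    exact this.eventually (gt_mem_nhds (Real.sqrt_pos.2 hS.pos))
  have h3 : ∀ᶠ j in atTop,
      frobNorm (S.loop K ^ j) * frobNorm Sig * frobNorm (S.loop K ^ j) < κ / 2 := by
    have := (hL.mul_const (frobNorm Sig)).mul hL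
    rw [zero_mul, zero_mul] at this
    exact this.eventually (gt_mem_nhds (half_pos hS.pos))
  obtain ⟨j₀, hj⟩ := eventually_atTop.1 (h1.and (h2.and h3))
  refine ⟨j₀ + 1, fun s hs => ?_⟩
  obtain ⟨g1, g2, g3⟩ := hj (s - 1) (by lia)
  refine ⟨by lia, g1.le, g2.le, ?_⟩
  set L := S.loop K ^ (s - 1) with hLdef
  have hC : (loopCov (S.loop K) S.W (s - 1) -
      (κ / 2) • (1 : Matrix (Fin n) (Fin n) ℝ)).PosSemidef := by
    have e := eq_pow_mul_add_loopCov hS.stationary (s - 1)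
    have e1 : loopCov (S.loop K) S.W (s - 1) = Sig - L * Sig * Lᵀ :=
      eq_sub_of_add_eq' e.symm
    refine PosSemidef.of_dotProduct_mulVec_nonneg ?_ fun y => ?_
    · exact (posSemidef_loopCov _ S.posSemidef_W _).1.sub
        (by simp [Matrix.IsHermitian])
    · have h4 := hS.cov_state.dotProduct_mulVec_nonneg y
      have h5 := dotProduct_mulVec_le (L * Sig * Lᵀ) y
      have h6 : frobNorm (L * Sig * Lᵀ) ≤ κ / 2 := by
        refine ((frobNorm_mul_le _ _).trans ?_).trans g3.le
        rw [frobNorm_transpose]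
        exact mul_le_mul_of_nonneg_right (frobNorm_mul_le _ _) (frobNorm_nonneg _)
      have h7 : 0 ≤ y ⬝ᵥ y := by
        simpa using dotProduct_star_self_nonneg y
      have h8 := mul_le_mul_of_nonneg_right h6 h7
      simp only [star_trivial, sub_mulVec, dotProduct_sub, smul_mulVec, one_mulVec,
        dotProduct_smul, smul_eq_mul] at h4 ⊢
      rw [e1]
      simp only [sub_mulVec, dotProduct_sub]
      linarith
  refine posSemidef_diag_sub_smul_one hC ?_
  have := hS.cov_action.add ((Matrix.PosSemidef.one (n := Fin d) (R := ℝ)).smul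
    (half_pos hS.pos).le)
  convert this using 1
  module

end BurnIn

/-! ### The error bound with high probability -/

section Thresholds

lemma exp_one_le_three : Real.exp 1 ≤ 3 := by linarith [Real.exp_one_lt_d9]

lemma sqrt_add_one_le {τ : ℝ} (hτ : 1 ≤ τ) : √(τ + 1) ≤ 2 * √τ := by
  rw [show (2 : ℝ) * √τ = √(4 * τ) by
    rw [Real.sqrt_mul (by norm_num), show (4 : ℝ) = 2 ^ 2 by norm_num, Real.sqrt_sq (by norm_num)]]
  exact Real.sqrt_le_sqrt (by linarith)

/-- After sufficiently many exploratory tuples the fluctuation of the Gram matrix is dominated by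
its mean. -/
lemma designThreshold_le {κ t p l τ : ℝ} (hκ : 0 < κ) (hp : 0 ≤ p)
    (hpl : p ≤ 3 * l) (hl : 1 ≤ l) (hτ : (1 + 3 * 10 ^ 17 * t ^ 4 / κ ^ 4) * l ^ 6 ≤ τ) :
    1 ≤ τ ∧ Real.exp 1 * (100 * p * (8192 * (p * t) ^ 2) * √(τ + 1)) ≤ κ ^ 2 / 4 * τ := by
  have hl6 : 1 ≤ l ^ 6 := one_le_pow₀ hl
  have h0 : 0 ≤ 3 * 10 ^ 17 * t ^ 4 / κ ^ 4 := by positivity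
  have hτ1 : 1 ≤ τ := by nlinarith
  refine ⟨hτ1, ?_⟩
  have hp6 : p ^ 6 ≤ 729 * l ^ 6 := by
    calc p ^ 6 ≤ (3 * l) ^ 6 := pow_le_pow_left₀ hp hpl 6
      _ = 729 * l ^ 6 := by ring
  have h1 : 2 * 10 ^ 7 * p ^ 3 * t ^ 2 / κ ^ 2 ≤ √τ := by
    refine Real.le_sqrt_of_sq_le ?_
    refine le_trans ?_ hτ
    have h2 : (2 * 10 ^ 7 * p ^ 3 * t ^ 2 / κ ^ 2) ^ 2 = 4 * 10 ^ 14 * t ^ 4 / κ ^ 4 * p ^ 6 := by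
      field_simp
      norm_num
      ring
    rw [h2]
    have h3 : 0 ≤ 4 * 10 ^ 14 * t ^ 4 / κ ^ 4 := by positivity
    have h4 := mul_le_mul_of_nonneg_left hp6 h3
    have h5 : 0 ≤ t ^ 4 / κ ^ 4 * l ^ 6 := by positivity
    have e1 : 4 * 10 ^ 14 * t ^ 4 / κ ^ 4 * (729 * l ^ 6) =
        4 * 10 ^ 14 * 729 * (t ^ 4 / κ ^ 4 * l ^ 6) := by ring
    have e2 : (1 + 3 * 10 ^ 17 * t ^ 4 / κ ^ 4) * l ^ 6 =
        l ^ 6 + 3 * 10 ^ 17 * (t ^ 4 / κ ^ 4 * l ^ 6) := by ring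
    rw [e2]
    rw [e1] at h4
    linarith
  have h2 := mul_le_mul exp_one_le_three (mul_le_mul_of_nonneg_left (sqrt_add_one_le hτ1)
    (by positivity : 0 ≤ 100 * p * (8192 * (p * t) ^ 2))) (by positivity) (by norm_num)
  have h3 := Real.mul_self_sqrt (by linarith : 0 ≤ τ)
  rw [div_le_iff₀ (by positivity)] at h1
  have h4 := mul_le_mul_of_nonneg_right h1 (Real.sqrt_nonneg τ)
  have h5 : √τ * κ ^ 2 * √τ = κ ^ 2 * τ := by rw [mul_right_comm, h3, mul_comm]
  have h6 : 0 ≤ p ^ 3 * t ^ 2 * √τ := by positivity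
  have e1 : 100 * p * (8192 * (p * t) ^ 2) * (2 * √τ) = 1638400 * (p ^ 3 * t ^ 2 * √τ) := by ring
  rw [e1] at h2
  have e2 : 2 * 10 ^ 7 * p ^ 3 * t ^ 2 * √τ = 2 * 10 ^ 7 * (p ^ 3 * t ^ 2 * √τ) := by ring
  rw [e2, h5] at h4
  linarith

/-- The contribution of the regression noise to the error bound. -/
lemma noiseThreshold_le {κ X p l τ : ℝ} (hκ : 0 < κ) (hX : 0 ≤ X) (hp : 0 ≤ p)
    (hpl : p ≤ 3 * l) (hl : 1 ≤ l) (hτ : 1 ≤ τ) :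
    Real.exp 1 * (100 * p * (5000 / κ * p ^ 2 * X) * √(τ + 1)) / (κ ^ 2 / 4 * τ) ≤
      4 * 10 ^ 8 / κ ^ 3 * (τ ^ (-(1 / 2) : ℝ) * X * l ^ 6) := by
  have hp3 : p ^ 3 ≤ 27 * l ^ 6 := by
    calc p ^ 3 ≤ (3 * l) ^ 3 := pow_le_pow_left₀ hp hpl 3
      _ = 27 * l ^ 3 := by ring
      _ ≤ 27 * l ^ 6 := by
        have := pow_le_pow_right₀ hl (by norm_num : 3 ≤ 6)
        linarith
  have hτ0 : 0 < τ := by linarith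
  have h2 := mul_le_mul exp_one_le_three (mul_le_mul_of_nonneg_left (sqrt_add_one_le hτ)
    (by positivity : 0 ≤ 100 * p * (5000 / κ * p ^ 2 * X))) (by positivity) (by norm_num)
  have hrt : τ ^ (-(1 / 2) : ℝ) = √τ / τ := by
    rw [Real.rpow_neg hτ0.le, ← Real.sqrt_eq_rpow, eq_div_iff hτ0.ne', inv_mul_eq_div,
      Real.div_sqrt]
  rw [hrt]
  refine (div_le_div_of_nonneg_right h2 (by positivity)).trans ?_
  have e : 3 * (100 * p * (5000 / κ * p ^ 2 * X) * (2 * √τ)) / (κ ^ 2 / 4 * τ) =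
      1.2 * 10 ^ 7 / κ ^ 3 * (√τ / τ * X) * p ^ 3 := by
    field_simp
    ring
  rw [e]
  have h0 : 0 ≤ 1 / κ ^ 3 * (√τ / τ * X) := by positivity
  have h3 := mul_le_mul_of_nonneg_left hp3 h0
  have h4 : 0 ≤ 1 / κ ^ 3 * (√τ / τ * X) * l ^ 6 := by positivity
  calc 1.2 * 10 ^ 7 / κ ^ 3 * (√τ / τ * X) * p ^ 3
      = 1.2 * 10 ^ 7 * (1 / κ ^ 3 * (√τ / τ * X) * p ^ 3) := by ring
    _ ≤ 1.2 * 10 ^ 7 * (1 / κ ^ 3 * (√τ / τ * X) * (27 * l ^ 6)) := by linarith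
    _ ≤ 4 * 10 ^ 8 * (1 / κ ^ 3 * (√τ / τ * X) * l ^ 6) := by linarith
    _ = _ := by ring

end Thresholds

section HighProbability

variable {n d : ℕ} {S : LQProblem n d} {K : Matrix (Fin d) (Fin n) ℝ}
  {Sig : Matrix (Fin n) (Fin n) ℝ} {SigA : Matrix (Fin d) (Fin d) ℝ}
  {Ω : Type*} [MeasurableSpace Ω] {μ : Measure Ω} [IsProbabilityMeasure μ]
  {m₀ : EuclideanSpace ℝ (Fin n)} {Sig₀ : Matrix (Fin n) (Fin n) ℝ}
  {x₀ : Ω → EuclideanSpace ℝ (Fin n)} {Hhat : Ω → Matrix (Fin n) (Fin n) ℝ}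
  {w : ℕ → Ω → EuclideanSpace ℝ (Fin n)} {a : ℕ → Ω → EuclideanSpace ℝ (Fin d)} {κ α : ℝ}
  {s p : ℕ}

omit [IsProbabilityMeasure μ] in
lemma hasLaw_sub_mean {ι : Type*} [Fintype ι] [DecidableEq ι] {Q : Matrix ι ι ℝ}
    {m : EuclideanSpace ℝ ι} {X : Ω → EuclideanSpace ℝ ι}
    (hX : HasLaw X (multivariateGaussian m Q) μ) :
    HasLaw (fun ω => X ω - m) (multivariateGaussian 0 Q) μ := by
  have h1 : HasLaw (fun y : EuclideanSpace ℝ ι => y - m) (multivariateGaussian 0 Q)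
      (multivariateGaussian m Q) := by
    refine ⟨by fun_prop, ?_⟩
    rw [multivariateGaussian, multivariateGaussian, Measure.map_map (by fun_prop) (by fun_prop)]
    congr 1
    ext y : 1
    simp
  exact h1.comp hX

lemma IsDataCollection.momBd_init (h : IsDataCollection μ S.W SigA m₀ Sig₀ x₀ Hhat w a)
    (h0 : Sig₀.PosSemidef) {R : ℝ} (hm : ‖m₀‖ ≤ R) (hR : Sig₀.trace ≤ R) (hp : 1 ≤ p) :
    MomBd μ (2 * p) x₀ ((R + 4 * √R) * √p) := by
  have h1 := momBd_matE h0 (hasLaw_sub_mean h.law_init) (1 : Matrix (Fin n) (Fin n) ℝ) hp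
  simp only [matE_one, Matrix.one_mul, transpose_one, Matrix.mul_one] at h1
  have hR0 : 0 ≤ R := (norm_nonneg _).trans hm
  have h2 := momBd_of_sqrt_le (b := p * R) (c := 4) h1 (by norm_num) (by
    have := mul_le_mul_of_nonneg_left hR (by positivity : (0 : ℝ) ≤ p)
    nlinarith [mul_nonneg (Nat.cast_nonneg p : (0 : ℝ) ≤ p) hR0])
  have h3 := h2.add (by lia) (MomBd.const m₀)
  simp only [sub_add_cancel] at h3
  refine h3.mono ?_
  rw [Real.sqrt_mul (Nat.cast_nonneg p)]
  have h4 : 1 ≤ √(p : ℝ) := Real.one_le_sqrt.2 (by exact_mod_cast hp)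
  nlinarith

/-- With high probability the initial state is not too large, the Gram matrix is close to the sum
of its conditional means, and the accumulated regression noise is of order `√τ`. The initial state
and the estimate of the value matrix are independent of the data, and are frozen first. -/
lemma LQProblem.IsNondegenerate.measure_bad_le (hS : S.IsNondegenerate K Sig SigA κ)
    (h : IsDataCollection μ S.W SigA m₀ Sig₀ x₀ Hhat w a) (hs : S.IsBurnIn K Sig SigA κ α s)
    (hp : 2 ≤ p)
    (hα : frobNorm S.dyn * (8 * √(Sig.trace + SigA.trace)) + 7 * √S.W.trace ≤ α)
    (h0 : Sig₀.PosSemidef) {R : ℝ} (hm : ‖m₀‖ ≤ R) (hR : Sig₀.trace ≤ R)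
    (hRα : Real.exp 1 * (R + 4 * √R) ≤ α) (τ : ℕ) :
    μ {ω | ¬ (‖S.designSum K SigA s (x₀ ω) (dataOf w a ω) τ‖ ≤
        Real.exp 1 * (100 * p * (8192 * (p * (Sig.trace + SigA.trace)) ^ 2) * √(τ + 1)) ∧
      ‖S.noiseSum K (Hhat ω) s (x₀ ω) (dataOf w a ω) τ‖ ≤
        Real.exp 1 * (100 * p * (5000 / κ * p ^ 2 * frobNorm (S.W * Hhat ω) *
          (Sig.trace + SigA.trace) * frobNorm (S.nextCov Sig SigA)) * √(τ + 1)))} ≤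
      ENNReal.ofReal (3 * Real.exp (-(2 * p))) := by
  set ε := ENNReal.ofReal (Real.exp (-(2 * p))) with hε
  set b₁ : ℝ :=
    Real.exp 1 * (100 * p * (8192 * (p * (Sig.trace + SigA.trace)) ^ 2) * √(τ + 1)) with hb₁
  set b₂ : Matrix (Fin n) (Fin n) ℝ → ℝ := fun H' =>
    Real.exp 1 * (100 * p * (5000 / κ * p ^ 2 * frobNorm (S.W * H') *
          (Sig.trace + SigA.trace) * frobNorm (S.nextCov Sig SigA)) * √(τ + 1)) with hb₂
  set U : Ω → EuclideanSpace ℝ (Fin n) × (Fin n → Fin n → ℝ) :=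
    fun ω => (x₀ ω, fun i j => Hhat ω i j) with hU
  have hmU : Measurable U := h.measurable_init.prodMk
    (measurable_pi_lambda _ fun i => measurable_pi_lambda _ fun j => h.measurable_est i j)
  set B₁ : Set ((EuclideanSpace ℝ (Fin n) × (Fin n → Fin n → ℝ)) × Data n d) :=
    {z | ‖z.1.1‖ ≤ α * √p ∧ b₁ < ‖S.designSum K SigA s z.1.1 z.2 τ‖} with hB₁
  set B₂ : Set ((EuclideanSpace ℝ (Fin n) × (Fin n → Fin n → ℝ)) × Data n d) :=
    {z | ‖z.1.1‖ ≤ α * √p ∧ b₂ (Matrix.of z.1.2) < ‖S.noiseSum K (Matrix.of z.1.2) s z.1.1 z.2 τ‖}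
    with hB₂
  have hx : Measurable fun z : (EuclideanSpace ℝ (Fin n) × (Fin n → Fin n → ℝ)) × Data n d =>
      z.1.1 := by fun_prop
  have hh : Measurable fun z : (EuclideanSpace ℝ (Fin n) × (Fin n → Fin n → ℝ)) × Data n d =>
      z.1.2 := by fun_prop
  -- the restriction on the length of the frozen initial state makes the moment bounds applicable
  have hmx := measurableSet_le hx.norm (measurable_const (a := α * √(p : ℝ)))
  have hmB₁ : MeasurableSet B₁ :=
    hmx.inter (measurableSet_lt measurable_const
      ((measurable_designSum SigA s τ).comp (hx.prodMk measurable_snd)).norm)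
  have hcont : Continuous fun H' : Fin n → Fin n → ℝ => b₂ (Matrix.of H') := by
    simp only [hb₂, frobNorm, Matrix.mul_apply, Matrix.of_apply]
    fun_prop
  have hmB₂ : MeasurableSet B₂ :=
    hmx.inter (measurableSet_lt (hcont.measurable.comp hh) (measurable_noiseSum s τ).norm)
  -- Fubini's theorem for the independent pair `(U, data)`
  have freeze : ∀ B, MeasurableSet B → (∀ ω, μ {ω' | (U ω, dataOf w a ω') ∈ B} ≤ ε) →
      μ {ω | (U ω, dataOf w a ω) ∈ B} ≤ ε := fun B hB hle => by
    have hpre : ∀ u, MeasurableSet {ω' | (u, dataOf w a ω') ∈ B} := fun u =>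
      (measurable_const.prodMk h.measurable_dataOf) hB
    have h1 := IndepFun.lintegral_eq (μ := μ) hmU h.measurable_dataOf h.indep_init
      (f := B.indicator 1) (measurable_one.indicator hB)
    have h2 : ∫⁻ ω, B.indicator 1 (U ω, dataOf w a ω) ∂μ =
        μ {ω | (U ω, dataOf w a ω) ∈ B} :=
      lintegral_indicator_one ((hmU.prodMk h.measurable_dataOf) hB)
    rw [← h2, h1]
    calc _ ≤ ∫⁻ _, ε ∂μ := lintegral_mono fun ω => by
          exact le_trans (le_of_eq (lintegral_indicator_one (hpre (U ω)))) (hle ω)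
      _ = ε := by simp
  have e2p : ((2 * p : ℕ) : ℝ) = 2 * (p : ℝ) := by push_cast; ring
  have m1 : μ {ω | (U ω, dataOf w a ω) ∈ B₁} ≤ ε := freeze B₁ hmB₁ fun ω => by
    by_cases hxω : ‖x₀ ω‖ ≤ α * √p
    · have := (hS.momBd_designSum h hs hp hxω hα τ).markov (by lia)
      rw [e2p] at this
      exact (measure_mono fun ω' hω' => hω'.2).trans this
    · have e : {ω' | (U ω, dataOf w a ω') ∈ B₁} = ∅ :=
        Set.eq_empty_of_forall_notMem fun ω' hω' => hxω hω'.1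
      rw [e, measure_empty]
      exact bot_le
  have m2 : μ {ω | (U ω, dataOf w a ω) ∈ B₂} ≤ ε := freeze B₂ hmB₂ fun ω => by
    by_cases hxω : ‖x₀ ω‖ ≤ α * √p
    · have := (hS.momBd_noiseSum h hs hp hxω hα (h.isSymm_est ω) τ).markov (by lia)
      rw [e2p] at this
      exact (measure_mono fun ω' hω' => hω'.2).trans this
    · have e : {ω' | (U ω, dataOf w a ω') ∈ B₂} = ∅ :=
        Set.eq_empty_of_forall_notMem fun ω' hω' => hxω hω'.1
      rw [e, measure_empty]
      exact bot_le
  have m0 : μ {ω | α * √p < ‖x₀ ω‖} ≤ ε := by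
    have := (h.momBd_init h0 hm hR (p := p) (by lia)).markov (by lia)
    rw [e2p] at this
    refine (measure_mono fun ω hω => ?_).trans this
    have hω' : α * √p < ‖x₀ ω‖ := hω
    refine lt_of_le_of_lt ?_ hω'
    rw [← mul_assoc]
    exact mul_le_mul_of_nonneg_right hRα (Real.sqrt_nonneg _)
  have hsub : {ω | ¬ (‖S.designSum K SigA s (x₀ ω) (dataOf w a ω) τ‖ ≤ b₁ ∧
      ‖S.noiseSum K (Hhat ω) s (x₀ ω) (dataOf w a ω) τ‖ ≤ b₂ (Hhat ω))} ⊆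
      ({ω | α * √p < ‖x₀ ω‖} ∪ {ω | (U ω, dataOf w a ω) ∈ B₁}) ∪
        {ω | (U ω, dataOf w a ω) ∈ B₂} := by
    intro ω hω
    by_cases hxω : ‖x₀ ω‖ ≤ α * √p
    · rcases not_and_or.1 hω with h1 | h1
      · exact Or.inl (Or.inr ⟨hxω, not_le.1 h1⟩)
      · exact Or.inr ⟨hxω, not_le.1 h1⟩
    · exact Or.inl (Or.inl (not_le.1 hxω))
  calc _ ≤ (ε + ε) + ε := (measure_mono hsub).trans ((measure_union_le _ _).trans
        (add_le_add ((measure_union_le _ _).trans (add_le_add m0 m1)) m2))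
    _ = ENNReal.ofReal (3 * Real.exp (-(2 * p))) := by
      rw [hε, ← ENNReal.ofReal_add (by positivity) (by positivity),
        ← ENNReal.ofReal_add (by positivity) (by positivity)]
      congr 1; ring

end HighProbability

/-- On the event where both deviations are small, the error bound holds. -/
lemma LQProblem.IsNondegenerate.frobNorm_sub_estimate_le_errorBound {n d : ℕ} {S : LQProblem n d}
    {K : Matrix (Fin d) (Fin n) ℝ} {Sig : Matrix (Fin n) (Fin n) ℝ}
    {SigA : Matrix (Fin d) (Fin d) ℝ} {G : Matrix (Fin n ⊕ Fin d) (Fin n ⊕ Fin d) ℝ} {κ α : ℝ}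
    {s p : ℕ} (hS : S.IsNondegenerate K Sig SigA κ) (hG : S.IsStateActionMatrix K G)
    (hs : S.IsBurnIn K Sig SigA κ α s) {x : EuclideanSpace ℝ (Fin n)} {u : Data n d}
    {h : Matrix (Fin n) (Fin n) ℝ} (hh : h.IsSymm) {τ : ℕ} {δ : ℝ} (hδ : 0 < δ) (hδ1 : δ < 1)
    (hpl : (p : ℝ) ≤ 3 * (1 + Real.log (1 / δ)))
    (hτ : (1 + 3 * 10 ^ 17 * (Sig.trace + SigA.trace) ^ 4 / κ ^ 4) *
      (1 + Real.log (1 / δ)) ^ 6 ≤ τ)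
    (hD : ‖S.designSum K SigA s x u τ‖ ≤
      Real.exp 1 * (100 * p * (8192 * (p * (Sig.trace + SigA.trace)) ^ 2) * √(τ + 1)))
    (hN : ‖S.noiseSum K h s x u τ‖ ≤ Real.exp 1 * (100 * p * (5000 / κ * p ^ 2 *
      frobNorm (S.W * h) * (Sig.trace + SigA.trace) * frobNorm (S.nextCov Sig SigA)) * √(τ + 1))) :
    IsUnit ((S.designMatrix K s x.ofLp (fun t => (u.1 t).ofLp) (fun k => (u.2 k).ofLp) τ)ᵀ *
      S.designMatrix K s x.ofLp (fun t => (u.1 t).ofLp) (fun k => (u.2 k).ofLp) τ).det ∧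
    frobNorm (G - S.estimate K s x.ofLp (fun t => (u.1 t).ofLp) (fun k => (u.2 k).ofLp) h τ) ≤
      S.errorBound (1 / κ + 4 * 10 ^ 8 / κ ^ 3) 6 Sig SigA (LQProblem.valueMatrix K G) h δ τ := by
  have hκ := hS.pos
  have ht := hS.trace_nonneg
  have hl0 : 0 ≤ Real.log (1 / δ) := Real.log_nonneg (one_le_one_div hδ hδ1.le)
  obtain ⟨hτ1, hthr⟩ := designThreshold_le hκ (Nat.cast_nonneg p) hpl (by linarith) hτ
  have hτpos : (0 : ℝ) < τ := by linarith
  obtain ⟨hu, herr⟩ := hG.frobNorm_sub_estimate_le hh hs.one_le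
    (by positivity : 0 < κ ^ 2 / 4 * τ) (x := x) (u := u) (τ := τ) fun y => by
      have h1 := le_sum_inner_sq (half_pos hκ).le hs.cov (hD.trans hthr) y
      refine le_trans (le_of_eq ?_) h1
      ring
  refine ⟨hu, herr.trans ?_⟩
  set Λ : ℝ := 1 + Real.log ((n : ℝ) ^ 2) + Real.log (1 / δ) + Real.log τ with hΛ
  have hn0 : 0 ≤ Real.log ((n : ℝ) ^ 2) := by
    have := Real.log_natCast_nonneg (n ^ 2)
    rwa [Nat.cast_pow] at this
  have hτ0 : 0 ≤ Real.log (τ : ℝ) := Real.log_nonneg hτ1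
  set X : ℝ := frobNorm (S.W * h) * (Sig.trace + SigA.trace) * frobNorm (S.nextCov Sig SigA)
    with hX
  have hX0 : 0 ≤ X := mul_nonneg (mul_nonneg (frobNorm_nonneg _) ht) (frobNorm_nonneg _)
  have h2 := noiseThreshold_le hκ hX0 (Nat.cast_nonneg p)
    (by linarith : (p : ℝ) ≤ 3 * Λ) (by linarith) hτ1
  have h3 : ‖S.noiseSum K h s x u τ‖ / (κ ^ 2 / 4 * τ) ≤
      4 * 10 ^ 8 / κ ^ 3 * ((τ : ℝ) ^ (-(1 / 2) : ℝ) * X * Λ ^ 6) := by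
    refine le_trans (div_le_div_of_nonneg_right (hN.trans (le_of_eq ?_)) (by positivity)) h2
    rw [hX]; ring
  have h4 : specNorm (LQProblem.valueMatrix K G - h) * frobNorm S.dyn ^ 2 ≤
      1 / κ * ((S.nextCov Sig SigA).trace * specNorm (LQProblem.valueMatrix K G - h)) := by
    have h5 : frobNorm S.dyn ^ 2 ≤ 1 / κ * (S.nextCov Sig SigA).trace := by
      rw [one_div, inv_mul_eq_div, le_div_iff₀ hκ, mul_comm]
      exact S.smul_frobNorm_dyn_sq_le hS.cov_state hS.cov_action
    have h6 : 0 ≤ specNorm (LQProblem.valueMatrix K G - h) := norm_nonneg _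
    have := mul_le_mul_of_nonneg_left h5 h6
    linarith
  have hΛ6 : 0 ≤ Λ ^ 6 := pow_nonneg (by linarith) 6
  have h7 : 0 ≤ (τ : ℝ) ^ (-(1 / 2) : ℝ) * X * Λ ^ 6 :=
    mul_nonneg (mul_nonneg (by positivity) hX0) hΛ6
  have h8 : 0 ≤ (S.nextCov Sig SigA).trace * specNorm (LQProblem.valueMatrix K G - h) := by
    refine mul_nonneg ?_ (norm_nonneg _)
    refine le_trans ?_ (S.smul_frobNorm_dyn_sq_le hS.cov_state hS.cov_action)
    positivity
  have h9 : 0 ≤ 4 * 10 ^ 8 / κ ^ 3 := by positivity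
  have h10 : 0 ≤ 1 / κ := by positivity
  rw [LQProblem.errorBound, ← hΛ]
  have e : (τ : ℝ) ^ (-(1 / 2) : ℝ) * frobNorm (S.W * h) * (Sig.trace + SigA.trace) *
      frobNorm (S.nextCov Sig SigA) * Λ ^ 6 = (τ : ℝ) ^ (-(1 / 2) : ℝ) * X * Λ ^ 6 := by
    rw [hX]; ring
  rw [e]
  have h11 := mul_nonneg h9 h8
  have h12 := mul_nonneg h10 h7
  rw [add_mul, mul_add, mul_add]
  linarith

end

theorem mainTheorem5 :
    ∃ q : ℕ, ∀ κ : ℝ, 0 < κ → ∃ C : ℝ, 0 < C ∧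
      ∀ (n d : ℕ) (S : LQProblem n d) (K : Matrix (Fin d) (Fin n) ℝ)
        (Sig : Matrix (Fin n) (Fin n) ℝ) (SigA : Matrix (Fin d) (Fin d) ℝ)
        (G : Matrix (Fin n ⊕ Fin d) (Fin n ⊕ Fin d) ℝ),
        S.IsStable K →
        S.IsStationaryCov K Sig →
        S.IsStateActionMatrix K G →
        -- nondegeneracy: `Σ ⪰ κ I`, `Σₐ ⪰ κ I`, every nonzero eigenvalue of `W` is at least `κ`,
        -- and `‖Σ_G‖_F ≥ κ`
        (Sig - κ • (1 : Matrix (Fin n) (Fin n) ℝ)).PosSemidef →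
        (SigA - κ • (1 : Matrix (Fin d) (Fin d) ℝ)).PosSemidef →
        (S.W * S.W - κ • S.W).PosSemidef →
        κ ≤ frobNorm (S.nextCov Sig SigA) →
        ∀ R : ℝ, ∃ (s₀ : ℕ) (τ₀ : ℝ),
          ∀ (Ω : Type u) [MeasurableSpace Ω] (μ : Measure Ω) [IsProbabilityMeasure μ]
            (m₀ : EuclideanSpace ℝ (Fin n)) (Sig₀ : Matrix (Fin n) (Fin n) ℝ)
            (x₀ : Ω → EuclideanSpace ℝ (Fin n)) (Hhat : Ω → Matrix (Fin n) (Fin n) ℝ)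
            (w : ℕ → Ω → EuclideanSpace ℝ (Fin n)) (a : ℕ → Ω → EuclideanSpace ℝ (Fin d)),
            Sig₀.PosSemidef → ‖m₀‖ ≤ R → Sig₀.trace ≤ R →
            IsDataCollection μ S.W SigA m₀ Sig₀ x₀ Hhat w a →
            ∀ (s τ : ℕ) (δ : ℝ), s₀ ≤ s → 0 < δ → δ < 1 →
              τ₀ * (1 + Real.log (1 / δ)) ^ q ≤ τ →
              -- the event in question fails with probability at most `δ`
              μ {ω | ¬ (
                IsUnit ((S.designMatrix K s (x₀ ω).ofLp (fun t => (w t ω).ofLp)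
                  (fun k => (a k ω).ofLp) τ)ᵀ *
                  S.designMatrix K s (x₀ ω).ofLp (fun t => (w t ω).ofLp)
                  (fun k => (a k ω).ofLp) τ).det ∧
                frobNorm (G - S.estimate K s (x₀ ω).ofLp (fun t => (w t ω).ofLp)
                  (fun k => (a k ω).ofLp) (Hhat ω) τ)
                  ≤ S.errorBound C q Sig SigA (LQProblem.valueMatrix K G) (Hhat ω) δ τ ∧
                ∀ P, IsFrobProj S.costMatrix
                    (S.estimate K s (x₀ ω).ofLp (fun t => (w t ω).ofLp)
                  (fun k => (a k ω).ofLp) (Hhat ω) τ) P →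
                  frobNorm (G - P)
                    ≤ S.errorBound C q Sig SigA (LQProblem.valueMatrix K G) (Hhat ω) δ τ)}
                ≤ ENNReal.ofReal δ := by
  refine ⟨6, fun κ hκ => ⟨1 / κ + 4 * 10 ^ 8 / κ ^ 3, by positivity, ?_⟩⟩
  intro n d S K Sig SigA G hK hst hG hSig hA hW hf R
  have hS : S.IsNondegenerate K Sig SigA κ := ⟨hκ, hst, hSig, hA, hW, hf⟩
  set α : ℝ := Real.exp 1 * (|R| + 4 * √|R|) +
    (frobNorm S.dyn * (8 * √(Sig.trace + SigA.trace)) + 7 * √S.W.trace) with hα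
  have h1 : 0 ≤ Real.exp 1 * (|R| + 4 * √|R|) := by positivity
  have h2 : 0 ≤ frobNorm S.dyn * (8 * √(Sig.trace + SigA.trace)) + 7 * √S.W.trace :=
    add_nonneg (mul_nonneg (frobNorm_nonneg _) (by positivity)) (by positivity)
  obtain ⟨s₀, hs₀⟩ := hS.exists_isBurnIn hK α
  refine ⟨s₀, 1 + 3 * 10 ^ 17 * (Sig.trace + SigA.trace) ^ 4 / κ ^ 4, ?_⟩
  intro Ω _ μ _ m₀ Sig₀ x₀ Hhat w a h0 hm hR h s τ δ hs hδ hδ1 hτ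
  -- the moments of order `2 p` are used, with `exp (-2 p)` smaller than `δ / 3`
  set p : ℕ := ⌈Real.log (1 / δ)⌉₊ + 2 with hp
  have hl0 : 0 ≤ Real.log (1 / δ) := Real.log_nonneg (one_le_one_div hδ hδ1.le)
  have hp1 : Real.log (1 / δ) + 2 ≤ p := by
    rw [hp]; push_cast; linarith [Nat.le_ceil (Real.log (1 / δ))]
  have hp2 : (p : ℝ) ≤ 3 * (1 + Real.log (1 / δ)) := by
    rw [hp]; push_cast; linarith [Nat.ceil_lt_add_one hl0]
  have hbad := hS.measure_bad_le h (hs₀ s hs) (p := p) (by lia) (by linarith) h0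
    (hm.trans (le_abs_self R)) (hR.trans (le_abs_self R)) (by linarith) τ
  have hexp : 3 * Real.exp (-(2 * p)) ≤ δ := by
    have h3 : Real.exp (-(2 * p)) ≤ Real.exp (Real.log δ - 2) := by
      refine Real.exp_le_exp.2 ?_
      rw [one_div, Real.log_inv] at hp1 hl0
      linarith
    rw [Real.exp_sub, Real.exp_log hδ] at h3
    have h4 := Real.add_one_le_exp (2 : ℝ)
    have h5 : δ / Real.exp 2 ≤ δ / 3 := div_le_div_of_nonneg_left hδ.le (by norm_num) (by linarith)
    linarith
  refine le_trans (measure_mono ?_) (hbad.trans (ENNReal.ofReal_le_ofReal hexp))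
  intro ω hω hgood
  obtain ⟨hu, herr⟩ := hS.frobNorm_sub_estimate_le_errorBound hG (hs₀ s hs) (h.isSymm_est ω)
    hδ hδ1 hp2 hτ hgood.1 hgood.2
  exact hω ⟨hu, herr, fun P hP => (hP.frobNorm_sub_le (hG.posSemidef_sub hK)).trans herr⟩
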